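/- **Setting.** Let $\Bbbk$ be a field. All graded vector spaces are $\mathbb N_0$-graded. A differential calculus (DC) on an algebra $A$ is a differential graded algebra (DGA) $(\Omega^\bullet,\wedge,\mathrm d)$ with $\Omega^0=A$ and $\Omega^n=\mathrm{span}_\Bbbk\{a^0\mathrm da^1\wedge\dots\wedge\mathrm da^n\}$ for all $n\ge 1$. The tensor product of two DGAs carries the product $(\omega\otimes\omega')(\eta\otimes\eta')=(-1)^{|\omega'||\eta|}\omega\eta\otimes\omega'\eta'$ and the differential $\mathrm d_\otimes(\omega\otimes\omega')=\mathrm d\omega\otimes\omega'+(-1)^{|\omega|}\omega\otimes\mathrm d\omega'$. DGA morphisms have degree $0$ and respect products, units and differentials. Let $H$ be a Hopf algebra over $\Bbbk$ with invertible antipode $S$, and let $A$ be a right $H$-comodule algebra with coaction $\Delta_A\colon A\to A\otimes H$ such that $B:=A^{\mathrm{co}H}\subseteq A$ is a quantum principal bundle, i.e. $A\otimes_BA\to A\otimes H$, $a\otimes_B a'\mapsto a\,\Delta_A(a')$, is bijective and $A$ is faithfully flat as a right $B$-module. Let $\Omega^\bullet(H)$ be the maximal prolongation of a bicovariant first order differential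 calculus on $H$, and let $\Omega^\bullet(A)$ be a complete calculus on $A$: a DC such that $\Delta_A$ extends to a DGA morphism $\Delta_A^\bullet\colon\Omega^\bullet(A)\to\Omega^\bullet(A)\otimes\Omega^\bullet(H)$, $\omega\mapsto\omega_{[0]}\otimes\omega_{[1]}$. Let $\Omega^\bullet(B):=\{\omega\in\Omega^\bullet(A)\mid\Delta_A^\bullet(\omega)=\omega\otimes 1\}$ and $E:=\Omega^\bullet(A)\otimes_{\Omega^\bullet(B)}\Omega^\bullet(A)$, graded by total degree. **Proposition.** The canonical map $$\chi^\bullet\colon E\to\Omega^\bullet(A)\otimes\Omega^\bullet(H),\qquad \omega\otimes\eta\mapsto\omega\wedge\eta_{[0]}\otimes\eta_{[1]}$$ is bijective. Set $\tau^\bullet(\theta):=(\chi^\bullet)^{-1}(1\otimes\theta)$ for $\theta\in\Omega^\bullet(H)$ and $$\sigma^\bullet\colon E\to E,\qquad\sigma^\bullet(\omega\otimes\eta):=(-1)^{|\omega_{[1]}||\eta|}\,\omega_{[0]}\wedge\eta\wedge\tau^\bullet(\omega_{[1]}).$$ Endow $E$ with the product $x\wedge_{\otimes_B}y:=(\chi^\bullet)^{-1}(\chi^\bullet(x)\,\chi^\bullet(y))$,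 the unit $1\otimes1$ and the differential $\mathrm d_{\otimes_B}(\omega\otimes\eta):=\mathrm d\omega\otimes\eta+(-1)^{|\omega|}\omega\otimes\mathrm d\eta$. Then: 1. $E$ is a DGA, and $\chi^\bullet\colon E\to\Omega^\bullet(A)\otimes\Omega^\bullet(H)$ and $\tau^\bullet\colon\Omega^\bullet(H)\to E$ are DGA morphisms. 2. $\sigma^\bullet$ has degree $0$ and is an isomorphism of $\Omega^\bullet(B)$-bimodules. More precisely, the comultiplication of $H$ extends to a DGA morphism $\Delta^\bullet\colon\Omega^\bullet(H)\to\Omega^\bullet(H)\otimes\Omega^\bullet(H)$; with $\Delta^\bullet$ as comultiplication, and with the counit of $H$ extended by $0$ to positive degrees, $\Omega^\bullet(H)$ has a bijective antipode $S^\bullet$, given by $$S^\bullet(h^0\mathrm dh^1\wedge\dots\wedge\mathrm dh^n)=(-1)^{n(n-1)/2}\,\mathrm d(S(h^n))\wedge\dots\wedge\mathrm d(S(h^1))\,S(h^0);$$ and the inverse of $\sigma^\bullet$ is $$(\sigma^\bullet)^{-1}(\omega\otimes\eta)=(-1)^{(|\omega|+|\eta_{[0]}|)|\eta_{[1]}|}\,\tau^\bullet\big((S^\bullet)^{-1}(\eta_{[1]})\big)\wedge\omega\wedge\eta_{[0]}.$$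 3. On $\Omega^\bullet(A)\otimes_{\Omega^\bullet(B)}\Omega^\bullet(A)\otimes_{\Omega^\bullet(B)}\Omega^\bullet(A)$ the braid equation holds: $(\sigma^\bullet\otimes\mathrm{id})(\mathrm{id}\otimes\sigma^\bullet)(\sigma^\bullet\otimes\mathrm{id})=(\mathrm{id}\otimes\sigma^\bullet)(\sigma^\bullet\otimes\mathrm{id})(\mathrm{id}\otimes\sigma^\bullet)$. 4. $\wedge\circ\sigma^\bullet=\wedge$, where $\wedge\colon E\to\Omega^\bullet(A)$ is the wedge product. 5. The hexagon identities hold as maps from the triple tensor product to $E$: $$\sigma^\bullet\circ(\wedge\otimes\mathrm{id})=(\mathrm{id}\otimes\wedge)(\sigma^\bullet\otimes\mathrm{id})(\mathrm{id}\otimes\sigma^\bullet),\qquad \sigma^\bullet\circ(\mathrm{id}\otimes\wedge)=(\wedge\otimes\mathrm{id})(\mathrm{id}\otimes\sigma^\bullet)(\sigma^\bullet\otimes\mathrm{id}).$$ -/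

import Mathlib

open scoped TensorProduct

namespace QPB

universe u v w

noncomputable section

/-! ## Balanced tensor products over a (noncommutative) subalgebra -/

section Balanced

variable {k : Type*} [Field k] {Ω : Type*} [Ring Ω] [Algebra k Ω] (B : Subalgebra k Ω)

/-- The relations `x b ⊗ y = x ⊗ b y`, for `b ∈ B`. A right `Ω`-action is a `Ωᵐᵒᵖ`-action. -/
def balRel (X Y : Type*) [AddCommGroup X] [Module k X] [Module Ωᵐᵒᵖ X]
    [AddCommGroup Y] [Module k Y] [Module B Y] : Submodule k (X ⊗[k] Y) :=
  Submodule.span k {z | ∃ (x : X) (b : B) (y : Y),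
    z = (MulOpposite.op (b : Ω) • x) ⊗ₜ[k] y - x ⊗ₜ[k] (b • y)}

/-- The balanced tensor product `X ⊗_B Y` of a right `Ω`-module `X` (restricted to `B`) and a left
`B`-module `Y`. -/
def Bal (X Y : Type*) [AddCommGroup X] [Module k X] [Module Ωᵐᵒᵖ X]
    [AddCommGroup Y] [Module k Y] [Module B Y] : Type _ :=
  (X ⊗[k] Y) ⧸ balRel B X Y

namespace Bal

section Basic

variable (X Y : Type*) [AddCommGroup X] [Module k X] [Module Ωᵐᵒᵖ X]
    [AddCommGroup Y] [Module k Y] [Module B Y]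

instance : AddCommGroup (Bal B X Y) :=
  inferInstanceAs (AddCommGroup ((X ⊗[k] Y) ⧸ balRel B X Y))

instance : Module k (Bal B X Y) :=
  inferInstanceAs (Module k ((X ⊗[k] Y) ⧸ balRel B X Y))

/-- The quotient map `X ⊗ Y → X ⊗_B Y`. -/
def proj : X ⊗[k] Y →ₗ[k] Bal B X Y := (balRel B X Y).mkQ

variable {X Y}

/-- The class of `x ⊗ y` in `X ⊗_B Y`. -/
def tmul (x : X) (y : Y) : Bal B X Y := proj B X Y (x ⊗ₜ[k] y)

variable (X Y) in
/-- The class of `x ⊗ y` in `X ⊗_B Y`, as a bilinear map. -/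
def mk : X →ₗ[k] Y →ₗ[k] Bal B X Y := (TensorProduct.mk k X Y).compr₂ (proj B X Y)

@[simp]
theorem mk_apply (x : X) (y : Y) : mk B X Y x y = tmul B x y := rfl

theorem tmul_balanced (x : X) (b : B) (y : Y) :
    tmul B (MulOpposite.op (b : Ω) • x) y = tmul B x (b • y) := by
  refine (Submodule.Quotient.eq _).2 (Submodule.subset_span ⟨x, b, y, rfl⟩)

theorem add_tmul (x x' : X) (y : Y) : tmul B (x + x') y = tmul B x y + tmul B x' y :=
  LinearMap.map_add₂ (mk B X Y) x x' y

theorem tmul_add (x : X) (y y' : Y) : tmul B x (y + y') = tmul B x y + tmul B x y' :=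
  map_add (mk B X Y x) y y'

theorem smul_tmul (c : k) (x : X) (y : Y) : tmul B (c • x) y = c • tmul B x y :=
  LinearMap.map_smul₂ (mk B X Y) c x y

theorem tmul_smul (c : k) (x : X) (y : Y) : tmul B x (c • y) = c • tmul B x y :=
  map_smul (mk B X Y x) c y

theorem zero_tmul (y : Y) : tmul B (0 : X) y = 0 := LinearMap.map_zero₂ (mk B X Y) y

theorem tmul_zero (x : X) : tmul B x (0 : Y) = 0 := map_zero (mk B X Y x)

@[elab_as_elim]
theorem induction {p : Bal B X Y → Prop} (z : Bal B X Y) (h0 : p 0)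
    (ht : ∀ x y, p (tmul B x y)) (ha : ∀ z z', p z → p z' → p (z + z')) : p z := by
  obtain ⟨t, rfl⟩ := Submodule.mkQ_surjective (balRel B X Y) z
  change p (proj B X Y t)
  induction t using TensorProduct.induction_on with
  | zero => rw [map_zero]; exact h0
  | tmul x y => exact ht x y
  | add a b hha hhb => rw [map_add]; exact ha _ _ hha hhb

variable {Z : Type*} [AddCommGroup Z] [Module k Z]

/-- A `B`-balanced bilinear map factors through `X ⊗_B Y`. -/
def lift (f : X →ₗ[k] Y →ₗ[k] Z)
    (hf : ∀ (x : X) (b : B) (y : Y), f (MulOpposite.op (b : Ω) • x) y = f x (b • y)) :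
    Bal B X Y →ₗ[k] Z :=
  (balRel B X Y).liftQ (TensorProduct.lift f) (by
    refine Submodule.span_le.2 ?_
    rintro _ ⟨x, b, y, rfl⟩
    simp [hf])

@[simp]
theorem lift_tmul (f : X →ₗ[k] Y →ₗ[k] Z)
    (hf : ∀ (x : X) (b : B) (y : Y), f (MulOpposite.op (b : Ω) • x) y = f x (b • y))
    (x : X) (y : Y) : lift B f hf (tmul B x y) = f x y :=
  rfl

theorem hom_ext {f g : Bal B X Y →ₗ[k] Z} (h : ∀ x y, f (tmul B x y) = g (tmul B x y)) :
    f = g := by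
  ext z
  induction z using Bal.induction with
  | h0 => simp
  | ht x y => exact h x y
  | ha z z' hz hz' => simp [hz, hz']

end Basic

section Functoriality

variable {X X' Y Y' : Type*} [AddCommGroup X] [Module k X] [Module Ωᵐᵒᵖ X]
    [AddCommGroup X'] [Module k X'] [Module Ωᵐᵒᵖ X']
    [AddCommGroup Y] [Module k Y] [Module B Y] [AddCommGroup Y'] [Module k Y'] [Module B Y']

/-- `f ⊗_B id` for a right `B`-linear map `f`. -/
def rmap (Y : Type*) [AddCommGroup Y] [Module k Y] [Module B Y] (f : X →ₗ[k] X')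
    (hf : ∀ (b : B) (x : X), f (MulOpposite.op (b : Ω) • x) = MulOpposite.op (b : Ω) • f x) :
    Bal B X Y →ₗ[k] Bal B X' Y :=
  lift B (LinearMap.mk₂ k (fun x y => tmul B (f x) y)
    (by intros; rw [map_add, add_tmul]) (by intros; rw [map_smul, smul_tmul])
    (by intros; rw [tmul_add]) (by intros; rw [tmul_smul]))
    (by intro x b y; simp only [LinearMap.mk₂_apply]; rw [hf, tmul_balanced])

/-- `id ⊗_B g` for a left `B`-linear map `g`. -/
def lmap (X : Type*) [AddCommGroup X] [Module k X] [Module Ωᵐᵒᵖ X] (g : Y →ₗ[k] Y')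
    (hg : ∀ (b : B) (y : Y), g (b • y) = b • g y) :
    Bal B X Y →ₗ[k] Bal B X Y' :=
  lift B (LinearMap.mk₂ k (fun x y => tmul B x (g y))
    (by intros; rw [add_tmul]) (by intros; rw [smul_tmul])
    (by intros; rw [map_add, tmul_add]) (by intros; rw [map_smul, tmul_smul]))
    (by intro x b y; simp only [LinearMap.mk₂_apply]; rw [hg, tmul_balanced])

@[simp]
theorem rmap_tmul (f : X →ₗ[k] X')
    (hf : ∀ (b : B) (x : X), f (MulOpposite.op (b : Ω) • x) = MulOpposite.op (b : Ω) • f x)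
    (x : X) (y : Y) : rmap B Y f hf (tmul B x y) = tmul B (f x) y :=
  rfl

@[simp]
theorem lmap_tmul (g : Y →ₗ[k] Y') (hg : ∀ (b : B) (y : Y), g (b • y) = b • g y)
    (x : X) (y : Y) : lmap B X g hg (tmul B x y) = tmul B x (g y) :=
  rfl

end Functoriality

section Actions

variable {X Y : Type*} [AddCommGroup X] [Module k X] [Module Ωᵐᵒᵖ X]
    [AddCommGroup Y] [Module k Y] [Module B Y]

variable (X Y) in
/-- Left multiplication by `a : Ω` on `X ⊗_B Y`. -/
def leftMul [Module Ω X] [IsScalarTower k Ω X] [SMulCommClass Ω Ωᵐᵒᵖ X] (a : Ω) :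
    Bal B X Y →ₗ[k] Bal B X Y :=
  rmap B Y (Algebra.lsmul k k X a) (fun b x => smul_comm a (MulOpposite.op (b : Ω)) x)

/-- The left action of `Ω` on `X ⊗_B Y` through the first factor. -/
instance leftModule [Module Ω X] [IsScalarTower k Ω X] [SMulCommClass Ω Ωᵐᵒᵖ X] :
    Module Ω (Bal B X Y) where
  smul a z := leftMul B X Y a z
  one_smul := LinearMap.congr_fun (f := leftMul B X Y 1) (g := LinearMap.id)
    (hom_ext B fun x y => congrArg (fun t => tmul B t y) (one_smul Ω x))
  mul_smul a b := LinearMap.congr_fun (f := leftMul B X Y (a * b))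
    (g := leftMul B X Y a ∘ₗ leftMul B X Y b)
    (hom_ext B fun x y => congrArg (fun t => tmul B t y) (mul_smul a b x))
  smul_zero a := map_zero (leftMul B X Y a)
  smul_add a z z' := map_add (leftMul B X Y a) z z'
  add_smul a b := LinearMap.congr_fun (f := leftMul B X Y (a + b))
    (g := leftMul B X Y a + leftMul B X Y b)
    (hom_ext B fun x y => (congrArg (fun t => tmul B t y) (add_smul a b x)).trans
      (add_tmul B _ _ _))
  zero_smul := LinearMap.congr_fun (f := leftMul B X Y 0) (g := 0)
    (hom_ext B fun x y => (congrArg (fun t => tmul B t y) (zero_smul Ω x)).trans (zero_tmul B _))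

theorem leftMul_smul [Module Ω X] [IsScalarTower k Ω X] [SMulCommClass Ω Ωᵐᵒᵖ X]
    (c : k) (a : Ω) : leftMul B X Y (c • a) = c • leftMul B X Y a :=
  hom_ext B fun x y => (congrArg (fun t => tmul B t y) (smul_assoc c a x)).trans
    (smul_tmul B c (a • x) y)

theorem smul_tmul_left [Module Ω X] [IsScalarTower k Ω X] [SMulCommClass Ω Ωᵐᵒᵖ X]
    (a : Ω) (x : X) (y : Y) : a • tmul B x y = tmul B (a • x) y :=
  rfl

variable (X Y) in
/-- Right multiplication by `a : Ω` on `X ⊗_B Y`. -/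
def rightMul [Module Ωᵐᵒᵖ Y] [IsScalarTower k Ωᵐᵒᵖ Y] [SMulCommClass B Ωᵐᵒᵖ Y] (a : Ωᵐᵒᵖ) :
    Bal B X Y →ₗ[k] Bal B X Y :=
  lmap B X (Algebra.lsmul k k Y a) (fun b y => (smul_comm b a y).symm)

/-- The right action of `Ω` on `X ⊗_B Y` through the second factor. -/
instance rightModule [Module Ωᵐᵒᵖ Y] [IsScalarTower k Ωᵐᵒᵖ Y] [SMulCommClass B Ωᵐᵒᵖ Y] :
    Module Ωᵐᵒᵖ (Bal B X Y) where
  smul a z := rightMul B X Y a z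
  one_smul := LinearMap.congr_fun (f := rightMul B X Y 1) (g := LinearMap.id)
    (hom_ext B fun x y => congrArg (fun t => tmul B x t) (one_smul Ωᵐᵒᵖ y))
  mul_smul a b := LinearMap.congr_fun (f := rightMul B X Y (a * b))
    (g := rightMul B X Y a ∘ₗ rightMul B X Y b)
    (hom_ext B fun x y => congrArg (fun t => tmul B x t) (mul_smul a b y))
  smul_zero a := map_zero (rightMul B X Y a)
  smul_add a z z' := map_add (rightMul B X Y a) z z'
  add_smul a b := LinearMap.congr_fun (f := rightMul B X Y (a + b))
    (g := rightMul B X Y a + rightMul B X Y b)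
    (hom_ext B fun x y => (congrArg (fun t => tmul B x t) (add_smul a b y)).trans
      (tmul_add B _ _ _))
  zero_smul := LinearMap.congr_fun (f := rightMul B X Y 0) (g := 0)
    (hom_ext B fun x y => (congrArg (fun t => tmul B x t) (zero_smul Ωᵐᵒᵖ y)).trans
      (tmul_zero B _))

theorem rightMul_smul [Module Ωᵐᵒᵖ Y] [IsScalarTower k Ωᵐᵒᵖ Y] [SMulCommClass B Ωᵐᵒᵖ Y]
    (c : k) (a : Ωᵐᵒᵖ) : rightMul B X Y (c • a) = c • rightMul B X Y a :=
  hom_ext B fun x y => (congrArg (fun t => tmul B x t) (smul_assoc c a y)).trans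
    (tmul_smul B c x (a • y))

theorem smul_tmul_right [Module Ωᵐᵒᵖ Y] [IsScalarTower k Ωᵐᵒᵖ Y] [SMulCommClass B Ωᵐᵒᵖ Y]
    (a : Ωᵐᵒᵖ) (x : X) (y : Y) : a • tmul B x y = tmul B x (a • y) :=
  rfl

end Actions

section Associator

/-- For fixed `z`, the map `x ⊗ y ↦ x ⊗ (y ⊗ z)`. -/
def assocHomAux (z : Ω) : Bal B Ω Ω →ₗ[k] Bal B Ω (Bal B Ω Ω) :=
  lmap B Ω ((mk B Ω Ω).flip z) (fun _ _ => rfl)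

/-- The map `(x ⊗ y) ⊗ z ↦ x ⊗ (y ⊗ z)`. -/
def assocHom : Bal B (Bal B Ω Ω) Ω →ₗ[k] Bal B Ω (Bal B Ω Ω) :=
  lift B
    (LinearMap.mk₂ k (fun t z => assocHomAux B z t)
      (fun t t' z => map_add (assocHomAux B z) t t')
      (fun c t z => map_smul (assocHomAux B z) c t)
      (fun t z z' => LinearMap.congr_fun (f := assocHomAux B (z + z'))
        (g := assocHomAux B z + assocHomAux B z')
        (hom_ext B fun x y => (congrArg (fun u => tmul B x u) (tmul_add B y z z')).trans
          (tmul_add B _ _ _)) t)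
      (fun c t z => LinearMap.congr_fun (f := assocHomAux B (c • z)) (g := c • assocHomAux B z)
        (hom_ext B fun x y => (congrArg (fun u => tmul B x u) (tmul_smul B c y z)).trans
          (tmul_smul B _ _ _)) t))
    (fun t b z => LinearMap.congr_fun
      (f := assocHomAux B z ∘ₗ rightMul B Ω Ω (MulOpposite.op (b : Ω)))
      (g := assocHomAux B (b • z))
      (hom_ext B fun x y => congrArg (fun u => tmul B x u) (tmul_balanced B y b z)) t)

/-- For fixed `x`, the map `y ⊗ z ↦ (x ⊗ y) ⊗ z`. -/
def assocInvAux (x : Ω) : Bal B Ω Ω →ₗ[k] Bal B (Bal B Ω Ω) Ω :=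
  rmap B Ω (mk B Ω Ω x) (fun _ _ => rfl)

/-- The map `x ⊗ (y ⊗ z) ↦ (x ⊗ y) ⊗ z`. -/
def assocInv : Bal B Ω (Bal B Ω Ω) →ₗ[k] Bal B (Bal B Ω Ω) Ω :=
  lift B
    (LinearMap.mk₂ k (fun x t => assocInvAux B x t)
      (fun x x' t => LinearMap.congr_fun (f := assocInvAux B (x + x'))
        (g := assocInvAux B x + assocInvAux B x')
        (hom_ext B fun y z => (congrArg (fun u => tmul B u z) (add_tmul B x x' y)).trans
          (add_tmul B _ _ _)) t)
      (fun c x t => LinearMap.congr_fun (f := assocInvAux B (c • x)) (g := c • assocInvAux B x)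
        (hom_ext B fun y z => (congrArg (fun u => tmul B u z) (smul_tmul B c x y)).trans
          (smul_tmul B _ _ _)) t)
      (fun x t t' => map_add (assocInvAux B x) t t')
      (fun c x t => map_smul (assocInvAux B x) c t))
    (fun x b t => LinearMap.congr_fun
      (f := assocInvAux B (MulOpposite.op (b : Ω) • x))
      (g := assocInvAux B x ∘ₗ leftMul B Ω Ω (b : Ω))
      (hom_ext B fun y z => congrArg (fun u => tmul B u z) (tmul_balanced B x b y)) t)

/-- The associativity isomorphism `(Ω ⊗_B Ω) ⊗_B Ω ≅ Ω ⊗_B (Ω ⊗_B Ω)`. -/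
def assoc : Bal B (Bal B Ω Ω) Ω ≃ₗ[k] Bal B Ω (Bal B Ω Ω) :=
  LinearEquiv.ofLinearMap (assocHom B) (assocInv B)
    (hom_ext B fun x t => LinearMap.congr_fun
      (f := assocHom B ∘ₗ assocInvAux B x) (g := mk B Ω (Bal B Ω Ω) x)
      (hom_ext B fun _ _ => rfl) t)
    (hom_ext B fun t z => LinearMap.congr_fun
      (f := assocInv B ∘ₗ assocHomAux B z) (g := (mk B (Bal B Ω Ω) Ω).flip z)
      (hom_ext B fun _ _ => rfl) t)

theorem assoc_tmul (x y z : Ω) :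
    assoc B (tmul B (tmul B x y) z) = tmul B x (tmul B y z) := rfl

theorem assoc_symm_tmul (x y z : Ω) :
    (assoc B).symm (tmul B x (tmul B y z)) = tmul B (tmul B x y) z := rfl

end Associator

end Bal

/-- For algebra morphisms `i, Δ : Ω → T` with equalizer `B`, the canonical map
`Ω ⊗_B Ω → T`, `x ⊗ y ↦ i(x) Δ(y)`. -/
def canonicalMap {T : Type*} [Ring T] [Algebra k T] (i Δ : Ω →ₐ[k] T) :
    Bal (AlgHom.equalizer Δ i) Ω Ω →ₗ[k] T :=
  Bal.lift _ ((LinearMap.mul k T).compl₁₂ i.toLinearMap Δ.toLinearMap) (by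
    intro x b y
    have hb : Δ (b : Ω) = i b := b.2
    simp [Subalgebra.smul_def, hb, mul_assoc])

/-- `Ω` is faithfully flat as a right `B`-module: the functor `Ω ⊗_B -` from left `B`-modules to
vector spaces preserves and reflects exact sequences. -/
def IsRightFaithfullyFlat {k : Type u} [Field k] {A : Type v} [Ring A] [Algebra k A]
    (B : Subalgebra k A) : Prop :=
  ∀ (M N P : Type v) [AddCommGroup M] [AddCommGroup N] [AddCommGroup P]
    [Module k M] [Module k N] [Module k P] [Module B M] [Module B N] [Module B P]
    [IsScalarTower k B M] [IsScalarTower k B N] [IsScalarTower k B P]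
    (f : M →ₗ[B] N) (g : N →ₗ[B] P),
    Function.Exact f g ↔
      Function.Exact (Bal.lmap B A (f.restrictScalars k) (fun b y => map_smul f b y))
        (Bal.lmap B A (g.restrictScalars k) (fun b y => map_smul g b y))

end Balanced

/-! ## Differential graded algebras and differential calculi -/

section DGA

/-- The data of a (non-negatively) graded vector space with a product, a unit and a
differential. -/
structure DGAData (k : Type*) [Field k] (V : Type*) [AddCommGroup V] [Module k V] where
  mul : V →ₗ[k] V →ₗ[k] V
  one : V
  gr : ℕ → Submodule k V
  d : V →ₗ[k] V

variable {k : Type*} [Field k]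

/-- The axioms of a differential graded algebra. -/
structure DGAData.IsDGA {V : Type*} [AddCommGroup V] [Module k V] (X : DGAData k V) : Prop where
  isInternal : DirectSum.IsInternal X.gr
  one_mul : ∀ x, X.mul X.one x = x
  mul_one : ∀ x, X.mul x X.one = x
  mul_assoc : ∀ x y z, X.mul (X.mul x y) z = X.mul x (X.mul y z)
  one_mem : X.one ∈ X.gr 0
  mul_mem : ∀ m n, ∀ x ∈ X.gr m, ∀ y ∈ X.gr n, X.mul x y ∈ X.gr (m + n)
  d_mem : ∀ n, ∀ x ∈ X.gr n, X.d x ∈ X.gr (n + 1)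
  d_d : ∀ x, X.d (X.d x) = 0
  leibniz : ∀ n, ∀ x ∈ X.gr n, ∀ y,
    X.d (X.mul x y) = X.mul (X.d x) y + (-1 : k) ^ n • X.mul x (X.d y)

/-- Morphisms of differential graded algebras: linear maps of degree `0` which intertwine the
products, the units and the differentials. -/
structure DGAData.IsHom {V W : Type*} [AddCommGroup V] [Module k V] [AddCommGroup W] [Module k W]
    (X : DGAData k V) (Y : DGAData k W) (f : V →ₗ[k] W) : Prop where
  map_mul : ∀ x y, f (X.mul x y) = Y.mul (f x) (f y)
  map_one : f X.one = Y.one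
  map_gr : ∀ n, ∀ x ∈ X.gr n, f x ∈ Y.gr n
  map_d : ∀ x, f (X.d x) = Y.d (f x)

/-- A differential calculus on the algebra `A`: a differential graded algebra `Ω` with `Ω⁰ = A`
(through `ι`) and `Ωⁿ` spanned by the elements `a⁰ da¹ ∧ … ∧ daⁿ`. -/
structure DiffCalculus (A : Type*) [Ring A] [Algebra k A] {Ω : Type*} [Ring Ω] [Algebra k Ω]
    (gr : ℕ → Submodule k Ω) [GradedAlgebra gr] where
  ι : A →ₐ[k] Ω
  d : Ω →ₗ[k] Ω
  ι_injective : Function.Injective ι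
  mem_zero_iff : ∀ x, x ∈ gr 0 ↔ ∃ a, ι a = x
  d_mem : ∀ n, ∀ x ∈ gr n, d x ∈ gr (n + 1)
  d_d : ∀ x, d (d x) = 0
  leibniz : ∀ n, ∀ x ∈ gr n, ∀ y, d (x * y) = d x * y + (-1 : k) ^ n • (x * d y)
  generated : ∀ n, gr n = Submodule.span k {x | ∃ (a : A) (b : Fin n → A),
    x = ι a * (List.ofFn fun i => d (ι (b i))).prod}

/-- The differential graded algebra underlying a differential calculus. -/
def DiffCalculus.dga {A : Type*} [Ring A] [Algebra k A] {Ω : Type*} [Ring Ω] [Algebra k Ω]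
    {gr : ℕ → Submodule k Ω} [GradedAlgebra gr] (c : DiffCalculus A gr) : DGAData k Ω where
  mul := LinearMap.mul k Ω
  one := 1
  gr := gr
  d := c.d

end DGA

section Parity

variable {k : Type*} [Field k] {Ω : Type*} [Ring Ω] [Algebra k Ω]
  (gr : ℕ → Submodule k Ω) [GradedAlgebra gr]

/-- The sign operator `ω ↦ (-1)^|ω| ω`. -/
def parity : Ω →ₗ[k] Ω :=
  (DirectSum.toModule k ℕ Ω fun n => (-1 : k) ^ n • (gr n).subtype) ∘ₗ
    (DirectSum.decomposeLinearEquiv gr).toLinearMap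

theorem parity_of_mem {n : ℕ} {x : Ω} (hx : x ∈ gr n) : parity gr x = (-1 : k) ^ n • x := by
  simp only [parity, LinearMap.comp_apply, LinearEquiv.coe_coe,
    DirectSum.decomposeLinearEquiv_apply]
  rw [DirectSum.decompose_of_mem gr hx, ← DirectSum.lof_eq_of k, DirectSum.toModule_lof]
  simp

theorem parity_one : parity gr 1 = 1 := by
  simpa using parity_of_mem gr (SetLike.GradedOne.one_mem (A := gr))

theorem parity_mul (x y : Ω) : parity gr (x * y) = parity gr x * parity gr y := by
  suffices h : (LinearMap.mul k Ω).compr₂ (parity gr) =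
      (LinearMap.mul k Ω).compl₁₂ (parity gr) (parity gr) from
    LinearMap.congr_fun (LinearMap.congr_fun h x) y
  refine DirectSum.decompose_lhom_ext gr fun i => ?_
  ext ⟨a, ha⟩ : 1
  refine DirectSum.decompose_lhom_ext gr fun j => ?_
  ext ⟨b, hb⟩ : 1
  simp [parity_of_mem gr ha, parity_of_mem gr hb,
    parity_of_mem gr (SetLike.GradedMul.mul_mem ha hb), pow_add, smul_smul, mul_comm]

theorem DiffCalculus.leibniz_parity {A : Type*} [Ring A] [Algebra k A] {gr : ℕ → Submodule k Ω}
    [GradedAlgebra gr] (c : DiffCalculus A gr) (x y : Ω) :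
    c.d (x * y) = c.d x * y + parity gr x * c.d y := by
  suffices h : c.d ∘ₗ (LinearMap.mul k Ω).flip y =
      (LinearMap.mul k Ω).flip y ∘ₗ c.d + (LinearMap.mul k Ω).flip (c.d y) ∘ₗ parity gr from
    LinearMap.congr_fun h x
  refine DirectSum.decompose_lhom_ext gr fun i => ?_
  ext ⟨a, ha⟩ : 1
  simp [parity_of_mem gr ha, c.leibniz i a ha y]

theorem DiffCalculus.d_one {A : Type*} [Ring A] [Algebra k A] {gr : ℕ → Submodule k Ω}
    [GradedAlgebra gr] (c : DiffCalculus A gr) : c.d 1 = 0 := by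
  have h := c.leibniz_parity 1 1
  rw [parity_one] at h
  simpa using h

end Parity

/-! ## The tensor product of two differential calculi

`𝒜 ᵍ⊗[k] ℬ` is Mathlib's graded tensor product, with product
`(ω ⊗ ω') (η ⊗ η') = (-1)^(|ω'| |η|) ω η ⊗ ω' η'`. -/

section TensorDGA

variable {k : Type*} [Field k] {A A' : Type*} [Ring A] [Algebra k A] [Ring A'] [Algebra k A']
  {Ω Ω' : Type*} [Ring Ω] [Algebra k Ω] [Ring Ω'] [Algebra k Ω']
  {gr : ℕ → Submodule k Ω} [GradedAlgebra gr] {gr' : ℕ → Submodule k Ω'} [GradedAlgebra gr']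

variable (gr gr') in
/-- The degree `n` component `⨁_{i + j = n} Ωⁱ ⊗ Ω'ʲ`. -/
def tensorGr (n : ℕ) : Submodule k (gr ᵍ⊗[k] gr') :=
  Submodule.span k {z | ∃ i j, i + j = n ∧ ∃ x ∈ gr i, ∃ y ∈ gr' j, z = x ᵍ⊗ₜ[k] y}

/-- The tensor product of linear maps `f ⊗ g`, on the graded tensor product. -/
def gradedMap (f : Ω →ₗ[k] Ω) (g : Ω' →ₗ[k] Ω') : gr ᵍ⊗[k] gr' →ₗ[k] gr ᵍ⊗[k] gr' :=
  (GradedTensorProduct.of k gr gr').toLinearMap ∘ₗ TensorProduct.map f g ∘ₗ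
    (GradedTensorProduct.of k gr gr').symm.toLinearMap

theorem gradedMap_tmul (f : Ω →ₗ[k] Ω) (g : Ω' →ₗ[k] Ω') (x : Ω) (y : Ω') :
    gradedMap f g (x ᵍ⊗ₜ[k] y : gr ᵍ⊗[k] gr') = f x ᵍ⊗ₜ[k] g y := rfl

/-- The tensor product differential graded algebra, with differential
`d(ω ⊗ ω') = dω ⊗ ω' + (-1)^|ω| ω ⊗ dω'`. -/
def tensorDGA (c : DiffCalculus A gr) (c' : DiffCalculus A' gr') :
    DGAData k (gr ᵍ⊗[k] gr') where
  mul := LinearMap.mul k _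
  one := 1
  gr := tensorGr gr gr'
  d := gradedMap c.d LinearMap.id + gradedMap (parity gr) c'.d

end TensorDGA

/-! ## Hopf algebras, comodule algebras, quantum principal bundles -/

section Bundles

variable (k : Type*) [Field k] (H : Type*) [Ring H] [HopfAlgebra k H]

/-- A right `H`-comodule algebra structure on `A`. -/
structure ComoduleAlgebra (A : Type*) [Ring A] [Algebra k A] where
  coact : A →ₐ[k] A ⊗[k] H
  coassoc : ∀ a, TensorProduct.assoc k A H H (coact.toLinearMap.rTensor H (coact a)) =
    (Coalgebra.comul (R := k) (A := H)).lTensor A (coact a)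
  counit : ∀ a, TensorProduct.rid k A ((Coalgebra.counit (R := k) (A := H)).lTensor A (coact a)) = a

variable {k H} {A : Type*} [Ring A] [Algebra k A]

/-- The subalgebra `B = A^{co H}` of coinvariants. -/
def ComoduleAlgebra.coinvariants (ρ : ComoduleAlgebra k H A) : Subalgebra k A :=
  AlgHom.equalizer ρ.coact Algebra.TensorProduct.includeLeft

/-- The Hopf–Galois map `A ⊗_B A → A ⊗ H`, `a ⊗ a' ↦ a a'_0 ⊗ a'_1`. -/
def ComoduleAlgebra.galoisMap (ρ : ComoduleAlgebra k H A) :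
    Bal ρ.coinvariants A A →ₗ[k] A ⊗[k] H :=
  canonicalMap Algebra.TensorProduct.includeLeft ρ.coact

/-- `B = A^{co H} ⊆ A` is a quantum principal bundle: a faithfully flat Hopf–Galois extension. -/
structure ComoduleAlgebra.IsQuantumPrincipalBundle (ρ : ComoduleAlgebra k H A) : Prop where
  bijective_galoisMap : Function.Bijective ρ.galoisMap
  faithfullyFlat : IsRightFaithfullyFlat ρ.coinvariants

end Bundles

/-! ## First order calculi on a Hopf algebra and their maximal prolongation -/

section FirstOrder

/-- A first order differential calculus on `H` with values in the `H`-bimodule `Γ`. -/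
structure FODC (k : Type*) [Field k] (H : Type*) [Ring H] [Algebra k H]
    (Γ : Type*) [AddCommGroup Γ] [Module k Γ] [Module H Γ] [Module Hᵐᵒᵖ Γ] where
  d : H →ₗ[k] Γ
  leibniz : ∀ a b, d (a * b) = MulOpposite.op b • d a + a • d b
  generated : Submodule.span k {γ | ∃ a b : H, γ = a • d b} = ⊤

variable {k : Type*} [Field k] {H : Type*} [Ring H] [HopfAlgebra k H]
  {Γ : Type*} [AddCommGroup Γ] [Module k Γ] [Module H Γ] [Module Hᵐᵒᵖ Γ]
  [IsScalarTower k H Γ] [IsScalarTower k Hᵐᵒᵖ Γ] [SMulCommClass H Hᵐᵒᵖ Γ]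

variable (k H Γ) in
/-- The left action `H → End Γ`. -/
def lact : H →ₗ[k] Γ →ₗ[k] Γ := (Algebra.lsmul k k Γ : H →ₐ[k] Module.End k Γ).toLinearMap

variable (k H Γ) in
/-- The right action `H → End Γ`. -/
def ract : H →ₗ[k] Γ →ₗ[k] Γ :=
  (Algebra.lsmul k k Γ : Hᵐᵒᵖ →ₐ[k] Module.End k Γ).toLinearMap ∘ₗ
    (MulOpposite.opLinearEquiv k).toLinearMap

/-- A right and a left `H`-coaction on `Γ` which make `(Γ, d)` an `H`-bicovariant first order
differential calculus on `H`. -/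
structure BicovariantStructure (F : FODC k H Γ) where
  right : Γ →ₗ[k] Γ ⊗[k] H
  left : Γ →ₗ[k] H ⊗[k] Γ
  right_coassoc : ∀ γ, TensorProduct.assoc k Γ H H (right.rTensor H (right γ)) =
    (Coalgebra.comul (R := k) (A := H)).lTensor Γ (right γ)
  right_counit : ∀ γ,
    TensorProduct.rid k Γ ((Coalgebra.counit (R := k) (A := H)).lTensor Γ (right γ)) = γ
  left_coassoc : ∀ γ, TensorProduct.assoc k H H Γ
    ((Coalgebra.comul (R := k) (A := H)).rTensor Γ (left γ)) = left.lTensor H (left γ)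
  left_counit : ∀ γ,
    TensorProduct.lid k Γ ((Coalgebra.counit (R := k) (A := H)).rTensor Γ (left γ)) = γ
  bicomodule : ∀ γ, TensorProduct.assoc k H Γ H (left.rTensor H (right γ)) =
    right.lTensor H (left γ)
  right_smul : ∀ (h : H) (γ : Γ), right (h • γ) =
    TensorProduct.map₂ (lact k H Γ) (LinearMap.mul k H) (Coalgebra.comul (R := k) h) (right γ)
  right_op_smul : ∀ (h : H) (γ : Γ), right (MulOpposite.op h • γ) =
    TensorProduct.map₂ (ract k H Γ) (LinearMap.mul k H).flip (Coalgebra.comul (R := k) h) (right γ)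
  left_smul : ∀ (h : H) (γ : Γ), left (h • γ) =
    TensorProduct.map₂ (LinearMap.mul k H) (lact k H Γ) (Coalgebra.comul (R := k) h) (left γ)
  left_op_smul : ∀ (h : H) (γ : Γ), left (MulOpposite.op h • γ) =
    TensorProduct.map₂ (LinearMap.mul k H).flip (ract k H Γ) (Coalgebra.comul (R := k) h) (left γ)
  right_d : ∀ h, right (F.d h) = F.d.rTensor H (Coalgebra.comul (R := k) h)
  left_d : ∀ h, left (F.d h) = F.d.lTensor H (Coalgebra.comul (R := k) h)

/-- The first order calculus is `H`-bicovariant. -/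
def FODC.IsBicovariant (F : FODC k H Γ) : Prop := Nonempty (BicovariantStructure F)

/-- The relations presenting the maximal prolongation: the first four present the tensor algebra
`H ⊕ Γ ⊕ (Γ ⊗_H Γ) ⊕ …`, the last one is `∑ daᵢ ⊗ dbᵢ = 0` whenever `∑ aᵢ dbᵢ = 0`. -/
inductive FODC.ProlongationRel (F : FODC k H Γ) :
    TensorAlgebra k (H × Γ) → TensorAlgebra k (H × Γ) → Prop
  | one : F.ProlongationRel (TensorAlgebra.ι k (1, 0)) 1
  | mul (a b : H) : F.ProlongationRel
      (TensorAlgebra.ι k (a, 0) * TensorAlgebra.ι k (b, 0)) (TensorAlgebra.ι k (a * b, 0))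
  | smul (a : H) (γ : Γ) : F.ProlongationRel
      (TensorAlgebra.ι k (a, 0) * TensorAlgebra.ι k (0, γ)) (TensorAlgebra.ι k (0, a • γ))
  | op_smul (a : H) (γ : Γ) : F.ProlongationRel
      (TensorAlgebra.ι k (0, γ) * TensorAlgebra.ι k (a, 0))
      (TensorAlgebra.ι k (0, MulOpposite.op a • γ))
  | closed (n : ℕ) (a b : Fin n → H) (h : ∑ i, a i • F.d (b i) = 0) : F.ProlongationRel
      (∑ i, TensorAlgebra.ι k (0, F.d (a i)) * TensorAlgebra.ι k (0, F.d (b i))) 0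

/-- The algebra underlying the maximal prolongation `Γ^∧` of `(Γ, d)`. -/
abbrev FODC.MaxProlongation (F : FODC k H Γ) : Type _ := RingQuot F.ProlongationRel

/-- The class of `(a, γ) ∈ H ⊕ Γ` in the maximal prolongation. -/
def FODC.prolongationι (F : FODC k H Γ) (x : H × Γ) : F.MaxProlongation :=
  RingQuot.mkAlgHom k F.ProlongationRel (TensorAlgebra.ι k x)

/-- The differential calculus `c` on `H` is (isomorphic to) the maximal prolongation of `(Γ, d)`.
Gradings and differentials correspond automatically, as both sides are generated by `H` and
`dH`. -/
def IsMaximalProlongation (F : FODC k H Γ) {Ω : Type*} [Ring Ω] [Algebra k Ω]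
    {gr : ℕ → Submodule k Ω} [GradedAlgebra gr] (c : DiffCalculus H gr) : Prop :=
  ∃ e : F.MaxProlongation ≃ₐ[k] Ω, (∀ h : H, e (F.prolongationι (h, 0)) = c.ι h) ∧
    ∀ h : H, e (F.prolongationι (0, F.d h)) = c.d (c.ι h)

end FirstOrder

/-! ## Extensions of the comultiplication and the graded antipode -/

section GradedHopf

variable {k : Type*} [Field k] {H : Type*} [Ring H] [HopfAlgebra k H]
  {Ω : Type*} [Ring Ω] [Algebra k Ω] {gr : ℕ → Submodule k Ω} [GradedAlgebra gr]

/-- `Δ` is a morphism of differential graded algebras `Ω(H) → Ω(H) ⊗ Ω(H)` which extends the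
comultiplication of `H`. -/
structure IsExtendedComul (c : DiffCalculus H gr) (Δ : Ω →ₐ[k] gr ᵍ⊗[k] gr) : Prop where
  isHom : DGAData.IsHom c.dga (tensorDGA c c) Δ.toLinearMap
  extends_comul : ∀ h : H, Δ (c.ι h) = GradedTensorProduct.of k gr gr
    (TensorProduct.map c.ι.toLinearMap c.ι.toLinearMap (Coalgebra.comul (R := k) h))

/-- `S` is the antipode of the graded Hopf algebra `Ω(H)` with comultiplication `Δ`, and counit
the one of `H` in degree `0` and zero in positive degrees. -/
structure IsGradedAntipode (c : DiffCalculus H gr) (Δ : Ω →ₐ[k] gr ᵍ⊗[k] gr)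
    (S : Ω →ₗ[k] Ω) : Prop where
  left_zero : ∀ h : H, LinearMap.mul' k Ω (S.rTensor Ω
    ((GradedTensorProduct.of k gr gr).symm (Δ (c.ι h)))) =
      algebraMap k Ω (Coalgebra.counit (R := k) h)
  left_pos : ∀ n, ∀ θ ∈ gr (n + 1), LinearMap.mul' k Ω (S.rTensor Ω
    ((GradedTensorProduct.of k gr gr).symm (Δ θ))) = 0
  right_zero : ∀ h : H, LinearMap.mul' k Ω (S.lTensor Ω
    ((GradedTensorProduct.of k gr gr).symm (Δ (c.ι h)))) =
      algebraMap k Ω (Coalgebra.counit (R := k) h)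
  right_pos : ∀ n, ∀ θ ∈ gr (n + 1), LinearMap.mul' k Ω (S.lTensor Ω
    ((GradedTensorProduct.of k gr gr).symm (Δ θ))) = 0

end GradedHopf

/-! ## Complete calculi and the extended braiding -/

section Complete

variable {k : Type*} [Field k] {H : Type*} [Ring H] [HopfAlgebra k H]
  {A : Type*} [Ring A] [Algebra k A]
  {ΩH : Type*} [Ring ΩH] [Algebra k ΩH] {grH : ℕ → Submodule k ΩH} [GradedAlgebra grH]
  {ΩA : Type*} [Ring ΩA] [Algebra k ΩA] {grA : ℕ → Submodule k ΩA} [GradedAlgebra grA]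

/-- The calculus `cA` on `A` is complete: the coaction of `A` extends to a (necessarily unique)
morphism of differential graded algebras `Ω(A) → Ω(A) ⊗ Ω(H)`. -/
structure CompleteCalculus (ρ : ComoduleAlgebra k H A) (cA : DiffCalculus A grA)
    (cH : DiffCalculus H grH) where
  coact : ΩA →ₐ[k] grA ᵍ⊗[k] grH
  isHom : DGAData.IsHom cA.dga (tensorDGA cA cH) coact.toLinearMap
  extends_coact : ∀ a : A, coact (cA.ι a) = GradedTensorProduct.of k grA grH
    (TensorProduct.map cA.ι.toLinearMap cH.ι.toLinearMap (ρ.coact a))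

namespace CompleteCalculus

variable {ρ : ComoduleAlgebra k H A} {cA : DiffCalculus A grA} {cH : DiffCalculus H grH}
  (K : CompleteCalculus ρ cA cH)

/-- The base forms `Ω(B) = {ω | Δ(ω) = ω ⊗ 1}`. -/
def base : Subalgebra k ΩA :=
  AlgHom.equalizer K.coact (GradedTensorProduct.includeLeft grA grH)

/-- `Ω(A) ⊗_{Ω(B)} Ω(A)`. -/
abbrev E : Type _ := Bal K.base ΩA ΩA

/-- The extended canonical map `χ(ω ⊗ η) = ω η_[0] ⊗ η_[1]`. -/
def chi : K.E →ₗ[k] grA ᵍ⊗[k] grH :=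
  canonicalMap (GradedTensorProduct.includeLeft grA grH) K.coact

theorem chi_tmul (x y : ΩA) :
    K.chi (Bal.tmul K.base x y) = (x ᵍ⊗ₜ[k] (1 : ΩH)) * K.coact y := rfl

theorem chi_smul (x : ΩA) (z : K.E) : K.chi (x • z) = (x ᵍ⊗ₜ[k] (1 : ΩH)) * K.chi z :=
  LinearMap.congr_fun (f := K.chi ∘ₗ Bal.leftMul K.base ΩA ΩA x)
    (g := LinearMap.mulLeft k (x ᵍ⊗ₜ[k] (1 : ΩH)) ∘ₗ K.chi)
    (Bal.hom_ext K.base fun a b => by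
      change (GradedTensorProduct.includeLeft grA grH (x * a)) * K.coact b =
        (GradedTensorProduct.includeLeft grA grH x) *
          (GradedTensorProduct.includeLeft grA grH a * K.coact b)
      rw [map_mul, mul_assoc]) z

theorem chi_op_smul (b : K.base) (z : K.E) :
    K.chi (MulOpposite.op (b : ΩA) • z) = K.chi z * ((b : ΩA) ᵍ⊗ₜ[k] (1 : ΩH)) :=
  LinearMap.congr_fun (f := K.chi ∘ₗ Bal.rightMul K.base ΩA ΩA (MulOpposite.op (b : ΩA)))
    (g := LinearMap.mulRight k ((b : ΩA) ᵍ⊗ₜ[k] (1 : ΩH)) ∘ₗ K.chi)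
    (Bal.hom_ext K.base fun x y => by
      have hb : K.coact (b : ΩA) = GradedTensorProduct.includeLeft grA grH b := b.2
      change (GradedTensorProduct.includeLeft grA grH x) * K.coact (y * b) =
        (GradedTensorProduct.includeLeft grA grH x) * K.coact y *
          (GradedTensorProduct.includeLeft grA grH b)
      rw [map_mul, hb, mul_assoc]) z

/-- The degree `n` component of `Ω(A) ⊗_{Ω(B)} Ω(A)`. -/
def grE (n : ℕ) : Submodule k K.E :=
  Submodule.span k {z | ∃ i j, i + j = n ∧ ∃ x ∈ grA i, ∃ y ∈ grA j, z = Bal.tmul K.base x y}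

theorem d_mem_base (b : K.base) : cA.d b ∈ K.base := by
  have hb : K.coact (b : ΩA) = (b : ΩA) ᵍ⊗ₜ[k] (1 : ΩH) := b.2
  have h := K.isHom.map_d b
  change K.coact (cA.d b) = gradedMap cA.d LinearMap.id (K.coact b) +
    gradedMap (parity grA) cH.d (K.coact b) at h
  change K.coact (cA.d b) = (cA.d b) ᵍ⊗ₜ[k] (1 : ΩH)
  rw [h, hb, gradedMap_tmul, gradedMap_tmul, cH.d_one]
  simp

theorem coact_parity (x : ΩA) :
    K.coact (parity grA x) = gradedMap (parity grA) (parity grH) (K.coact x) := by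
  suffices h : K.coact.toLinearMap ∘ₗ parity grA =
      gradedMap (parity grA) (parity grH) ∘ₗ K.coact.toLinearMap from LinearMap.congr_fun h x
  have key : ∀ n, ∀ z ∈ tensorGr grA grH n,
      gradedMap (parity grA) (parity grH) z = (-1 : k) ^ n • z := by
    intro n z hz
    induction hz using Submodule.span_induction with
    | mem z hz =>
      obtain ⟨i, j, rfl, x, hx, y, hy, rfl⟩ := hz
      rw [gradedMap_tmul, parity_of_mem grA hx, parity_of_mem grH hy]
      rw [GradedTensorProduct.tmul, GradedTensorProduct.tmul, TensorProduct.smul_tmul_smul,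
        map_smul, pow_add]
    | zero => simp
    | add x y _ _ hx hy => rw [map_add, hx, hy, smul_add]
    | smul c x _ hx => rw [map_smul, hx, smul_comm]
  refine DirectSum.decompose_lhom_ext grA fun i => ?_
  ext ⟨a, ha⟩ : 1
  have h := key i _ (K.isHom.map_gr i a ha)
  change K.coact (parity grA a) = gradedMap (parity grA) (parity grH) (K.coact a)
  rw [parity_of_mem grA ha, map_smul]
  exact h.symm

theorem parity_mem_base (b : K.base) : parity grA b ∈ K.base := by
  have hb : K.coact (b : ΩA) = (b : ΩA) ᵍ⊗ₜ[k] (1 : ΩH) := b.2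
  change K.coact (parity grA b) = (parity grA b) ᵍ⊗ₜ[k] (1 : ΩH)
  rw [K.coact_parity, hb, gradedMap_tmul, parity_one]

/-- The differential `d(ω ⊗ η) = dω ⊗ η + (-1)^|ω| ω ⊗ dη` on `Ω(A) ⊗_{Ω(B)} Ω(A)`. -/
def dE : K.E →ₗ[k] K.E :=
  Bal.lift K.base
    ((Bal.mk K.base ΩA ΩA).compl₁₂ cA.d LinearMap.id +
      (Bal.mk K.base ΩA ΩA).compl₁₂ (parity grA) cA.d) (by
    intro x b y
    have e1 := Bal.tmul_balanced K.base (cA.d x) b y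
    have e2 := Bal.tmul_balanced K.base (parity grA x) ⟨_, K.d_mem_base b⟩ y
    have e3 := Bal.tmul_balanced K.base (parity grA x) ⟨_, K.parity_mem_base b⟩ (cA.d y)
    simp only [MulOpposite.smul_eq_mul_unop, MulOpposite.unop_op, Subalgebra.smul_def,
      smul_eq_mul] at e1 e2 e3
    simp only [LinearMap.add_apply, LinearMap.compl₁₂_apply, Bal.mk_apply, LinearMap.id_apply,
      MulOpposite.smul_eq_mul_unop, MulOpposite.unop_op, Subalgebra.smul_def, smul_eq_mul,
      cA.leibniz_parity, parity_mul, Bal.add_tmul, Bal.tmul_add, e1, e2, e3, add_assoc])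

variable (hχ : Function.Bijective K.chi)

/-- The canonical map as an isomorphism of vector spaces. -/
def chiEquiv : K.E ≃ₗ[k] grA ᵍ⊗[k] grH := LinearEquiv.ofBijective K.chi hχ

/-- The translation map `τ(θ) = χ⁻¹(1 ⊗ θ)`. -/
def tau : ΩH →ₗ[k] K.E :=
  (K.chiEquiv hχ).symm.toLinearMap ∘ₗ (GradedTensorProduct.includeRight grA grH).toLinearMap

/-- The differential graded algebra structure of `Ω(A) ⊗ Ω(H)` pulled back to
`Ω(A) ⊗_{Ω(B)} Ω(A)`: the product is `x ∧ y = χ⁻¹(χ(x) χ(y))`, with unit `1 ⊗ 1`. -/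
def pullbackDGA : DGAData k K.E where
  mul := ((LinearMap.mul k (grA ᵍ⊗[k] grH)).compl₁₂ K.chi K.chi).compr₂
    (K.chiEquiv hχ).symm.toLinearMap
  one := Bal.tmul K.base 1 1
  gr := K.grE
  d := K.dE

/-- The map `ω ⊗ θ ↦ ω τ(θ)`. -/
def mulTau : grA ᵍ⊗[k] grH →ₗ[k] K.E :=
  TensorProduct.lift (LinearMap.mk₂ k (fun (x : ΩA) (θ : ΩH) => x • K.tau hχ θ)
    (fun x y θ => add_smul x y (K.tau hχ θ))
    (fun c x θ => LinearMap.congr_fun (Bal.leftMul_smul K.base c x) (K.tau hχ θ))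
    (fun x θ θ' => by rw [map_add, smul_add])
    (fun c x θ => by rw [map_smul]; exact map_smul (Bal.leftMul K.base ΩA ΩA x) c _)) ∘ₗ
    (GradedTensorProduct.of k grA grH).symm.toLinearMap

theorem mulTau_tmul (x : ΩA) (θ : ΩH) : K.mulTau hχ (x ᵍ⊗ₜ[k] θ) = x • K.tau hχ θ := rfl

theorem chi_tau (θ : ΩH) : K.chi (K.tau hχ θ) = (1 : ΩA) ᵍ⊗ₜ[k] θ :=
  (K.chiEquiv hχ).apply_symm_apply _

theorem chi_mulTau (z : grA ᵍ⊗[k] grH) : K.chi (K.mulTau hχ z) = z := by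
  suffices h : K.chi ∘ₗ K.mulTau hχ = LinearMap.id from LinearMap.congr_fun h z
  refine GradedTensorProduct.hom_ext _ _ (TensorProduct.ext' fun x θ => ?_)
  change K.chi (K.mulTau hχ (x ᵍ⊗ₜ[k] θ)) = x ᵍ⊗ₜ[k] θ
  rw [mulTau_tmul, chi_smul, chi_tau, GradedTensorProduct.tmul_one_mul_one_tmul]

/-- The extended braiding
`σ(ω ⊗ η) = (-1)^(|ω_[1]| |η|) ω_[0] η τ(ω_[1])`; the sign is produced by the product
`(ω_[0] ⊗ ω_[1]) (η ⊗ 1) = (-1)^(|ω_[1]| |η|) ω_[0] η ⊗ ω_[1]`. -/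
def sigma : K.E →ₗ[k] K.E :=
  Bal.lift K.base
    (((LinearMap.mul k (grA ᵍ⊗[k] grH)).compl₁₂ K.coact.toLinearMap
      (GradedTensorProduct.includeLeft grA grH).toLinearMap).compr₂ (K.mulTau hχ)) (by
    intro x b y
    have hb : K.coact (b : ΩA) = GradedTensorProduct.includeLeft grA grH b := b.2
    change K.mulTau hχ (K.coact (x * b) * GradedTensorProduct.includeLeft grA grH y) =
      K.mulTau hχ (K.coact x * GradedTensorProduct.includeLeft grA grH (b * y))
    rw [map_mul K.coact, map_mul (GradedTensorProduct.includeLeft grA grH), hb, mul_assoc])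

theorem sigma_tmul (x y : ΩA) : K.sigma hχ (Bal.tmul K.base x y) =
    K.mulTau hχ (K.coact x * (y ᵍ⊗ₜ[k] (1 : ΩH))) := rfl

theorem sigma_smul (b : K.base) (z : K.E) : K.sigma hχ (b • z) = b • K.sigma hχ z := by
  refine LinearMap.congr_fun (f := K.sigma hχ ∘ₗ Bal.leftMul K.base ΩA ΩA (b : ΩA))
    (g := Bal.leftMul K.base ΩA ΩA (b : ΩA) ∘ₗ K.sigma hχ)
    (Bal.hom_ext K.base fun x y => hχ.1 ?_) z
  have hb : K.coact (b : ΩA) = (b : ΩA) ᵍ⊗ₜ[k] (1 : ΩH) := b.2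
  change K.chi (K.mulTau hχ (K.coact (b * x) * (y ᵍ⊗ₜ[k] (1 : ΩH)))) =
    K.chi ((b : ΩA) • K.mulTau hχ (K.coact x * (y ᵍ⊗ₜ[k] (1 : ΩH))))
  rw [chi_smul, chi_mulTau, chi_mulTau, map_mul, hb, mul_assoc]

theorem sigma_op_smul (b : K.base) (z : K.E) :
    K.sigma hχ (MulOpposite.op (b : ΩA) • z) = MulOpposite.op (b : ΩA) • K.sigma hχ z := by
  refine LinearMap.congr_fun
    (f := K.sigma hχ ∘ₗ Bal.rightMul K.base ΩA ΩA (MulOpposite.op (b : ΩA)))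
    (g := Bal.rightMul K.base ΩA ΩA (MulOpposite.op (b : ΩA)) ∘ₗ K.sigma hχ)
    (Bal.hom_ext K.base fun x y => hχ.1 ?_) z
  change K.chi (K.mulTau hχ (K.coact x * GradedTensorProduct.includeLeft grA grH (y * b))) =
    K.chi (MulOpposite.op (b : ΩA) • K.mulTau hχ
      (K.coact x * GradedTensorProduct.includeLeft grA grH y))
  rw [chi_op_smul, chi_mulTau, chi_mulTau, map_mul, mul_assoc]
  rfl

/-- For a bijection `S` of `Ω(H)`, the map
`ω ⊗ η ↦ (-1)^((|ω| + |η_[0]|) |η_[1]|) τ(S⁻¹(η_[1])) ω η_[0]`; the sign is produced by the graded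
flip of `ω η_[0] ⊗ η_[1]`. -/
def sigmaInv (S : ΩH ≃ₗ[k] ΩH) : K.E →ₗ[k] K.E :=
  TensorProduct.lift (LinearMap.mk₂ k
    (fun (θ : ΩH) (x : ΩA) => MulOpposite.op x • K.tau hχ (S.symm θ))
    (fun θ θ' x => by rw [map_add, map_add, smul_add])
    (fun c θ x => by
      rw [map_smul, map_smul]
      exact map_smul (Bal.rightMul K.base ΩA ΩA (MulOpposite.op x)) c _)
    (fun θ x y => add_smul (MulOpposite.op x) (MulOpposite.op y) (K.tau hχ (S.symm θ)))
    (fun c θ x => LinearMap.congr_fun (Bal.rightMul_smul K.base c (MulOpposite.op x))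
      (K.tau hχ (S.symm θ)))) ∘ₗ
    (GradedTensorProduct.of k grH grA).symm.toLinearMap ∘ₗ
    (GradedTensorProduct.comm grA grH).toLinearMap ∘ₗ K.chi

/-- The wedge product `Ω(A) ⊗_{Ω(B)} Ω(A) → Ω(A)`. -/
def wedge : K.E →ₗ[k] ΩA :=
  Bal.lift K.base (LinearMap.mul k ΩA) (by
    intro x b y
    exact mul_assoc x b y)

theorem wedge_smul (b : K.base) (z : K.E) : K.wedge (b • z) = b • K.wedge z :=
  LinearMap.congr_fun (f := K.wedge ∘ₗ Bal.leftMul K.base ΩA ΩA (b : ΩA))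
    (g := LinearMap.mulLeft k (b : ΩA) ∘ₗ K.wedge)
    (Bal.hom_ext K.base fun x y => mul_assoc (b : ΩA) x y) z

theorem wedge_op_smul (b : K.base) (z : K.E) :
    K.wedge (MulOpposite.op (b : ΩA) • z) = MulOpposite.op (b : ΩA) • K.wedge z :=
  LinearMap.congr_fun (f := K.wedge ∘ₗ Bal.rightMul K.base ΩA ΩA (MulOpposite.op (b : ΩA)))
    (g := LinearMap.mulRight k (b : ΩA) ∘ₗ K.wedge)
    (Bal.hom_ext K.base fun x y => (mul_assoc x y (b : ΩA)).symm) z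

/-- `(Ω(A) ⊗_{Ω(B)} Ω(A)) ⊗_{Ω(B)} Ω(A)`. -/
abbrev E₃ : Type _ := Bal K.base K.E ΩA

/-- `σ ⊗ id` on the triple tensor product. -/
def sigmaLeft : K.E₃ →ₗ[k] K.E₃ := Bal.rmap K.base ΩA (K.sigma hχ) (K.sigma_op_smul hχ)

/-- `id ⊗ σ` on the triple tensor product. -/
def sigmaRight : K.E₃ →ₗ[k] K.E₃ :=
  (Bal.assoc K.base).symm.toLinearMap ∘ₗ
    Bal.lmap K.base ΩA (K.sigma hχ) (K.sigma_smul hχ) ∘ₗ (Bal.assoc K.base).toLinearMap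

/-- `∧ ⊗ id` on the triple tensor product. -/
def wedgeLeft : K.E₃ →ₗ[k] K.E := Bal.rmap K.base ΩA K.wedge K.wedge_op_smul

/-- `id ⊗ ∧` on the triple tensor product. -/
def wedgeRight : K.E₃ →ₗ[k] K.E :=
  Bal.lmap K.base ΩA K.wedge K.wedge_smul ∘ₗ (Bal.assoc K.base).toLinearMap

end CompleteCalculus

end Complete

end

end QPB

open scoped TensorProduct

namespace QPB

noncomputable section

set_option linter.unusedSectionVars false

/-! ## The graded tensor product of two graded algebras -/

section GradedTensor

variable {k : Type*} [Field k]

/-! Write Δ for the coaction on Ω(A), χ for the canonical map and τ for the translation map. The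
substance is the bijectivity of χ; afterwards every claim about `E` and σ can be checked after
applying χ, or an analogous map on the triple tensor product.

An inverse of χ must send x ⊗ θ to x τ(θ), so τ has to be extended from H to Ω(H). On H it comes
from the bundle B ⊆ A. By `base_smul_zeroTranslation`, τ(h) commutes with base forms inside `E`;
hence L_h : x ⊗ y ↦ x τ(h) y is a well-defined operator and h ↦ L_h is an algebra morphism H →
End(E). By the universal property of the maximal prolongation
(`IsMaximalProlongation.exists_algHom`), L extends to Ω(H) with dh ↦ [d, L_h], provided ∑ a db = 0
implies both ∑ L_a [d, L_b] = 0 and ∑ [d, L_a] [d, L_b] = 0. The second follows from the first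
because d² = 0. The map x ⊗ θ ↦ x L_θ(1 ⊗ 1) then inverts χ, which is verified on the generators A
and dA.

Both hard points rest on flatness in the form of `IsRightFaithfullyFlat.mem_span_of_lmap_eq_zero`:
the kernel of A ⊗_B g comes from ker g. Call m horizontal if Δ(m) lies in Ω(A) ⊗ H. Then τ(S⁻¹(m₁))
m₀, an element of A ⊗_B Ω(A), is killed by id ⊗ (Δ - (· ⊗ 1)), so it lies in A ⊗_B Ω(B). This gives
m ∈ A·Ω(B), and m ⊗ 1 = τ(S⁻¹(m₁)) m₀ in `E`; taking m = b u with b ∈ Ω(B), u ∈ A yields the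
commutation of b with τ(h). For the first relation (`mulMap_insertHom_insertD`), ∑ L_a [d, L_b](1 ⊗
1) agrees, modulo the elements x τ(h), with the image of some Y ∈ A ⊗_B Ω(A) whose vertical
component depends only on the left coaction of ∑ a db. If ∑ a db = 0, then Y is built from
horizontal forms, so the whole sum lies in the span of the x τ(h). There χ is injective, and χ of
the sum is 1 ⊗ ∑ a db = 0.

The comultiplication, counit and antipode of Ω(H) come from the same universal property. For the
antipode the condition to verify is ∑ d(S b) S(a) = 0 whenever ∑ a db = 0, a convolution computation
(`antipode_forms`); the coopposite Hopf algebra supplies the inverse.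

The rest follows from χσ(x ⊗ y) = Δ(x)(y ⊗ 1). The hexagons are associativity and multiplicativity
of Δ; ∧ = (id ⊗ ε)χ gives ∧σ = ∧; for the braid equation, `E₃` embeds into Ω(A) ⊗ Ω(H) ⊗ Ω(H) as
products of three algebra maps, which σ permutes; and transported by χ, σ becomes x ⊗ θ ↦ Δ(x)(1 ⊗
S(θ)), inverted by means of S⁻¹. -/

/-- The kernel of `p i` contains every `G j` with j ≠ i, hence their supremum, while `p i` is the
identity on `G i`; this forces independence. -/
theorem isInternal_of_projections {M : Type*} [AddCommGroup M] [Module k M]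
    (G : ℕ → Submodule k M) (p : ℕ → M →ₗ[k] M) (same : ∀ n, ∀ x ∈ G n, p n x = x)
    (ne : ∀ m n, m ≠ n → ∀ x ∈ G m, p n x = 0) (top : ⨆ n, G n = ⊤) :
    DirectSum.IsInternal G := by
  refine DirectSum.isInternal_submodule_of_iSupIndep_of_iSup_eq_top (fun i => ?_) top
  rw [Submodule.disjoint_def]
  intro x hx hx'
  have hle : ⨆ j, ⨆ (_ : j ≠ i), G j ≤ LinearMap.ker (p i) :=
    iSup₂_le fun j hj y hy => ne j i hj y hy
  rw [← same i x hx]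
  exact hle hx'

section Single

variable {Ω : Type*} [Ring Ω] [Algebra k Ω] (gr : ℕ → Submodule k Ω) [GradedAlgebra gr]

theorem graded_ext {M : Type*} [AddCommMonoid M] [Module k M] {f g : Ω →ₗ[k] M}
    (h : ∀ n, ∀ x ∈ gr n, f x = g x) : f = g :=
  DirectSum.decompose_lhom_ext gr fun n => by
    ext ⟨x, hx⟩
    exact h n x hx

theorem proj_of_mem {n : ℕ} {x : Ω} (hx : x ∈ gr n) : GradedAlgebra.proj gr n x = x := by
  rw [GradedAlgebra.proj_apply, DirectSum.decompose_of_mem_same gr hx]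

theorem proj_of_mem_ne {m n : ℕ} (h : m ≠ n) {x : Ω} (hx : x ∈ gr m) :
    GradedAlgebra.proj gr n x = 0 := by
  rw [GradedAlgebra.proj_apply, DirectSum.decompose_of_mem_ne gr hx h]

end Single

variable {Ω Ω' : Type*} [Ring Ω] [Algebra k Ω] [Ring Ω'] [Algebra k Ω']
  {gr : ℕ → Submodule k Ω} [GradedAlgebra gr] {gr' : ℕ → Submodule k Ω'} [GradedAlgebra gr']

theorem tmul_mul_tmul_of_mem {j i : ℕ} (x : Ω) {y : Ω'} (hy : y ∈ gr' j) {x' : Ω} (hx' : x' ∈ gr i)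
    (y' : Ω') : (x ᵍ⊗ₜ[k] y * x' ᵍ⊗ₜ[k] y' : gr ᵍ⊗[k] gr') =
      (-1 : k) ^ (j * i) • ((x * x') ᵍ⊗ₜ[k] (y * y')) := by
  refine (GradedTensorProduct.tmul_coe_mul_coe_tmul gr gr' x ⟨y, hy⟩ ⟨x', hx'⟩ y').trans ?_
  rcases Nat.even_or_odd (j * i) with h | h
  · rw [h.neg_one_pow, h.neg_one_pow, one_smul, one_smul]
  · rw [h.neg_one_pow, h.neg_one_pow, Units.neg_smul, one_smul, neg_one_smul]

/-- The Koszul sign is trivial as soon as one of the two inner factors has degree 0, so the other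
one need not be homogeneous. -/
theorem tmul_mul_tmul_zero (x : Ω) (y : Ω') {x' : Ω} (hx' : x' ∈ gr 0)
    (y' : Ω') : (x ᵍ⊗ₜ[k] y * x' ᵍ⊗ₜ[k] y' : gr ᵍ⊗[k] gr') = (x * x') ᵍ⊗ₜ[k] (y * y') := by
  revert y
  suffices h : ∀ y, (LinearMap.mulRight k (x' ᵍ⊗ₜ[k] y' : gr ᵍ⊗[k] gr') ∘ₗ
      (GradedTensorProduct.of k gr gr').toLinearMap ∘ₗ TensorProduct.mk k Ω Ω' x) y =
      ((GradedTensorProduct.of k gr gr').toLinearMap ∘ₗ TensorProduct.mk k Ω Ω' (x * x') ∘ₗ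
        LinearMap.mulRight k y') y from h
  refine LinearMap.congr_fun (graded_ext gr' fun n y hy => ?_)
  exact (tmul_mul_tmul_of_mem x hy hx' y').trans (by simp)

theorem tmul_zero_mul_tmul (x : Ω) {y : Ω'} (hy : y ∈ gr' 0) (x' : Ω)
    (y' : Ω') : (x ᵍ⊗ₜ[k] y * x' ᵍ⊗ₜ[k] y' : gr ᵍ⊗[k] gr') = (x * x') ᵍ⊗ₜ[k] (y * y') := by
  revert x'
  suffices h : ∀ x', (LinearMap.mulLeft k (x ᵍ⊗ₜ[k] y : gr ᵍ⊗[k] gr') ∘ₗ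
      (GradedTensorProduct.of k gr gr').toLinearMap ∘ₗ (TensorProduct.mk k Ω Ω').flip y') x' =
      ((GradedTensorProduct.of k gr gr').toLinearMap ∘ₗ (TensorProduct.mk k Ω Ω').flip (y * y') ∘ₗ
        LinearMap.mulLeft k x) x' from h
  refine LinearMap.congr_fun (graded_ext gr fun n x' hx' => ?_)
  exact (tmul_mul_tmul_of_mem x hy hx' y').trans (by simp)

theorem tmul_mul_one_tmul (x : Ω) (y y' : Ω') :
    (x ᵍ⊗ₜ[k] y * 1 ᵍ⊗ₜ[k] y' : gr ᵍ⊗[k] gr') = x ᵍ⊗ₜ[k] (y * y') := by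
  rw [tmul_mul_tmul_zero x y (SetLike.GradedOne.one_mem (A := gr)) y', mul_one]

theorem tmul_one_mul_tmul (x x' : Ω) (y' : Ω') :
    (x ᵍ⊗ₜ[k] (1 : Ω') * x' ᵍ⊗ₜ[k] y' : gr ᵍ⊗[k] gr') = (x * x') ᵍ⊗ₜ[k] y' := by
  rw [tmul_zero_mul_tmul x (SetLike.GradedOne.one_mem (A := gr')) x' y', one_mul]

theorem gradedTensor_ext {M : Type*} [AddCommMonoid M] [Module k M]
    {f g : gr ᵍ⊗[k] gr' →ₗ[k] M}
    (h : ∀ i j, ∀ x ∈ gr i, ∀ y ∈ gr' j, f (x ᵍ⊗ₜ[k] y) = g (x ᵍ⊗ₜ[k] y)) : f = g := by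
  refine GradedTensorProduct.hom_ext _ _ (TensorProduct.ext ?_)
  refine graded_ext gr fun i x hx => graded_ext gr' fun j y hy => ?_
  exact h i j x hx y hy

theorem tmul_mem_tensorGr {i j n : ℕ} (h : i + j = n) {x : Ω} (hx : x ∈ gr i) {y : Ω'}
    (hy : y ∈ gr' j) : (x ᵍ⊗ₜ[k] y : gr ᵍ⊗[k] gr') ∈ tensorGr gr gr' n :=
  Submodule.subset_span ⟨i, j, h, x, hx, y, hy, rfl⟩

variable (gr gr') in
theorem tensorGr_isInternal : DirectSum.IsInternal (tensorGr gr gr') := by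
  refine isInternal_of_projections _ (fun n => ∑ p ∈ Finset.HasAntidiagonal.antidiagonal n,
    (GradedTensorProduct.of k gr gr').toLinearMap ∘ₗ
      TensorProduct.map (GradedAlgebra.proj gr p.1) (GradedAlgebra.proj gr' p.2) ∘ₗ
      (GradedTensorProduct.of k gr gr').symm.toLinearMap) ?_ ?_ ?_
  · intro n z hz
    induction hz using Submodule.span_induction with
    | mem z hz =>
      obtain ⟨i, j, hij, x, hx, y, hy, rfl⟩ := hz
      rw [LinearMap.sum_apply, Finset.sum_eq_single (i, j)]
      · change GradedTensorProduct.tmul k (GradedAlgebra.proj gr i x) (GradedAlgebra.proj gr' j y) = _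
        rw [proj_of_mem gr hx, proj_of_mem gr' hy]
      · rintro ⟨i', j'⟩ _ hne
        change GradedTensorProduct.tmul k (GradedAlgebra.proj gr i' x)
          (GradedAlgebra.proj gr' j' y) = _
        by_cases hi : i = i'
        · have hj : j ≠ j' := fun hj => hne (by rw [hi, hj])
          rw [proj_of_mem_ne gr' hj hy]
          simp
        · rw [proj_of_mem_ne gr hi hx]
          simp
      · intro h
        exact absurd (Finset.HasAntidiagonal.mem_antidiagonal.2 hij) h
    | zero => simp
    | add x y _ _ hx hy => rw [map_add, hx, hy]
    | smul c x _ hx => rw [map_smul, hx]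
  · intro m n hmn z hz
    induction hz using Submodule.span_induction with
    | mem z hz =>
      obtain ⟨i, j, hij, x, hx, y, hy, rfl⟩ := hz
      rw [LinearMap.sum_apply]
      refine Finset.sum_eq_zero ?_
      rintro ⟨i', j'⟩ hp
      change GradedTensorProduct.tmul k (GradedAlgebra.proj gr i' x)
          (GradedAlgebra.proj gr' j' y) = _
      by_cases hi : i = i'
      · have hj : j ≠ j' := by
          rintro rfl
          apply hmn
          rw [← hij, ← Finset.HasAntidiagonal.mem_antidiagonal.1 hp, hi]
        rw [proj_of_mem_ne gr' hj hy]
        simp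
      · rw [proj_of_mem_ne gr hi hx]
        simp
    | zero => simp
    | add x y _ _ hx hy => rw [map_add, hx, hy, add_zero]
    | smul c x _ hx => rw [map_smul, hx, smul_zero]
  · have h : (⨆ n, tensorGr gr gr' n).mkQ = 0 := gradedTensor_ext fun i j x hx y hy => by
      simpa using Submodule.mem_iSup_of_mem (i + j) (tmul_mem_tensorGr rfl hx hy)
    rw [← Submodule.ker_mkQ (⨆ n, tensorGr gr gr' n), h, LinearMap.ker_zero]

theorem tensorGr_mul_mem {m n : ℕ} {s t : gr ᵍ⊗[k] gr'} (hs : s ∈ tensorGr gr gr' m)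
    (ht : t ∈ tensorGr gr gr' n) : s * t ∈ tensorGr gr gr' (m + n) := by
  induction hs using Submodule.span_induction with
  | mem s hs =>
    obtain ⟨i, j, rfl, x, hx, y, hy, rfl⟩ := hs
    induction ht using Submodule.span_induction with
    | mem t ht =>
      obtain ⟨i', j', rfl, x', hx', y', hy', rfl⟩ := ht
      rw [tmul_mul_tmul_of_mem x hy hx' y']
      refine Submodule.smul_mem _ _ (tmul_mem_tensorGr (by ring)
        (SetLike.GradedMul.mul_mem hx hx') (SetLike.GradedMul.mul_mem hy hy'))
    | zero => simp
    | add a b _ _ ha hb => rw [mul_add]; exact Submodule.add_mem _ ha hb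
    | smul c a _ ha => rw [mul_smul_comm]; exact Submodule.smul_mem _ _ ha
  | zero => simp
  | add a b _ _ ha hb => rw [add_mul]; exact Submodule.add_mem _ ha hb
  | smul c a _ ha => rw [smul_mul_assoc]; exact Submodule.smul_mem _ _ ha

theorem tensorGr_one_mem : (1 : gr ᵍ⊗[k] gr') ∈ tensorGr gr gr' 0 :=
  tmul_mem_tensorGr (zero_add 0) (SetLike.GradedOne.one_mem (A := gr))
    (SetLike.GradedOne.one_mem (A := gr'))

instance tensorGradedMonoid : SetLike.GradedMonoid (tensorGr gr gr') where
  one_mem := tensorGr_one_mem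
  mul_mem _ _ _ _ := tensorGr_mul_mem

/-- Makes iterated graded tensor products such as Ω(A) ⊗ Ω(H) ⊗ Ω(H) available, and lets calculus
lemmas take a tensor product as target. -/
instance tensorGradedAlgebra : GradedAlgebra (tensorGr gr gr') :=
  { tensorGradedMonoid, (tensorGr_isInternal gr gr').chooseDecomposition with }

theorem parity_tensor (z : gr ᵍ⊗[k] gr') :
    parity (tensorGr gr gr') z = gradedMap (parity gr) (parity gr') z := by
  suffices h : parity (tensorGr gr gr') = gradedMap (parity gr) (parity gr') from
    LinearMap.congr_fun h z
  refine gradedTensor_ext fun i j x hx y hy => ?_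
  rw [parity_of_mem _ (tmul_mem_tensorGr rfl hx hy), gradedMap_tmul, parity_of_mem gr hx,
    parity_of_mem gr' hy, GradedTensorProduct.tmul, GradedTensorProduct.tmul,
    TensorProduct.smul_tmul_smul, map_smul, pow_add]

end GradedTensor

/-! ### The differential of a tensor product of calculi. -/

section TensorDifferential

variable {k : Type*} [Field k] {A A' : Type*} [Ring A] [Algebra k A] [Ring A'] [Algebra k A']
  {Ω Ω' : Type*} [Ring Ω] [Algebra k Ω] [Ring Ω'] [Algebra k Ω']
  {gr : ℕ → Submodule k Ω} [GradedAlgebra gr] {gr' : ℕ → Submodule k Ω'} [GradedAlgebra gr']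
  (c : DiffCalculus A gr) (c' : DiffCalculus A' gr')

theorem tensorDGA_d_tmul (x : Ω) (y : Ω') : (tensorDGA c c').d (x ᵍ⊗ₜ[k] y) =
    c.d x ᵍ⊗ₜ[k] y + parity gr x ᵍ⊗ₜ[k] c'.d y := rfl

theorem DiffCalculus.d_parity (x : Ω) : c.d (parity gr x) = - parity gr (c.d x) := by
  suffices h : c.d ∘ₗ parity gr = - (parity gr ∘ₗ c.d) from LinearMap.congr_fun h x
  refine graded_ext gr fun n x hx => ?_
  simp [parity_of_mem gr hx, parity_of_mem gr (c.d_mem n x hx), pow_succ]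

theorem tensorDGA_d_mem {n : ℕ} {z : gr ᵍ⊗[k] gr'} (hz : z ∈ tensorGr gr gr' n) :
    (tensorDGA c c').d z ∈ tensorGr gr gr' (n + 1) := by
  induction hz using Submodule.span_induction with
  | mem z hz =>
    obtain ⟨i, j, rfl, x, hx, y, hy, rfl⟩ := hz
    rw [tensorDGA_d_tmul, parity_of_mem gr hx]
    exact Submodule.add_mem _ (tmul_mem_tensorGr (by ring) (c.d_mem i x hx) hy)
      (tmul_mem_tensorGr (by ring) (Submodule.smul_mem _ _ hx) (c'.d_mem j y hy))
  | zero => simp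
  | add a b _ _ ha hb => rw [map_add]; exact Submodule.add_mem _ ha hb
  | smul a b _ hb => rw [map_smul]; exact Submodule.smul_mem _ _ hb

theorem tensorDGA_d_d (z : gr ᵍ⊗[k] gr') : (tensorDGA c c').d ((tensorDGA c c').d z) = 0 := by
  suffices h : (tensorDGA c c').d ∘ₗ (tensorDGA c c').d = 0 from LinearMap.congr_fun h z
  refine gradedTensor_ext fun i j x hx y hy => ?_
  rw [LinearMap.comp_apply, tensorDGA_d_tmul, map_add, tensorDGA_d_tmul, tensorDGA_d_tmul, c.d_d,
    c'.d_d, c.d_parity]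
  simp [GradedTensorProduct.tmul, TensorProduct.neg_tmul]

theorem tensorDGA_leibniz (s t : gr ᵍ⊗[k] gr') : (tensorDGA c c').d (s * t) =
    (tensorDGA c c').d s * t + parity (tensorGr gr gr') s * (tensorDGA c c').d t := by
  revert t
  refine LinearMap.congr_fun (f := (tensorDGA c c').d ∘ₗ LinearMap.mulLeft k s)
    (g := LinearMap.mulLeft k ((tensorDGA c c').d s) +
      LinearMap.mulLeft k (parity (tensorGr gr gr') s) ∘ₗ (tensorDGA c c').d)
    (gradedTensor_ext fun i' j' x' hx' y' hy' => ?_)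
  revert s
  refine LinearMap.congr_fun
    (f := (tensorDGA c c').d ∘ₗ LinearMap.mulRight k (x' ᵍ⊗ₜ[k] y'))
    (g := LinearMap.mulRight k (x' ᵍ⊗ₜ[k] y') ∘ₗ (tensorDGA c c').d +
      LinearMap.mulRight k ((tensorDGA c c').d (x' ᵍ⊗ₜ[k] y')) ∘ₗ parity (tensorGr gr gr'))
    (gradedTensor_ext fun i j x hx y hy => ?_)
  simp only [LinearMap.comp_apply, LinearMap.add_apply, LinearMap.mulRight_apply]
  rw [parity_of_mem _ (tmul_mem_tensorGr rfl hx hy), tmul_mul_tmul_of_mem x hy hx' y', map_smul,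
    tensorDGA_d_tmul, tensorDGA_d_tmul, tensorDGA_d_tmul, c.leibniz i x hx, c'.leibniz j y hy,
    parity_of_mem gr hx, parity_of_mem gr hx',
    parity_of_mem gr (SetLike.GradedMul.mul_mem hx hx')]
  simp only [add_mul, mul_add, smul_mul_assoc, tmul_mul_tmul_of_mem _ hy hx',
    tmul_mul_tmul_of_mem _ (c'.d_mem j y hy) hx',
    tmul_mul_tmul_of_mem _ hy (c.d_mem i' x' hx'),
    tmul_mul_tmul_of_mem _ hy (Submodule.smul_mem (gr i') ((-1 : k) ^ i') hx')]
  simp only [GradedTensorProduct.tmul, TensorProduct.add_tmul, TensorProduct.tmul_add, map_add,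
    ← TensorProduct.smul_tmul', TensorProduct.tmul_smul, map_smul, smul_add, smul_smul,
    mul_smul_comm]
  -- Of the four terms of the Leibniz rule, the one with dx already agrees on both sides; `e1`,
  -- `e2`, `e3` match the signs of those with dy, dx' and dy'.
  have hj : (-1 : k) ^ j * (-1) ^ j = 1 := by rw [← mul_pow]; simp
  have e1 : (-1 : k) ^ (j * i') * (-1) ^ (i + i') = (-1) ^ (j * i' + 1 * i') * (-1) ^ i := by ring
  have e2 : (-1 : k) ^ (j * i') * (-1) ^ i = (-1) ^ (i + j) * (-1) ^ (j * i' + j * 1) := by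
    linear_combination (-((-1 : k) ^ (j * i') * (-1) ^ i)) * hj
  have e3 : (-1 : k) ^ (j * i') * ((-1) ^ j * (-1) ^ (i + i')) =
      (-1) ^ (i + j) * ((-1) ^ (j * i') * (-1) ^ i') := by ring
  rw [e1, e2, e3]
  abel

end TensorDifferential

/-! ### Functoriality and associativity of the graded tensor product. -/

section GradedTensorMaps

variable {k : Type*} [Field k] {Ω Ω' Ω'' : Type*} [Ring Ω] [Algebra k Ω] [Ring Ω'] [Algebra k Ω']
  [Ring Ω''] [Algebra k Ω'']
  {gr : ℕ → Submodule k Ω} [GradedAlgebra gr] {gr' : ℕ → Submodule k Ω'} [GradedAlgebra gr']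
  {gr'' : ℕ → Submodule k Ω''} [GradedAlgebra gr'']
  {Ξ Ξ' : Type*} [Ring Ξ] [Algebra k Ξ] [Ring Ξ'] [Algebra k Ξ']
  {gs : ℕ → Submodule k Ξ} [GradedAlgebra gs] {gs' : ℕ → Submodule k Ξ'} [GradedAlgebra gs']

/-- The graded tensor product of two morphisms of graded algebras. -/
def gradedTensorMap (f : Ω →ₐ[k] Ξ) (hf : ∀ n, ∀ x ∈ gr n, f x ∈ gs n)
    (g : Ω' →ₐ[k] Ξ') (hg : ∀ n, ∀ x ∈ gr' n, g x ∈ gs' n) :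
    gr ᵍ⊗[k] gr' →ₐ[k] gs ᵍ⊗[k] gs' :=
  AlgHom.ofLinearMap ((GradedTensorProduct.of k gs gs').toLinearMap ∘ₗ
      TensorProduct.map f.toLinearMap g.toLinearMap ∘ₗ
      (GradedTensorProduct.of k gr gr').symm.toLinearMap)
    (by
      change GradedTensorProduct.tmul k (f 1) (g 1) = _
      rw [map_one, map_one]
      rfl)
    (by
      rw [LinearMap.map_mul_iff]
      refine gradedTensor_ext fun i j x hx y hy => gradedTensor_ext fun i' j' x' hx' y' hy' => ?_
      rw [LinearMap.compr₂_apply, LinearMap.mul_apply', tmul_mul_tmul_of_mem x hy hx' y', map_smul]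
      refine Eq.trans ?_ (tmul_mul_tmul_of_mem (f x) (hg j y hy) (hf i' x' hx') (g y')).symm
      rw [← map_mul, ← map_mul]
      rfl)

theorem gradedTensor_ext₃ {M : Type*} [AddCommMonoid M] [Module k M]
    {f g : (tensorGr gr gr') ᵍ⊗[k] gr'' →ₗ[k] M}
    (h : ∀ i j l, ∀ x ∈ gr i, ∀ y ∈ gr' j, ∀ z ∈ gr'' l,
      f ((x ᵍ⊗ₜ[k] y) ᵍ⊗ₜ[k] z) = g ((x ᵍ⊗ₜ[k] y) ᵍ⊗ₜ[k] z)) : f = g := by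
  refine GradedTensorProduct.hom_ext _ _ (TensorProduct.ext ?_)
  refine gradedTensor_ext fun i j x hx y hy => graded_ext gr'' fun l z hz => ?_
  exact h i j l x hx y hy z hz

variable (gr gr' gr'') in
/-- The associativity isomorphism of the graded tensor product, as a linear map. -/
def gradedAssocLin :
    (tensorGr gr gr') ᵍ⊗[k] gr'' →ₗ[k] gr ᵍ⊗[k] (tensorGr gr' gr'') :=
  (GradedTensorProduct.of k gr (tensorGr gr' gr'')).toLinearMap ∘ₗ
    TensorProduct.map LinearMap.id (GradedTensorProduct.of k gr' gr'').toLinearMap ∘ₗ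
      (TensorProduct.assoc k Ω Ω' Ω'').toLinearMap ∘ₗ
      TensorProduct.map (GradedTensorProduct.of k gr gr').symm.toLinearMap LinearMap.id ∘ₗ
      (GradedTensorProduct.of k (tensorGr gr gr') gr'').symm.toLinearMap

theorem gradedAssocLin_tmul (x : Ω) (y : Ω') (z : Ω'') :
    gradedAssocLin gr gr' gr'' ((x ᵍ⊗ₜ[k] y) ᵍ⊗ₜ[k] z) = x ᵍ⊗ₜ[k] (y ᵍ⊗ₜ[k] z) := rfl

variable (gr gr' gr'') in
/-- The associativity isomorphism of the graded tensor product. -/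
def gradedAssoc :
    (tensorGr gr gr') ᵍ⊗[k] gr'' →ₐ[k] gr ᵍ⊗[k] (tensorGr gr' gr'') :=
  AlgHom.ofLinearMap (gradedAssocLin gr gr' gr'') rfl
    (by
      rw [LinearMap.map_mul_iff]
      refine gradedTensor_ext₃ fun i j l x hx y hy z hz =>
        gradedTensor_ext₃ fun i' j' l' x' hx' y' hy' z' hz' => ?_
      change gradedAssocLin gr gr' gr'' _ = gradedAssocLin gr gr' gr'' _ *
        gradedAssocLin gr gr' gr'' _
      rw [LinearMap.mul_apply', gradedAssocLin_tmul, gradedAssocLin_tmul,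
        tmul_mul_tmul_of_mem _ hz (tmul_mem_tensorGr rfl hx' hy') z', map_smul,
        tmul_mul_tmul_of_mem x (tmul_mem_tensorGr rfl hy hz) hx',
        tmul_mul_tmul_of_mem x hy hx' y', tmul_mul_tmul_of_mem y hz hy' z']
      simp only [GradedTensorProduct.tmul, ← TensorProduct.smul_tmul', TensorProduct.tmul_smul,
        map_smul, smul_smul]
      congr 1
      rw [← pow_add, ← pow_add]
      ring_nf)

theorem gradedAssoc_tmul (x : Ω) (y : Ω') (z : Ω'') :
    gradedAssoc gr gr' gr'' ((x ᵍ⊗ₜ[k] y) ᵍ⊗ₜ[k] z) = x ᵍ⊗ₜ[k] (y ᵍ⊗ₜ[k] z) := rfl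

theorem list_prod_ofFn_mem {n : ℕ} (b : Fin n → Ω) (hb : ∀ i, b i ∈ gr 1) :
    (List.ofFn b).prod ∈ gr n := by
  induction n with
  | zero => simpa using SetLike.GradedOne.one_mem (A := gr)
  | succ n ih =>
    rw [List.ofFn_succ, List.prod_cons]
    have h := SetLike.GradedMul.mul_mem (hb 0) (ih _ fun i => hb i.succ)
    rwa [add_comm 1 n] at h

end GradedTensorMaps

/-! ## Differential calculi are generated in degree zero -/

section Generation

variable {k : Type*} [Field k] {A : Type*} [Ring A] [Algebra k A] {Ω : Type*} [Ring Ω]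
  [Algebra k Ω] {gr : ℕ → Submodule k Ω} [GradedAlgebra gr] (c : DiffCalculus A gr)

theorem DiffCalculus.ι_mem (a : A) : c.ι a ∈ gr 0 := (c.mem_zero_iff _).2 ⟨a, rfl⟩

theorem DiffCalculus.d_ι_mem (a : A) : c.d (c.ι a) ∈ gr 1 := c.d_mem 0 _ (c.ι_mem a)

theorem DiffCalculus.parity_ι (a : A) : parity gr (c.ι a) = c.ι a := by
  simp [parity_of_mem gr (c.ι_mem a)]

theorem DiffCalculus.d_ι_mul (a b : A) :
    c.d (c.ι (a * b)) = c.d (c.ι a) * c.ι b + c.ι a * c.d (c.ι b) := by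
  rw [map_mul, c.leibniz_parity, c.parity_ι]

/-- Every form is a sum of products a⁰ da¹ ∧ … ∧ daⁿ. Restricting `hmul` to homogeneous factors
makes the principle usable for properties involving signs. -/
theorem DiffCalculus.induction {p : Ω → Prop} (hι : ∀ a, p (c.ι a)) (hd : ∀ a, p (c.d (c.ι a)))
    (hadd : ∀ x y, p x → p y → p (x + y))
    (hmul : ∀ m n, ∀ x ∈ gr m, ∀ y ∈ gr n, p x → p y → p (x * y)) (x : Ω) : p x := by
  have h0 : p 0 := by simpa using hι 0
  have hlist : ∀ (n : ℕ) (b : Fin n → A), p (List.ofFn fun i => c.d (c.ι (b i))).prod := by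
    intro n
    induction n with
    | zero => intro b; simpa using hι 1
    | succ n ih =>
      intro b
      rw [List.ofFn_succ, List.prod_cons]
      exact hmul 1 n _ (c.d_ι_mem _) _ (list_prod_ofFn_mem _ fun i => c.d_ι_mem _) (hd _) (ih _)
  induction x using DirectSum.Decomposition.inductionOn gr with
  | zero => exact h0
  | @homogeneous n m =>
    obtain ⟨x, hx⟩ := m
    have hx' := hx
    rw [c.generated n] at hx'
    change p x
    clear hx
    -- Membership in `gr n` is carried along because the scalar case below needs `hmul`, which only
    -- accepts homogeneous factors.
    suffices h : x ∈ gr n ∧ p x from h.2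
    induction hx' using Submodule.span_induction with
    | mem x hx =>
      obtain ⟨a, b, rfl⟩ := hx
      have hm := list_prod_ofFn_mem (gr := gr) (fun i => c.d (c.ι (b i))) fun i => c.d_ι_mem _
      refine ⟨?_, hmul 0 n _ (c.ι_mem a) _ hm (hι a) (hlist n b)⟩
      simpa using SetLike.GradedMul.mul_mem (c.ι_mem a) hm
    | zero => exact ⟨Submodule.zero_mem _, h0⟩
    | add x y _ _ hx hy => exact ⟨Submodule.add_mem _ hx.1 hy.1, hadd _ _ hx.2 hy.2⟩
    | smul r x _ hx =>
      refine ⟨Submodule.smul_mem _ _ hx.1, ?_⟩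
      -- A scalar is a form of degree 0, so closure under scalars is a case of closure under
      -- products.
      have h := hmul 0 n _ (c.ι_mem (algebraMap k A r)) x hx.1 (hι _) hx.2
      rwa [AlgHom.commutes, ← Algebra.smul_def] at h
  | add x y hx hy => exact hadd _ _ hx hy

theorem DiffCalculus.algHom_ext {C : Type*} [Ring C] [Algebra k C] {f g : Ω →ₐ[k] C}
    (hι : ∀ a, f (c.ι a) = g (c.ι a)) (hd : ∀ a, f (c.d (c.ι a)) = g (c.d (c.ι a))) : f = g := by
  ext x
  induction x using c.induction with
  | hι a => exact hι a
  | hd a => exact hd a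
  | hadd x y hx hy => rw [map_add, map_add, hx, hy]
  | hmul m n x _ y _ hx hy => rw [map_mul, map_mul, hx, hy]

variable {C : Type*} [Ring C] [Algebra k C] {gC : ℕ → Submodule k C} [GradedAlgebra gC]
  (D : C →ₗ[k] C) (hmem : ∀ x ∈ gC 0, D x ∈ gC 1)
  (hleib : ∀ x y, D (x * y) = D x * y + parity gC x * D y) (hsq : ∀ x, D (D x) = 0)
  (f : Ω →ₐ[k] C) (h0 : ∀ a, f (c.ι a) ∈ gC 0) (h1 : ∀ a, f (c.d (c.ι a)) = D (f (c.ι a)))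

include hmem h0 h1 in
theorem DiffCalculus.algHom_mem (n : ℕ) (x : Ω) (hx : x ∈ gr n) : f x ∈ gC n := by
  rw [c.generated n] at hx
  induction hx using Submodule.span_induction with
  | mem x hx =>
    obtain ⟨a, b, rfl⟩ := hx
    rw [map_mul, map_list_prod, List.map_ofFn]
    have hm := list_prod_ofFn_mem (gr := gC) (f ∘ fun i => c.d (c.ι (b i))) fun i => by
      rw [Function.comp_apply, h1]
      exact hmem _ (h0 _)
    simpa using SetLike.GradedMul.mul_mem (h0 a) hm
  | zero => simp
  | add x y _ _ hx hy => rw [map_add]; exact Submodule.add_mem _ hx hy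
  | smul r x _ hx => rw [map_smul]; exact Submodule.smul_mem _ _ hx

include hmem hleib hsq h0 h1 in
-- Both differentials are graded derivations of square zero and f preserves degrees, so agreement on
-- A propagates first to dA and then to products.
theorem DiffCalculus.algHom_d (x : Ω) : f (c.d x) = D (f x) := by
  have hpar : ∀ x, f (parity gr x) = parity gC (f x) := by
    intro x
    suffices h : f.toLinearMap ∘ₗ parity gr = parity gC ∘ₗ f.toLinearMap from
      LinearMap.congr_fun h x
    refine graded_ext gr fun n x hx => ?_
    simp [parity_of_mem gr hx, parity_of_mem gC (c.algHom_mem D hmem f h0 h1 n x hx)]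
  induction x using c.induction with
  | hι a => exact h1 a
  | hd a => rw [c.d_d, h1, hsq, map_zero]
  | hadd x y hx hy => rw [map_add, map_add, map_add, map_add, hx, hy]
  | hmul m n x _ y _ hx hy =>
    rw [c.leibniz_parity, map_add, map_mul, map_mul, map_mul, hleib, hpar, hx, hy]

end Generation

/-! ## The universal property of the maximal prolongation -/

section Universal

/-- Over a field p has a linear section, and composing q with it gives the factorization. -/
theorem exists_factor {k V W U : Type*} [Field k] [AddCommGroup V] [Module k V] [AddCommGroup W]
    [Module k W] [AddCommGroup U] [Module k U] (p : V →ₗ[k] W) (hp : LinearMap.range p = ⊤)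
    (q : V →ₗ[k] U) (h : ∀ x, p x = 0 → q x = 0) : ∃ g : W →ₗ[k] U, ∀ x, g (p x) = q x := by
  obtain ⟨s, hs⟩ := p.exists_rightInverse_of_surjective hp
  refine ⟨q ∘ₗ s, fun x => ?_⟩
  have h1 : p (s (p x) - x) = 0 := by
    rw [map_sub, sub_eq_zero]
    exact LinearMap.congr_fun hs (p x)
  have h2 := h _ h1
  rwa [map_sub, sub_eq_zero] at h2

variable {k : Type*} [Field k] {H : Type*} [Ring H] [HopfAlgebra k H]
  {Γ : Type*} [AddCommGroup Γ] [Module k Γ] [Module H Γ] [Module Hᵐᵒᵖ Γ]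
  [IsScalarTower k H Γ] [IsScalarTower k Hᵐᵒᵖ Γ] [SMulCommClass H Hᵐᵒᵖ Γ]

/-- The map `H ⊗ H → Γ`, `a ⊗ b ↦ a db`. -/
def FODC.smulD (F : FODC k H Γ) : H ⊗[k] H →ₗ[k] Γ :=
  TensorProduct.lift ((lact k H Γ).compl₂ F.d)

theorem FODC.smulD_tmul (F : FODC k H Γ) (a b : H) : F.smulD (a ⊗ₜ[k] b) = a • F.d b := rfl

theorem FODC.range_smulD (F : FODC k H Γ) : LinearMap.range F.smulD = ⊤ := by
  rw [← top_le_iff, ← F.generated, Submodule.span_le]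
  rintro _ ⟨a, b, rfl⟩
  exact ⟨a ⊗ₜ b, rfl⟩

@[elab_as_elim]
theorem FODC.induction (F : FODC k H Γ) {p : Γ → Prop} (hs : ∀ a b : H, p (a • F.d b))
    (hadd : ∀ x y, p x → p y → p (x + y)) (γ : Γ) : p γ := by
  have hγ : γ ∈ LinearMap.range F.smulD := by rw [F.range_smulD]; trivial
  obtain ⟨X, rfl⟩ := hγ
  induction X using TensorProduct.induction_on with
  | zero => simpa using hs 0 0
  | tmul a b => exact hs a b
  | add X Y hX hY => rw [map_add]; exact hadd _ _ hX hY

/-- The map `V ⊗ W → C`, `v ⊗ w ↦ f(v) g(w)`. -/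
def mulMap {k V W C : Type*} [Field k] [AddCommGroup V] [Module k V] [AddCommGroup W] [Module k W]
    [Ring C] [Algebra k C] (f : V →ₗ[k] C) (g : W →ₗ[k] C) : V ⊗[k] W →ₗ[k] C :=
  LinearMap.mul' k C ∘ₗ TensorProduct.map f g

@[simp]
theorem mulMap_tmul {k V W C : Type*} [Field k] [AddCommGroup V] [Module k V] [AddCommGroup W]
    [Module k W] [Ring C] [Algebra k C] (f : V →ₗ[k] C) (g : W →ₗ[k] C) (v : V) (w : W) :
    mulMap f g (v ⊗ₜ[k] w) = f v * g w := rfl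

/-- Condition `w₁` says that a db ↦ f₀(a) D(b) is well defined on Γ, and `w₂` is the quadratic
relation of the prolongation. The remaining relations follow from the Leibniz rule `hD`. -/
theorem FODC.exists_hom {C : Type*} [Ring C] [Algebra k C] (F : FODC k H Γ)
    (f₀ : H →ₐ[k] C) (D : H →ₗ[k] C) (hD : ∀ a b, D (a * b) = D a * f₀ b + f₀ a * D b)
    (w₁ : ∀ X, F.smulD X = 0 → mulMap f₀.toLinearMap D X = 0)
    (w₂ : ∀ X, F.smulD X = 0 → mulMap D D X = 0) :
    ∃ f : F.MaxProlongation →ₐ[k] C, (∀ a, f (F.prolongationι (a, 0)) = f₀ a) ∧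
      ∀ a, f (F.prolongationι (0, F.d a)) = D a := by
  obtain ⟨f₁, hf₁⟩ := exists_factor F.smulD F.range_smulD _ w₁
  have hf : ∀ a b, f₁ (a • F.d b) = f₀ a * D b := fun a b => hf₁ (a ⊗ₜ b)
  have hf' : ∀ a, f₁ (F.d a) = D a := fun a => by simpa using hf 1 a
  have hl : ∀ a γ, f₁ (a • γ) = f₀ a * f₁ γ := by
    intro a γ
    refine F.induction (fun b e => ?_) (fun x y hx hy => ?_) γ
    · rw [smul_smul, hf, hf, map_mul, mul_assoc]
    · rw [smul_add, map_add, map_add, hx, hy, mul_add]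
  have hr : ∀ a γ, f₁ (MulOpposite.op a • γ) = f₁ γ * f₀ a := by
    intro a γ
    refine F.induction (fun b e => ?_) (fun x y hx hy => ?_) γ
    · have h1 : MulOpposite.op a • F.d e = F.d (e * a) - e • F.d a := by
        rw [F.leibniz]; abel
      rw [← smul_comm b, h1, smul_sub, smul_smul, map_sub, hf, hf, hf, hD, map_mul, mul_add,
        mul_assoc, mul_assoc, add_sub_cancel_right]
    · rw [smul_add, map_add, map_add, hx, hy, add_mul]
  have hrel : ∀ ⦃x y⦄, F.ProlongationRel x y →
      TensorAlgebra.lift k (f₀.toLinearMap.coprod f₁) x =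
        TensorAlgebra.lift k (f₀.toLinearMap.coprod f₁) y := by
    intro x y h
    cases h with
    | one => simp
    | mul a b => simp
    | smul a γ => simp [hl]
    | op_smul a γ => simp [hr]
    | closed n a b h =>
      have h2 := w₂ (∑ i, a i ⊗ₜ b i) (by simpa [FODC.smulD_tmul] using h)
      simpa [hf'] using h2
  refine ⟨RingQuot.liftAlgHom k ⟨_, hrel⟩, fun a => ?_, fun a => ?_⟩
  · simp [FODC.prolongationι]
  · simp [FODC.prolongationι, hf']

variable {F : FODC k H Γ} {Ω : Type*} [Ring Ω] [Algebra k Ω]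
  {gr : ℕ → Submodule k Ω} [GradedAlgebra gr] {c : DiffCalculus H gr}

/-- The target C needs neither a grading nor a differential. This freedom is used for C = k, C =
Ωᵐᵒᵖ and C = End(E), besides the tensor square of Ω(H). -/
theorem IsMaximalProlongation.exists_algHom (h : IsMaximalProlongation F c)
    {C : Type*} [Ring C] [Algebra k C]
    (f₀ : H →ₐ[k] C) (D : H →ₗ[k] C) (hD : ∀ a b, D (a * b) = D a * f₀ b + f₀ a * D b)
    (w₁ : ∀ X, F.smulD X = 0 → mulMap f₀.toLinearMap D X = 0)
    (w₂ : ∀ X, F.smulD X = 0 → mulMap D D X = 0) :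
    ∃ f : Ω →ₐ[k] C, (∀ a, f (c.ι a) = f₀ a) ∧ ∀ a, f (c.d (c.ι a)) = D a := by
  obtain ⟨e, he, he'⟩ := h
  obtain ⟨f, hf, hf'⟩ := F.exists_hom f₀ D hD w₁ w₂
  refine ⟨f.comp e.symm.toAlgHom, fun a => ?_, fun a => ?_⟩
  · rw [← he, ← hf]
    simp
  · rw [← he', ← hf']
    simp

/-- Used to turn a relation ∑ a db = 0 in Γ into a relation between forms in Ω(H). -/
theorem IsMaximalProlongation.exists_forms (h : IsMaximalProlongation F c) :
    ∃ j : Γ →ₗ[k] Ω, ∀ a b, j (a • F.d b) = c.ι a * c.d (c.ι b) := by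
  obtain ⟨e, he, he'⟩ := h
  refine ⟨e.toAlgHom.toLinearMap ∘ₗ (RingQuot.mkAlgHom k F.ProlongationRel).toLinearMap ∘ₗ
    TensorAlgebra.ι k ∘ₗ LinearMap.inr k H Γ, fun a b => ?_⟩
  rw [← he, ← he', ← map_mul]
  refine congrArg e ?_
  change RingQuot.mkAlgHom k F.ProlongationRel _ = RingQuot.mkAlgHom k F.ProlongationRel _ *
    RingQuot.mkAlgHom k F.ProlongationRel _
  rw [← map_mul]
  exact (RingQuot.mkAlgHom_rel k (FODC.ProlongationRel.smul a (F.d b))).symm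

end Universal

/-! ## The extended comultiplication -/

section ZeroForms

variable {k : Type*} [Field k] {A A' : Type*} [Ring A] [Algebra k A] [Ring A'] [Algebra k A']
  {Ω Ω' : Type*} [Ring Ω] [Algebra k Ω] [Ring Ω'] [Algebra k Ω']
  {gr : ℕ → Submodule k Ω} [GradedAlgebra gr] {gr' : ℕ → Submodule k Ω'} [GradedAlgebra gr']
  (c : DiffCalculus A gr) (c' : DiffCalculus A' gr')

/-- The inclusion of `A ⊗ A'` as the degree zero part of `Ω ⊗ Ω'`, as a linear map. -/
def zeroFormsLin : A ⊗[k] A' →ₗ[k] gr ᵍ⊗[k] gr' :=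
  (GradedTensorProduct.of k gr gr').toLinearMap ∘ₗ
    TensorProduct.map c.ι.toLinearMap c'.ι.toLinearMap

theorem zeroFormsLin_tmul (a : A) (b : A') :
    zeroFormsLin c c' (a ⊗ₜ b) = c.ι a ᵍ⊗ₜ[k] c'.ι b := rfl

/-- The inclusion of `A ⊗ A'` as the degree zero part of `Ω ⊗ Ω'`. -/
def zeroForms : A ⊗[k] A' →ₐ[k] gr ᵍ⊗[k] gr' :=
  AlgHom.ofLinearMap (zeroFormsLin c c')
    (by
      rw [Algebra.TensorProduct.one_def, zeroFormsLin_tmul, map_one, map_one]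
      rfl)
    (by
      rw [LinearMap.map_mul_iff]
      refine TensorProduct.ext' fun a b => TensorProduct.ext' fun a' b' => ?_
      change zeroFormsLin c c' ((a ⊗ₜ b) * (a' ⊗ₜ b')) =
        zeroFormsLin c c' (a ⊗ₜ b) * zeroFormsLin c c' (a' ⊗ₜ b')
      rw [Algebra.TensorProduct.tmul_mul_tmul, zeroFormsLin_tmul, zeroFormsLin_tmul,
        zeroFormsLin_tmul, tmul_mul_tmul_zero _ _ (c.ι_mem a'), map_mul, map_mul])

theorem zeroForms_apply (z : A ⊗[k] A') : zeroForms c c' z = GradedTensorProduct.of k gr gr'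
    (TensorProduct.map c.ι.toLinearMap c'.ι.toLinearMap z) := rfl

theorem zeroForms_tmul (a : A) (b : A') :
    zeroForms c c' (a ⊗ₜ b) = c.ι a ᵍ⊗ₜ[k] c'.ι b := rfl

theorem zeroForms_mem (z : A ⊗[k] A') : zeroForms c c' z ∈ tensorGr gr gr' 0 := by
  induction z using TensorProduct.induction_on with
  | zero => simp
  | tmul a b => exact tmul_mem_tensorGr (zero_add 0) (c.ι_mem a) (c'.ι_mem b)
  | add x y hx hy => rw [map_add]; exact Submodule.add_mem _ hx hy

theorem tensorDGA_d_zeroForms (a : A) (b : A') : (tensorDGA c c').d (zeroForms c c' (a ⊗ₜ b)) =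
    c.d (c.ι a) ᵍ⊗ₜ[k] c'.ι b + c.ι a ᵍ⊗ₜ[k] c'.d (c'.ι b) := by
  rw [zeroForms_tmul, tensorDGA_d_tmul, c.parity_ι]

end ZeroForms

section Comul

variable {k : Type*} [Field k] {H : Type*} [Ring H] [HopfAlgebra k H]
  {Γ : Type*} [AddCommGroup Γ] [Module k Γ] [Module H Γ] [Module Hᵐᵒᵖ Γ]
  [IsScalarTower k H Γ] [IsScalarTower k Hᵐᵒᵖ Γ] [SMulCommClass H Hᵐᵒᵖ Γ]
  {F : FODC k H Γ} {Ω : Type*} [Ring Ω] [Algebra k Ω]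
  {gr : ℕ → Submodule k Ω} [GradedAlgebra gr] {c : DiffCalculus H gr}

/-- When D is a twisted derivation of square zero on the target, D(f₀(a) Df₀(b)) = Df₀(a) Df₀(b), so
the quadratic condition is the derivative of the linear one. -/
theorem derivation_prolongs {C : Type*} [Ring C] [Algebra k C] (P D : C →ₗ[k] C)
    (hleib : ∀ x y, D (x * y) = D x * y + P x * D y) (hsq : ∀ x, D (D x) = 0)
    (f₀ : H →ₐ[k] C) (hP : ∀ a, P (f₀ a) = f₀ a)
    (w₁ : ∀ X, F.smulD X = 0 → mulMap f₀.toLinearMap (D ∘ₗ f₀.toLinearMap) X = 0)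
    (X : H ⊗[k] H) (hX : F.smulD X = 0) :
    mulMap (D ∘ₗ f₀.toLinearMap) (D ∘ₗ f₀.toLinearMap) X = 0 := by
  have h : mulMap (D ∘ₗ f₀.toLinearMap) (D ∘ₗ f₀.toLinearMap) =
      D ∘ₗ mulMap f₀.toLinearMap (D ∘ₗ f₀.toLinearMap) :=
    TensorProduct.ext' fun a b => by simp [hleib, hsq, hP]
  rw [h, LinearMap.comp_apply, w₁ X hX, map_zero]

/-- For s = Δ(a), t = Δ(b), the components of Δ(a) dΔ(b) in Γ ⊗ H and H ⊗ Γ are the formulas for the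
right and the left coaction of a db. -/
theorem mulMap_zeroForms_d {j : Γ →ₗ[k] Ω} (hj : ∀ a b, j (a • F.d b) = c.ι a * c.d (c.ι b))
    (s t : H ⊗[k] H) : zeroForms c c s * (tensorDGA c c).d (zeroForms c c t) =
      GradedTensorProduct.of k gr gr (TensorProduct.map j c.ι.toLinearMap
        (TensorProduct.map₂ (lact k H Γ) (LinearMap.mul k H) s (F.d.rTensor H t)) +
      TensorProduct.map c.ι.toLinearMap j
        (TensorProduct.map₂ (LinearMap.mul k H) (lact k H Γ) s (F.d.lTensor H t))) := by
  induction s using TensorProduct.induction_on with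
  | zero => simp
  | add x y hx hy =>
    simp only [map_add, add_mul, LinearMap.add_apply, hx, hy]
    abel
  | tmul x y =>
    induction t using TensorProduct.induction_on with
    | zero => simp
    | add s t hs ht =>
      simp only [map_add, mul_add] at hs ht ⊢
      rw [hs, ht]
      abel
    | tmul u v =>
      rw [tensorDGA_d_zeroForms, zeroForms_tmul, mul_add,
        tmul_zero_mul_tmul _ (c.ι_mem y), tmul_mul_tmul_zero _ _ (c.ι_mem u)]
      simp only [LinearMap.rTensor_tmul, LinearMap.lTensor_tmul, TensorProduct.map₂_apply_tmul,
        TensorProduct.map_tmul, LinearMap.mul_apply', AlgHom.toLinearMap_apply, map_mul, map_add]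
      change _ = (j (x • F.d u)) ᵍ⊗ₜ[k] (c.ι y * c.ι v) +
        (c.ι x * c.ι u) ᵍ⊗ₜ[k] (j (y • F.d v))
      rw [hj, hj]

theorem IsMaximalProlongation.exists_extendedComul (h : IsMaximalProlongation F c)
    (R : BicovariantStructure F) : ∃ Δ : Ω →ₐ[k] gr ᵍ⊗[k] gr, IsExtendedComul c Δ := by
  obtain ⟨j, hj⟩ := h.exists_forms
  set f₀ : H →ₐ[k] gr ᵍ⊗[k] gr := (zeroForms c c).comp (Bialgebra.comulAlgHom k H) with hf₀
  have hf0 : ∀ a, f₀ a = zeroForms c c (Coalgebra.comul (R := k) a) := fun a => rfl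
  have hP : ∀ a, parity (tensorGr gr gr) (f₀ a) = f₀ a := fun a => by
    rw [hf0]
    simpa using parity_of_mem (tensorGr gr gr) (zeroForms_mem c c (Coalgebra.comul (R := k) a))
  -- Bicovariance enters here: ∑ Δ(a) dΔ(b) depends only on the element ∑ a db of Γ, through its two
  -- coactions.
  have key : ∀ X, mulMap f₀.toLinearMap ((tensorDGA c c).d ∘ₗ f₀.toLinearMap) X =
      GradedTensorProduct.of k gr gr (TensorProduct.map j c.ι.toLinearMap (R.right (F.smulD X)) +
        TensorProduct.map c.ι.toLinearMap j (R.left (F.smulD X))) := by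
    intro X
    induction X using TensorProduct.induction_on with
    | zero => simp
    | tmul a b =>
      rw [F.smulD_tmul, R.right_smul, R.left_smul, R.right_d, R.left_d]
      exact mulMap_zeroForms_d hj _ _
    | add x y hx hy =>
      simp only [map_add] at hx hy ⊢
      rw [hx, hy]
      abel
  have w₁ : ∀ X, F.smulD X = 0 →
      mulMap f₀.toLinearMap ((tensorDGA c c).d ∘ₗ f₀.toLinearMap) X = 0 := fun X hX => by
    rw [key, hX]
    simp
  obtain ⟨Δ, hΔ, hΔ'⟩ := h.exists_algHom f₀ ((tensorDGA c c).d ∘ₗ f₀.toLinearMap)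
    (fun a b => by
      simp only [LinearMap.comp_apply, AlgHom.toLinearMap_apply, map_mul]
      rw [tensorDGA_leibniz, hP])
    w₁ (derivation_prolongs (parity (tensorGr gr gr)) _ (tensorDGA_leibniz c c)
      (tensorDGA_d_d c c) f₀ hP w₁)
  have h0 : ∀ a, Δ (c.ι a) ∈ tensorGr gr gr 0 := fun a => by
    rw [hΔ]
    exact zeroForms_mem c c _
  have h1 : ∀ a, Δ (c.d (c.ι a)) = (tensorDGA c c).d (Δ (c.ι a)) := fun a => by
    rw [hΔ, hΔ']
    rfl
  exact ⟨Δ, ⟨map_mul Δ, map_one Δ,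
    c.algHom_mem (gC := tensorGr gr gr) _ (fun x hx => tensorDGA_d_mem c c hx) Δ h0 h1,
    c.algHom_d (gC := tensorGr gr gr) _ (fun x hx => tensorDGA_d_mem c c hx)
      (tensorDGA_leibniz c c) (tensorDGA_d_d c c) Δ h0 h1⟩, hΔ⟩

/-- The universal property with D = 0: every form of positive degree contains a factor da and is
therefore killed. -/
theorem IsMaximalProlongation.exists_counit (h : IsMaximalProlongation F c) :
    ∃ ε : Ω →ₐ[k] k, (∀ a, ε (c.ι a) = Coalgebra.counit (R := k) a) ∧
      ∀ n, ∀ θ ∈ gr (n + 1), ε θ = 0 := by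
  obtain ⟨ε, h0, h1⟩ := h.exists_algHom (Bialgebra.counitAlgHom k H) 0 (by simp)
    (fun X _ => by simp [mulMap]) (fun X _ => by simp [mulMap])
  refine ⟨ε, h0, fun n θ hθ => ?_⟩
  rw [c.generated] at hθ
  induction hθ using Submodule.span_induction with
  | mem x hx =>
    obtain ⟨a, b, rfl⟩ := hx
    rw [List.ofFn_succ, List.prod_cons, map_mul, map_mul, h1]
    simp
  | zero => simp
  | add x y _ _ hx hy => rw [map_add, hx, hy, add_zero]
  | smul r x _ hx => rw [map_smul, hx, smul_zero]

end Comul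

/-! ## The graded antipode -/

section AntipodeForms

open Coalgebra WithConv HopfAlgebra

variable {k : Type*} [Field k] {H : Type*} [Ring H] [HopfAlgebra k H]
  {Γ : Type*} [AddCommGroup Γ] [Module k Γ] [Module H Γ] [Module Hᵐᵒᵖ Γ]
  [IsScalarTower k H Γ] [IsScalarTower k Hᵐᵒᵖ Γ] [SMulCommClass H Hᵐᵒᵖ Γ]

/-- In the convolution algebra of maps H ⊗ H → C, let m be the product, mS the antipode of the
product, φ = a db and g = d(S b) S(a). Differentiating b₁ S(b₂) = ε(b) gives φ * mS = -(m * g).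
Since mS * m = 1, it follows that g = -(mS * φ * mS), and this depends on ∑ a db alone, through the
two coactions. The coactions are separate arguments so that the lemma also applies with left and
right exchanged. -/
theorem antipode_forms (F : FODC k H Γ) (right : Γ →ₗ[k] Γ ⊗[k] H) (left : Γ →ₗ[k] H ⊗[k] Γ)
    (hright : ∀ a b, right (a • F.d b) = TensorProduct.map₂ (lact k H Γ) (LinearMap.mul k H)
      (comul (R := k) a) (F.d.rTensor H (comul (R := k) b)))
    (hleft : ∀ a b, left (a • F.d b) = TensorProduct.map₂ (LinearMap.mul k H) (lact k H Γ)
      (comul (R := k) a) (F.d.lTensor H (comul (R := k) b)))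
    {C : Type*} [Ring C] [Algebra k C] (f₀ : H →ₐ[k] C) (D : H →ₗ[k] C)
    (hD : ∀ a b, D (a * b) = D a * f₀ b + f₀ a * D b)
    (j : Γ →ₗ[k] C) (hj : ∀ a b, j (a • F.d b) = f₀ a * D b)
    (X : H ⊗[k] H) (hX : F.smulD X = 0) :
    mulMap (D ∘ₗ antipode k) (f₀.toLinearMap ∘ₗ antipode k) (TensorProduct.comm k H H X) = 0 := by
  have hD1 : D 1 = 0 := by simpa using hD 1 1
  let fS : H →ₗ[k] C := f₀.toLinearMap ∘ₗ antipode k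
  let m : WithConv (H ⊗[k] H →ₗ[k] C) := toConv (f₀.toLinearMap ∘ₗ LinearMap.mul' k H)
  let mS : WithConv (H ⊗[k] H →ₗ[k] C) := toConv (fS ∘ₗ LinearMap.mul' k H)
  let φ : WithConv (H ⊗[k] H →ₗ[k] C) := toConv (j ∘ₗ F.smulD)
  let g : WithConv (H ⊗[k] H →ₗ[k] C) := toConv (mulMap (D ∘ₗ antipode k) fS ∘ₗ
    (TensorProduct.comm k H H).toLinearMap)
  -- The coaction a db ↦ a₁ db₁ ⊗ a₂ b₂ feeds exactly the two arguments of this convolution product;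
  -- likewise for the left coaction next.
  have hφmS : toConv (mulMap j fS ∘ₗ right ∘ₗ F.smulD) = φ * mS := by
    refine WithConv.ext (TensorProduct.ext' fun a b => ?_)
    change mulMap j fS (right (a • F.d b)) = (φ * mS) (a ⊗ₜ b)
    rw [((ℛ k a).tmul (ℛ k b)).convMul_apply, hright, ← (ℛ k a).eq, ← (ℛ k b).eq]
    simp only [map_sum, LinearMap.sum_apply, LinearMap.rTensor_tmul,
      TensorProduct.map₂_apply_tmul, Coalgebra.Repr.tmul_index, Finset.sum_product]
    rw [Finset.sum_comm]
    rfl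
  have hmSφ : toConv (mulMap fS (mulMap j fS ∘ₗ right) ∘ₗ left ∘ₗ F.smulD) = mS * (φ * mS) := by
    rw [← hφmS]
    refine WithConv.ext (TensorProduct.ext' fun a b => ?_)
    change mulMap fS (mulMap j fS ∘ₗ right) (left (a • F.d b)) =
      (mS * toConv (mulMap j fS ∘ₗ right ∘ₗ F.smulD)) (a ⊗ₜ b)
    rw [((ℛ k a).tmul (ℛ k b)).convMul_apply, hleft, ← (ℛ k a).eq, ← (ℛ k b).eq]
    simp only [map_sum, LinearMap.sum_apply, LinearMap.lTensor_tmul,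
      TensorProduct.map₂_apply_tmul, Coalgebra.Repr.tmul_index, Finset.sum_product]
    rw [Finset.sum_comm]
    rfl
  have hmS : mS * m = 1 := by
    refine WithConv.ext (TensorProduct.ext' fun a b => ?_)
    change (mS * m) (a ⊗ₜ b) = (1 : WithConv (H ⊗[k] H →ₗ[k] C)) (a ⊗ₜ b)
    have h := sum_antipode_mul_eq_algebraMap_counit ((ℛ k a).mul (ℛ k b))
    have h2 := congrArg f₀ h
    rw [((ℛ k a).tmul (ℛ k b)).convMul_apply]
    simp only [map_sum, map_mul, AlgHom.commutes] at h2
    rw [LinearMap.convOne_apply]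
    refine Eq.trans ?_ (h2.trans ?_)
    · rfl
    · simp [TensorProduct.counit_tmul, mul_comm]
  have hrel : φ * mS = -(m * g) := by
    rw [eq_neg_iff_add_eq_zero]
    refine WithConv.ext (TensorProduct.ext' fun a b => ?_)
    change (φ * mS) (a ⊗ₜ b) + (m * g) (a ⊗ₜ b) = 0
    rw [((ℛ k a).tmul (ℛ k b)).convMul_apply, ((ℛ k a).tmul (ℛ k b)).convMul_apply]
    simp only [Coalgebra.Repr.tmul_index, Finset.sum_product, ← Finset.sum_add_distrib]
    refine Finset.sum_eq_zero fun i _ => ?_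
    -- The derivative of b₁ S(b₂) = ε(b); the right-hand side vanishes because D(1) = 0.
    have hb := congrArg D (sum_mul_antipode_eq_smul (ℛ k b))
    rw [map_smul, hD1, smul_zero, map_sum] at hb
    simp only [hD] at hb
    calc _ = f₀ ((ℛ k a).left i) * (∑ l ∈ (ℛ k b).index,
          (D ((ℛ k b).left l) * f₀ (antipode k ((ℛ k b).right l)) +
            f₀ ((ℛ k b).left l) * D (antipode k ((ℛ k b).right l)))) *
            f₀ (antipode k ((ℛ k a).right i)) := by
          rw [Finset.mul_sum, Finset.sum_mul]
          refine Finset.sum_congr rfl fun l _ => ?_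
          change j ((ℛ k a).left i • F.d ((ℛ k b).left l)) *
              f₀ (antipode k ((ℛ k a).right i * (ℛ k b).right l)) +
            f₀ ((ℛ k a).left i * (ℛ k b).left l) *
              (D (antipode k ((ℛ k b).right l)) * f₀ (antipode k ((ℛ k a).right i))) = _
          rw [hj, antipode_mul_antidistrib, map_mul, map_mul]
          noncomm_ring
      _ = 0 := by rw [hb, mul_zero, zero_mul]
  have hg : g = -(mS * (φ * mS)) := by
    rw [hrel, mul_neg, neg_neg, ← mul_assoc, hmS, one_mul]
  rw [← hmSφ] at hg
  have := congrArg (fun t : WithConv (H ⊗[k] H →ₗ[k] C) => t X) hg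
  change mulMap (D ∘ₗ antipode k) fS (TensorProduct.comm k H H X) =
    - mulMap fS (mulMap j fS ∘ₗ right) (left (F.smulD X)) at this
  change mulMap (D ∘ₗ antipode k) fS (TensorProduct.comm k H H X) = 0
  rw [this, hX, map_zero, map_zero, neg_zero]

end AntipodeForms

/-! ## The coopposite Hopf algebra -/

section Coopposite

open Coalgebra HopfAlgebra

variable {k : Type*} [Field k] {H : Type*} [Ring H] [HopfAlgebra k H]

/-- The coopposite coalgebra. -/
abbrev coopCoalgebra : Coalgebra k H where
  comul := (TensorProduct.comm k H H).toLinearMap ∘ₗ comul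
  counit := counit
  coassoc := by
    -- Coassociativity is carried to its mirror image: `h₁` and `h₂` pull the flips to the outside,
    -- and `h₃` compares the two reversals of the three factors.
    have h₁ : ∀ t : H ⊗[k] H, ((TensorProduct.comm k H H).toLinearMap ∘ₗ comul).lTensor H
        (TensorProduct.comm k H H t) = (TensorProduct.comm k H H).toLinearMap.lTensor H
          (TensorProduct.comm k (H ⊗[k] H) H (comul.rTensor H t)) := fun t =>
      LinearMap.congr_fun
        (f := ((TensorProduct.comm k H H).toLinearMap ∘ₗ comul).lTensor H ∘ₗ
          (TensorProduct.comm k H H).toLinearMap)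
        (g := (TensorProduct.comm k H H).toLinearMap.lTensor H ∘ₗ
          (TensorProduct.comm k (H ⊗[k] H) H).toLinearMap ∘ₗ comul.rTensor H)
        (TensorProduct.ext' fun _ _ => rfl) t
    have h₂ : ∀ t : H ⊗[k] H, ((TensorProduct.comm k H H).toLinearMap ∘ₗ comul).rTensor H
        (TensorProduct.comm k H H t) = (TensorProduct.comm k H H).toLinearMap.rTensor H
          (TensorProduct.comm k H (H ⊗[k] H) (comul.lTensor H t)) := fun t =>
      LinearMap.congr_fun
        (f := ((TensorProduct.comm k H H).toLinearMap ∘ₗ comul).rTensor H ∘ₗ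
          (TensorProduct.comm k H H).toLinearMap)
        (g := (TensorProduct.comm k H H).toLinearMap.rTensor H ∘ₗ
          (TensorProduct.comm k H (H ⊗[k] H)).toLinearMap ∘ₗ comul.lTensor H)
        (TensorProduct.ext' fun _ _ => rfl) t
    have h₃ : ∀ t : (H ⊗[k] H) ⊗[k] H, TensorProduct.assoc k H H H
        ((TensorProduct.comm k H H).toLinearMap.rTensor H
          (TensorProduct.comm k H (H ⊗[k] H) (TensorProduct.assoc k H H H t))) =
        (TensorProduct.comm k H H).toLinearMap.lTensor H
          (TensorProduct.comm k (H ⊗[k] H) H t) := fun t =>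
      LinearMap.congr_fun
        (f := (TensorProduct.assoc k H H H).toLinearMap ∘ₗ
          (TensorProduct.comm k H H).toLinearMap.rTensor H ∘ₗ
          (TensorProduct.comm k H (H ⊗[k] H)).toLinearMap ∘ₗ
          (TensorProduct.assoc k H H H).toLinearMap)
        (g := (TensorProduct.comm k H H).toLinearMap.lTensor H ∘ₗ
          (TensorProduct.comm k (H ⊗[k] H) H).toLinearMap)
        (TensorProduct.ext_threefold fun _ _ _ => rfl) t
    ext a
    change TensorProduct.assoc k H H H (((TensorProduct.comm k H H).toLinearMap ∘ₗ comul).rTensor H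
      (TensorProduct.comm k H H (comul a))) =
        ((TensorProduct.comm k H H).toLinearMap ∘ₗ comul).lTensor H
          (TensorProduct.comm k H H (comul a))
    rw [h₁, h₂, ← coassoc_apply, h₃]
  rTensor_counit_comp_comul := by
    ext a
    have h : ∀ t : H ⊗[k] H, (counit (R := k) (A := H)).rTensor H (TensorProduct.comm k H H t) =
        TensorProduct.comm k H k ((counit (R := k) (A := H)).lTensor H t) := fun t =>
      LinearMap.congr_fun
        (f := (counit (R := k) (A := H)).rTensor H ∘ₗ (TensorProduct.comm k H H).toLinearMap)
        (g := (TensorProduct.comm k H k).toLinearMap ∘ₗ (counit (R := k) (A := H)).lTensor H)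
        (TensorProduct.ext' fun _ _ => rfl) t
    exact (h _).trans (by rw [lTensor_counit_comul]; rfl)
  lTensor_counit_comp_comul := by
    ext a
    have h : ∀ t : H ⊗[k] H, (counit (R := k) (A := H)).lTensor H (TensorProduct.comm k H H t) =
        TensorProduct.comm k k H ((counit (R := k) (A := H)).rTensor H t) := fun t =>
      LinearMap.congr_fun
        (f := (counit (R := k) (A := H)).lTensor H ∘ₗ (TensorProduct.comm k H H).toLinearMap)
        (g := (TensorProduct.comm k k H).toLinearMap ∘ₗ (counit (R := k) (A := H)).rTensor H)
        (TensorProduct.ext' fun _ _ => rfl) t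
    exact (h _).trans (by rw [rTensor_counit_comul]; rfl)

/-- The coopposite bialgebra. -/
abbrev coopBialgebra : Bialgebra k H where
  toCoalgebra := coopCoalgebra
  counit_one := Bialgebra.counit_one
  mul_compr₂_counit := Bialgebra.mul_compr₂_counit
  comul_one := congrArg (TensorProduct.comm k H H) (Bialgebra.comul_one (R := k) (A := H))
  mul_compr₂_comul := by
    ext a b
    exact (congrArg (Algebra.TensorProduct.comm k H H) (Bialgebra.comul_mul a b)).trans
      (map_mul (Algebra.TensorProduct.comm k H H) _ _)

variable (hS : Function.Bijective (antipode k : H →ₗ[k] H))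

/-- The inverse of a bijective antipode. -/
def antipodeInv : H →ₗ[k] H := (LinearEquiv.ofBijective (antipode k : H →ₗ[k] H) hS).symm

theorem antipode_antipodeInv (a : H) : antipode k (antipodeInv hS a) = a :=
  (LinearEquiv.ofBijective (antipode k : H →ₗ[k] H) hS).apply_symm_apply a

theorem antipodeInv_antipode (a : H) : antipodeInv hS (antipode k a) = a :=
  (LinearEquiv.ofBijective (antipode k : H →ₗ[k] H) hS).symm_apply_apply a

theorem antipodeInv_mul (a b : H) :
    antipodeInv hS (a * b) = antipodeInv hS b * antipodeInv hS a := hS.1 (by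
  rw [antipode_antipodeInv, antipode_mul_antidistrib, antipode_antipodeInv, antipode_antipodeInv])

theorem antipodeInv_one : antipodeInv hS (1 : H) = 1 := hS.1 (by
  rw [antipode_antipodeInv, antipode_one])

/-- Applying the injective, product-reversing antipode turns the identity into the antipode axiom
S(a₁) a₂ = ε(a). -/
theorem sum_antipodeInv_mul {ι : Type*} {a : H} (r : Coalgebra.Repr k a ι) :
    ∑ i ∈ r.index, antipodeInv hS (r.right i) * r.left i = algebraMap k H (counit a) := hS.1 (by
  simp only [map_sum, antipode_mul_antidistrib, antipode_antipodeInv,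
    sum_antipode_mul_eq_algebraMap_counit]
  rw [Algebra.algebraMap_eq_smul_one, map_smul, antipode_one])

theorem sum_mul_antipodeInv {ι : Type*} {a : H} (r : Coalgebra.Repr k a ι) :
    ∑ i ∈ r.index, r.right i * antipodeInv hS (r.left i) = algebraMap k H (counit a) := hS.1 (by
  simp only [map_sum, antipode_mul_antidistrib, antipode_antipodeInv,
    sum_mul_antipode_eq_algebraMap_counit]
  rw [Algebra.algebraMap_eq_smul_one, map_smul, antipode_one])

/-- The coopposite of a Hopf algebra with bijective antipode is a Hopf algebra, with the inverse
antipode. -/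
abbrev coopHopfAlgebra : HopfAlgebra k H where
  toBialgebra := coopBialgebra
  antipode := antipodeInv hS
  mul_antipode_rTensor_comul := by
    ext a
    change LinearMap.mul' k H ((antipodeInv hS).rTensor H
      (TensorProduct.comm k H H (comul a))) = algebraMap k H (counit a)
    rw [← sum_antipodeInv_mul hS (ℛ k a), ← (ℛ k a).eq]
    simp
  mul_antipode_lTensor_comul := by
    ext a
    change LinearMap.mul' k H ((antipodeInv hS).lTensor H
      (TensorProduct.comm k H H (comul a))) = algebraMap k H (counit a)
    rw [← sum_mul_antipodeInv hS (ℛ k a), ← (ℛ k a).eq]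
    simp

end Coopposite

/-! ## The graded antipode -/

section Antipode

open Coalgebra HopfAlgebra

variable {k : Type*} [Field k] {H : Type*} [Ring H] [HopfAlgebra k H]
  {Γ : Type*} [AddCommGroup Γ] [Module k Γ] [Module H Γ] [Module Hᵐᵒᵖ Γ]
  [IsScalarTower k H Γ] [IsScalarTower k Hᵐᵒᵖ Γ] [SMulCommClass H Hᵐᵒᵖ Γ]
  {F : FODC k H Γ} {Ω : Type*} [Ring Ω] [Algebra k Ω]
  {gr : ℕ → Submodule k Ω} [GradedAlgebra gr] {c : DiffCalculus H gr}

variable (gr) in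
/-- The sign operator `ω ↦ (-1)^(n (n - 1) / 2) ω` for `ω` of degree `n`. -/
def reversalSign : Ω →ₗ[k] Ω :=
  (DirectSum.toModule k ℕ Ω fun n => (-1 : k) ^ n.choose 2 • (gr n).subtype) ∘ₗ
    (DirectSum.decomposeLinearEquiv gr).toLinearMap

theorem reversalSign_of_mem {n : ℕ} {x : Ω} (hx : x ∈ gr n) :
    reversalSign gr x = (-1 : k) ^ n.choose 2 • x := by
  simp only [reversalSign, LinearMap.comp_apply, LinearEquiv.coe_coe,
    DirectSum.decomposeLinearEquiv_apply]
  rw [DirectSum.decompose_of_mem gr hx, ← DirectSum.lof_eq_of k, DirectSum.toModule_lof]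
  simp

/-- A degree `0` map `S` which extends the map `s` on `H`, commutes with the differential on `H`,
and satisfies `S(ω η) = (-1)^(|ω| |η|) S(η) S(ω)`. -/
structure IsGradedAntiHom (c : DiffCalculus H gr) (s : H →ₗ[k] H) (S : Ω →ₗ[k] Ω) : Prop where
  map_ι : ∀ a, S (c.ι a) = c.ι (s a)
  map_d_ι : ∀ a, S (c.d (c.ι a)) = c.d (c.ι (s a))
  map_gr : ∀ n, ∀ x ∈ gr n, S x ∈ gr n
  map_mul : ∀ m n, ∀ x ∈ gr m, ∀ y ∈ gr n, S (x * y) = (-1 : k) ^ (m * n) • (S y * S x)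

/-- Since C(m+n, 2) = mn + C(m, 2) + C(n, 2), rescaling degree n by (-1)^C(n, 2) turns an ordinary
antihomomorphism into a graded one. -/
theorem neg_one_pow_choose_two_add (m n : ℕ) : (-1 : k) ^ (m + n).choose 2 =
    (-1) ^ (m * n) * ((-1) ^ n.choose 2 * (-1) ^ m.choose 2) := by
  rw [← pow_add, ← pow_add]
  congr 1
  induction n with
  | zero => simp
  | succ n ih =>
    rw [← add_assoc, Nat.choose_succ_succ' (m + n) 1, Nat.choose_succ_succ' n 1, ih]
    simp only [Nat.choose_one_right]
    ring

/-- The universal property with target Ωᵐᵒᵖ gives an ungraded antihomomorphism, which `reversalSign`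
then corrects. The flip in `w` reflects the reversed multiplication. -/
theorem IsMaximalProlongation.exists_gradedAntiHom (h : IsMaximalProlongation F c)
    (s : H →ₗ[k] H) (hs1 : s 1 = 1) (hs : ∀ a b, s (a * b) = s b * s a)
    (w : ∀ X, F.smulD X = 0 → mulMap ((c.d ∘ₗ c.ι.toLinearMap) ∘ₗ s) (c.ι.toLinearMap ∘ₗ s)
      (TensorProduct.comm k H H X) = 0) : ∃ S : Ω →ₗ[k] Ω, IsGradedAntiHom c s S := by
  let opL : Ω →ₗ[k] Ωᵐᵒᵖ := (MulOpposite.opLinearEquiv k).toLinearMap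
  let f₀ : H →ₐ[k] Ωᵐᵒᵖ := AlgHom.ofLinearMap (opL ∘ₗ c.ι.toLinearMap ∘ₗ s)
    (by simp [opL, hs1]) (fun a b => by simp [opL, hs])
  let D : H →ₗ[k] Ωᵐᵒᵖ := opL ∘ₗ (c.d ∘ₗ c.ι.toLinearMap) ∘ₗ s
  have hf₀ : ∀ a, f₀ a = MulOpposite.op (c.ι (s a)) := fun a => rfl
  have hD : ∀ a, D a = MulOpposite.op (c.d (c.ι (s a))) := fun a => rfl
  have key₁ : mulMap f₀.toLinearMap D = opL ∘ₗ mulMap ((c.d ∘ₗ c.ι.toLinearMap) ∘ₗ s)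
      (c.ι.toLinearMap ∘ₗ s) ∘ₗ (TensorProduct.comm k H H).toLinearMap :=
    TensorProduct.ext' fun a b => by simp [hf₀, hD, opL]
  -- d(s b) d(s a) = -d(d(s b) s(a)), so the quadratic condition is again a derivative of the linear
  -- one.
  have key₂ : mulMap D D = -(opL ∘ₗ c.d ∘ₗ mulMap ((c.d ∘ₗ c.ι.toLinearMap) ∘ₗ s)
      (c.ι.toLinearMap ∘ₗ s) ∘ₗ (TensorProduct.comm k H H).toLinearMap) :=
    TensorProduct.ext' fun a b => by
      simp [hD, opL, c.leibniz 1 _ (c.d_ι_mem _), c.d_d]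
  obtain ⟨S₀, hS, hS'⟩ := h.exists_algHom f₀ D
    (fun a b => by
      rw [hD, hD, hD, hf₀, hf₀, hs, c.d_ι_mul]
      simp [add_comm])
    (fun X hX => by
      have := w X hX
      rw [key₁]
      simp only [LinearMap.comp_apply, LinearEquiv.coe_coe, this, map_zero])
    (fun X hX => by
      have := w X hX
      rw [key₂]
      simp only [LinearMap.neg_apply, LinearMap.comp_apply, LinearEquiv.coe_coe, this, map_zero,
        neg_zero])
  let S : Ω →ₗ[k] Ω :=
    (MulOpposite.opLinearEquiv k).symm.toLinearMap ∘ₗ S₀.toLinearMap ∘ₗ reversalSign gr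
  have hSm : ∀ n, ∀ x ∈ gr n, S x = (-1 : k) ^ n.choose 2 • (S₀ x).unop := by
    intro n x hx
    simp [S, reversalSign_of_mem hx]
  have hS0 : ∀ a, (S₀ (c.ι a)).unop = c.ι (s a) := fun a => by rw [hS]; rfl
  have hS1 : ∀ a, (S₀ (c.d (c.ι a))).unop = c.d (c.ι (s a)) := fun a => by rw [hS']; rfl
  have hgr : ∀ n, ∀ x ∈ gr n, (S₀ x).unop ∈ gr n := by
    intro n x hx
    rw [c.generated n] at hx
    induction hx using Submodule.span_induction with
    | mem x hx =>
      obtain ⟨a, b, rfl⟩ := hx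
      have hl : ∀ (n : ℕ) (b : Fin n → H),
          (S₀ (List.ofFn fun i => c.d (c.ι (b i))).prod).unop ∈ gr n := by
        intro n
        induction n with
        | zero => intro b; simpa using SetLike.GradedOne.one_mem (A := gr)
        | succ n ih =>
          intro b
          rw [List.ofFn_succ, List.prod_cons, map_mul, MulOpposite.unop_mul, hS1]
          exact SetLike.GradedMul.mul_mem (ih _) (c.d_ι_mem _)
      rw [map_mul, MulOpposite.unop_mul, hS0]
      exact SetLike.GradedMul.mul_mem (hl n b) (c.ι_mem (s a))
    | zero => simp
    | add x y _ _ hx hy => rw [map_add]; exact Submodule.add_mem _ hx hy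
    | smul r x _ hx => rw [map_smul]; exact Submodule.smul_mem _ _ hx
  refine ⟨S, fun a => ?_, fun a => ?_, fun n x hx => ?_, fun m n x hx y hy => ?_⟩
  · rw [hSm 0 _ (c.ι_mem a), hS0]
    simp
  · rw [hSm 1 _ (c.d_ι_mem a), hS1]
    simp
  · rw [hSm n x hx]
    exact Submodule.smul_mem _ _ (hgr n x hx)
  · rw [hSm _ _ (SetLike.GradedMul.mul_mem hx hy), hSm m x hx, hSm n y hy, map_mul,
      MulOpposite.unop_mul, smul_mul_smul_comm, smul_smul, neg_one_pow_choose_two_add]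

/-- A composite of two graded antihomomorphisms is multiplicative, because the sign (-1)^(mn) occurs
twice; so checking generators suffices. -/
theorem IsGradedAntiHom.comp_eq_id {s t : H →ₗ[k] H} {S T : Ω →ₗ[k] Ω}
    (hS : IsGradedAntiHom c s S) (hT : IsGradedAntiHom c t T) (hst : ∀ a, s (t a) = a) (x : Ω) :
    S (T x) = x := by
  induction x using c.induction with
  | hι a => rw [hT.map_ι, hS.map_ι, hst]
  | hd a => rw [hT.map_d_ι, hS.map_d_ι, hst]
  | hadd x y hx hy => rw [map_add, map_add, hx, hy]
  | hmul m n x hxm y hyn hx hy =>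
    rw [hT.map_mul m n x hxm y hyn, map_smul,
      hS.map_mul n m _ (hT.map_gr n y hyn) _ (hT.map_gr m x hxm), hx, hy, smul_smul, mul_comm n m,
      ← mul_pow]
    simp

theorem IsGradedAntiHom.map_prod {s : H →ₗ[k] H} {S : Ω →ₗ[k] Ω} (hS : IsGradedAntiHom c s S)
    (hs1 : s 1 = 1) (n : ℕ) (b : Fin n → H) : S (List.ofFn fun i => c.d (c.ι (b i))).prod =
      (-1 : k) ^ n.choose 2 • (List.ofFn fun i => c.d (c.ι (s (b i)))).reverse.prod := by
  induction n with
  | zero => simpa [hs1] using hS.map_ι 1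
  | succ n ih =>
    rw [List.ofFn_succ, List.prod_cons, hS.map_mul 1 n _ (c.d_ι_mem _) _
      (list_prod_ofFn_mem _ fun i => c.d_ι_mem _), ih, hS.map_d_ι, List.ofFn_succ (n := n),
      List.reverse_cons, List.prod_append, smul_mul_assoc, smul_smul, ← pow_add,
      Nat.choose_succ_succ' n 1]
    simp

theorem IsGradedAntiHom.map_form {s : H →ₗ[k] H} {S : Ω →ₗ[k] Ω} (hS : IsGradedAntiHom c s S)
    (hs1 : s 1 = 1) (n : ℕ) (a : H) (b : Fin n → H) :
    S (c.ι a * (List.ofFn fun i => c.d (c.ι (b i))).prod) =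
      (-1 : k) ^ n.choose 2 •
        ((List.ofFn fun i => c.d (c.ι (s (b i)))).reverse.prod * c.ι (s a)) := by
  rw [hS.map_mul 0 n _ (c.ι_mem a) _ (list_prod_ofFn_mem _ fun i => c.d_ι_mem _),
    hS.map_prod hs1, hS.map_ι]
  simp

/-! ### Passing the antipode axioms from generators to products. -/

section Axioms

variable {s : H →ₗ[k] H} {S : Ω →ₗ[k] Ω} (hS : IsGradedAntiHom c s S)

include hS in
-- Reversal of products by S puts the contribution of t in the middle: x ⊗ y multiplied by t yields
-- ± S(x) (…) y, and (…) is the scalar e. The sign (-1)^(m i) matters only for m ≠ 0, where e = 0.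
theorem IsGradedAntiHom.mulMap_left_mul {m : ℕ} {t : gr ᵍ⊗[k] gr} (ht : t ∈ tensorGr gr gr m)
    (e : k) (hm : m ≠ 0 → e = 0)
    (hte : mulMap S LinearMap.id ((GradedTensorProduct.of k gr gr).symm t) = algebraMap k Ω e)
    (w : gr ᵍ⊗[k] gr) :
    mulMap S LinearMap.id ((GradedTensorProduct.of k gr gr).symm (t * w)) =
      e • mulMap S LinearMap.id ((GradedTensorProduct.of k gr gr).symm w) := by
  revert w
  refine LinearMap.congr_fun
    (f := mulMap S LinearMap.id ∘ₗ (GradedTensorProduct.of k gr gr).symm.toLinearMap ∘ₗ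
      LinearMap.mulLeft k t)
    (g := e • (mulMap S LinearMap.id ∘ₗ (GradedTensorProduct.of k gr gr).symm.toLinearMap))
    (gradedTensor_ext fun i j x hx y hy => ?_)
  have key : ∀ t ∈ tensorGr gr gr m,
      mulMap S LinearMap.id ((GradedTensorProduct.of k gr gr).symm (t * x ᵍ⊗ₜ[k] y)) =
      (-1 : k) ^ (m * i) •
        (S x * mulMap S LinearMap.id ((GradedTensorProduct.of k gr gr).symm t) * y) := by
    intro t ht
    induction ht using Submodule.span_induction with
    | mem t ht =>
      obtain ⟨p, q, rfl, u, hu, v, hv, rfl⟩ := ht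
      rw [tmul_mul_tmul_of_mem u hv hx y, map_smul, map_smul]
      simp only [GradedTensorProduct.tmul, GradedTensorProduct.of_symm_of, mulMap_tmul,
        LinearMap.id_apply, hS.map_mul p i u hu x hx, smul_mul_assoc, smul_smul, mul_assoc]
      congr 1
      ring
    | zero => simp
    | add a b _ _ ha hb => simp only [add_mul, map_add, mul_add, ha, hb, smul_add]
    | smul r a _ ha =>
      rw [smul_mul_assoc, map_smul, map_smul, ha, map_smul, map_smul, mul_smul_comm,
        smul_mul_assoc, smul_comm]
  refine (key t ht).trans ?_
  rw [hte]
  by_cases h0 : m = 0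
  · subst h0
    rw [← Algebra.commutes, mul_assoc, ← Algebra.smul_def]
    simp [GradedTensorProduct.tmul]
  · rw [hm h0]
    simp

include hS in
theorem IsGradedAntiHom.mulMap_mul_right {m : ℕ} {t : gr ᵍ⊗[k] gr} (ht : t ∈ tensorGr gr gr m)
    (e : k) (hm : m ≠ 0 → e = 0)
    (hte : mulMap LinearMap.id S ((GradedTensorProduct.of k gr gr).symm t) = algebraMap k Ω e)
    (w : gr ᵍ⊗[k] gr) :
    mulMap LinearMap.id S ((GradedTensorProduct.of k gr gr).symm (w * t)) =
      e • mulMap LinearMap.id S ((GradedTensorProduct.of k gr gr).symm w) := by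
  revert w
  refine LinearMap.congr_fun
    (f := mulMap LinearMap.id S ∘ₗ (GradedTensorProduct.of k gr gr).symm.toLinearMap ∘ₗ
      LinearMap.mulRight k t)
    (g := e • (mulMap LinearMap.id S ∘ₗ (GradedTensorProduct.of k gr gr).symm.toLinearMap))
    (gradedTensor_ext fun i j x hx y hy => ?_)
  have key : ∀ t ∈ tensorGr gr gr m,
      mulMap LinearMap.id S ((GradedTensorProduct.of k gr gr).symm (x ᵍ⊗ₜ[k] y * t)) =
      (-1 : k) ^ (m * j) •
        (x * mulMap LinearMap.id S ((GradedTensorProduct.of k gr gr).symm t) * S y) := by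
    intro t ht
    induction ht using Submodule.span_induction with
    | mem t ht =>
      obtain ⟨p, q, rfl, u, hu, v, hv, rfl⟩ := ht
      rw [tmul_mul_tmul_of_mem x hy hu v, map_smul, map_smul]
      simp only [GradedTensorProduct.tmul, GradedTensorProduct.of_symm_of, mulMap_tmul,
        LinearMap.id_apply, hS.map_mul j q y hy v hv, mul_smul_comm, smul_smul, mul_assoc]
      congr 1
      ring
    | zero => simp
    | add a b _ _ ha hb => simp only [add_mul, map_add, mul_add, ha, hb, smul_add]
    | smul r a _ ha =>
      rw [mul_smul_comm, map_smul, map_smul, ha, map_smul, map_smul, mul_smul_comm,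
        smul_mul_assoc, smul_comm]
  refine (key t ht).trans ?_
  rw [hte]
  by_cases h0 : m = 0
  · subst h0
    rw [← Algebra.commutes, mul_assoc, ← Algebra.smul_def]
    simp [GradedTensorProduct.tmul]
  · rw [hm h0]
    simp

end Axioms

theorem IsExtendedComul.map_d_ι {Δ : Ω →ₐ[k] gr ᵍ⊗[k] gr} (hΔ : IsExtendedComul c Δ) (a : H) :
    Δ (c.d (c.ι a)) = (tensorDGA c c).d (zeroForms c c (comul a)) := by
  rw [zeroForms_apply, ← hΔ.extends_comul]
  exact hΔ.isHom.map_d (c.ι a)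

/-- Induction on generators: on A-type generators it is the antipode axiom of H, on exact ones its
derivative, and products are handled by `mulMap_left_mul`. -/
theorem IsGradedAntiHom.mulMap_comul_left {S : Ω →ₗ[k] Ω} (hS : IsGradedAntiHom c (antipode k) S)
    {Δ : Ω →ₐ[k] gr ᵍ⊗[k] gr} (hΔ : IsExtendedComul c Δ) {ε : Ω →ₐ[k] k}
    (hε : ∀ a, ε (c.ι a) = counit (R := k) a) (hε' : ∀ n, ∀ θ ∈ gr (n + 1), ε θ = 0) (θ : Ω) :
    mulMap S LinearMap.id ((GradedTensorProduct.of k gr gr).symm (Δ θ)) =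
      algebraMap k Ω (ε θ) := by
  induction θ using c.induction with
  | hι a =>
    rw [hΔ.extends_comul, GradedTensorProduct.of_symm_of, hε, ← c.ι.commutes,
      ← sum_antipode_mul_eq_algebraMap_counit (ℛ k a), ← (ℛ k a).eq]
    simp [hS.map_ι]
  | hd a =>
    have h := congrArg (c.d ∘ₗ c.ι.toLinearMap) (sum_antipode_mul_eq_smul (ℛ k a))
    rw [map_smul, LinearMap.comp_apply, LinearMap.comp_apply, AlgHom.toLinearMap_apply,
      AlgHom.toLinearMap_apply, map_one c.ι, c.d_one, smul_zero, map_sum, map_sum] at h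
    rw [hε' 0 _ (c.d_ι_mem a), map_zero, hΔ.map_d_ι, ← h, ← (ℛ k a).eq]
    simp only [map_sum, tensorDGA_d_zeroForms, map_add, GradedTensorProduct.tmul,
      GradedTensorProduct.of_symm_of, mulMap_tmul, hS.map_ι, hS.map_d_ι, LinearMap.id_apply,
      c.d_ι_mul]
  | hadd x y hx hy => simp only [map_add, hx, hy]
  | hmul m n x hxm y hyn hx hy =>
    rw [_root_.map_mul Δ, hS.mulMap_left_mul (t := Δ x) (hΔ.isHom.map_gr m x hxm) (ε x) (fun hm => ?_) hx, hy,
      _root_.map_mul ε, _root_.map_mul (algebraMap k Ω), Algebra.smul_def]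
    obtain ⟨m', rfl⟩ := Nat.exists_eq_succ_of_ne_zero hm
    exact hε' _ _ hxm

theorem IsGradedAntiHom.mulMap_comul_right {S : Ω →ₗ[k] Ω}
    (hS : IsGradedAntiHom c (antipode k) S)
    {Δ : Ω →ₐ[k] gr ᵍ⊗[k] gr} (hΔ : IsExtendedComul c Δ) {ε : Ω →ₐ[k] k}
    (hε : ∀ a, ε (c.ι a) = counit (R := k) a) (hε' : ∀ n, ∀ θ ∈ gr (n + 1), ε θ = 0) (θ : Ω) :
    mulMap LinearMap.id S ((GradedTensorProduct.of k gr gr).symm (Δ θ)) =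
      algebraMap k Ω (ε θ) := by
  induction θ using c.induction with
  | hι a =>
    rw [hΔ.extends_comul, GradedTensorProduct.of_symm_of, hε, ← c.ι.commutes,
      ← sum_mul_antipode_eq_algebraMap_counit (ℛ k a), ← (ℛ k a).eq]
    simp [hS.map_ι]
  | hd a =>
    have h := congrArg (c.d ∘ₗ c.ι.toLinearMap) (sum_mul_antipode_eq_smul (ℛ k a))
    rw [map_smul, LinearMap.comp_apply, LinearMap.comp_apply, AlgHom.toLinearMap_apply,
      AlgHom.toLinearMap_apply, map_one c.ι, c.d_one, smul_zero, map_sum, map_sum] at h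
    rw [hε' 0 _ (c.d_ι_mem a), map_zero, hΔ.map_d_ι, ← h, ← (ℛ k a).eq]
    simp only [map_sum, tensorDGA_d_zeroForms, map_add, GradedTensorProduct.tmul,
      GradedTensorProduct.of_symm_of, mulMap_tmul, hS.map_ι, hS.map_d_ι, LinearMap.id_apply,
      c.d_ι_mul]
  | hadd x y hx hy => simp only [map_add, hx, hy]
  | hmul m n x hxm y hyn hx hy =>
    rw [_root_.map_mul Δ, hS.mulMap_mul_right (t := Δ y) (hΔ.isHom.map_gr n y hyn) (ε y) (fun hn => ?_) hy, hx,
      _root_.map_mul ε, _root_.map_mul (algebraMap k Ω), Algebra.smul_def, Algebra.commutes]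
    obtain ⟨n', rfl⟩ := Nat.exists_eq_succ_of_ne_zero hn
    exact hε' _ _ hyn

/-- The inverse is built in the same way from S⁻¹, which is the antipode of the coopposite Hopf
algebra. The calculus stays bicovariant for it, with the flipped left coaction as right coaction and
conversely. -/
theorem IsMaximalProlongation.exists_antipode (h : IsMaximalProlongation F c)
    (hF : F.IsBicovariant) (hS : Function.Bijective (antipode k : H →ₗ[k] H)) :
    ∃ S : Ω ≃ₗ[k] Ω, IsGradedAntiHom c (antipode k) S.toLinearMap := by
  obtain ⟨R⟩ := hF
  obtain ⟨j, hj⟩ := h.exists_forms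
  obtain ⟨S, hS'⟩ := h.exists_gradedAntiHom (antipode k) antipode_one antipode_mul_antidistrib
    (antipode_forms F R.right R.left (fun a b => by rw [R.right_smul, R.right_d])
      (fun a b => by rw [R.left_smul, R.left_d]) c.ι (c.d ∘ₗ c.ι.toLinearMap) c.d_ι_mul j hj)
  -- Flipping the formula for one coaction of a db produces the formula for the other, with both
  -- comultiplications flipped.
  have hmap₂ : ∀ s t : H ⊗[k] H, TensorProduct.comm k H Γ (TensorProduct.map₂ (LinearMap.mul k H)
      (lact k H Γ) s (F.d.lTensor H t)) = TensorProduct.map₂ (lact k H Γ) (LinearMap.mul k H)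
        (TensorProduct.comm k H H s) (F.d.rTensor H (TensorProduct.comm k H H t)) := by
    intro s t
    induction s using TensorProduct.induction_on with
    | zero => simp
    | add x y hx hy => simp only [map_add, LinearMap.add_apply, hx, hy]
    | tmul x y =>
      induction t using TensorProduct.induction_on with
      | zero => simp
      | add x y hx hy => simp only [map_add, hx, hy]
      | tmul u v => rfl
  have hmap₂' : ∀ s t : H ⊗[k] H, TensorProduct.comm k Γ H (TensorProduct.map₂ (lact k H Γ)
      (LinearMap.mul k H) s (F.d.rTensor H t)) = TensorProduct.map₂ (LinearMap.mul k H)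
        (lact k H Γ) (TensorProduct.comm k H H s)
          (F.d.lTensor H (TensorProduct.comm k H H t)) := by
    intro s t
    induction s using TensorProduct.induction_on with
    | zero => simp
    | add x y hx hy => simp only [map_add, LinearMap.add_apply, hx, hy]
    | tmul x y =>
      induction t using TensorProduct.induction_on with
      | zero => simp
      | add x y hx hy => simp only [map_add, hx, hy]
      | tmul u v => rfl
  obtain ⟨T, hT⟩ := h.exists_gradedAntiHom (antipodeInv hS) (antipodeInv_one hS)
    (antipodeInv_mul hS)
    (@antipode_forms k _ H _ (coopHopfAlgebra hS) Γ _ _ _ _ _ _ _ F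
      ((TensorProduct.comm k H Γ).toLinearMap ∘ₗ R.left)
      ((TensorProduct.comm k Γ H).toLinearMap ∘ₗ R.right)
      (fun a b => by
        refine Eq.trans ?_ (hmap₂ (comul a) (comul b))
        rw [← R.left_d, ← R.left_smul]
        rfl)
      (fun a b => by
        refine Eq.trans ?_ (hmap₂' (comul a) (comul b))
        rw [← R.right_d, ← R.right_smul]
        rfl) Ω _ _ c.ι (c.d ∘ₗ c.ι.toLinearMap) c.d_ι_mul j hj)
  exact ⟨LinearEquiv.ofLinearMap S T
    (LinearMap.ext (hS'.comp_eq_id hT (antipode_antipodeInv hS)))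
    (LinearMap.ext (hT.comp_eq_id hS' (antipodeInv_antipode hS))), hS'⟩

theorem IsGradedAntiHom.isGradedAntipode {S : Ω →ₗ[k] Ω} (hS : IsGradedAntiHom c (antipode k) S)
    {Δ : Ω →ₐ[k] gr ᵍ⊗[k] gr} (hΔ : IsExtendedComul c Δ) {ε : Ω →ₐ[k] k}
    (hε : ∀ a, ε (c.ι a) = counit (R := k) a) (hε' : ∀ n, ∀ θ ∈ gr (n + 1), ε θ = 0) :
    IsGradedAntipode c Δ S where
  left_zero h := (hS.mulMap_comul_left hΔ hε hε' (c.ι h)).trans (by rw [hε])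
  left_pos n θ hθ := (hS.mulMap_comul_left hΔ hε hε' θ).trans (by rw [hε' n θ hθ, map_zero])
  right_zero h := (hS.mulMap_comul_right hΔ hε hε' (c.ι h)).trans (by rw [hε])
  right_pos n θ hθ := (hS.mulMap_comul_right hΔ hε hε' θ).trans (by rw [hε' n θ hθ, map_zero])

end Antipode

/-! ## The extended coaction is a comodule structure -/

section Coaction

variable {k : Type*} [Field k] {H : Type*} [Ring H] [HopfAlgebra k H]
  {A : Type*} [Ring A] [Algebra k A]
  {ΩH : Type*} [Ring ΩH] [Algebra k ΩH] {grH : ℕ → Submodule k ΩH} [GradedAlgebra grH]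
  {ΩA : Type*} [Ring ΩA] [Algebra k ΩA] {grA : ℕ → Submodule k ΩA} [GradedAlgebra grA]
  {ρ : ComoduleAlgebra k H A} {cA : DiffCalculus A grA} {cH : DiffCalculus H grH}
  (K : CompleteCalculus ρ cA cH)

namespace CompleteCalculus

theorem coact_ι (a : A) : K.coact (cA.ι a) = zeroForms cA cH (ρ.coact a) := K.extends_coact a

theorem coact_d (x : ΩA) : K.coact (cA.d x) = (tensorDGA cA cH).d (K.coact x) := K.isHom.map_d x

theorem coact_mem (n : ℕ) (x : ΩA) (hx : x ∈ grA n) : K.coact x ∈ tensorGr grA grH n :=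
  K.isHom.map_gr n x hx

variable {ΔH : ΩH →ₐ[k] grH ᵍ⊗[k] grH} (hΔ : IsExtendedComul cH ΔH)

/-- The map `Δ ⊗ id` on `Ω(A) ⊗ Ω(H)`. -/
def coactTensor : grA ᵍ⊗[k] grH →ₐ[k] (tensorGr grA grH) ᵍ⊗[k] grH :=
  gradedTensorMap K.coact K.coact_mem (AlgHom.id k ΩH) (fun _ _ h => h)

variable (grA) in
/-- The map `id ⊗ Δ` on `Ω(A) ⊗ Ω(H)`. -/
def tensorComul : grA ᵍ⊗[k] grH →ₐ[k] grA ᵍ⊗[k] (tensorGr grH grH) :=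
  gradedTensorMap (AlgHom.id k ΩA) (fun _ _ h => h) ΔH hΔ.isHom.map_gr

theorem coactTensor_tmul (x : ΩA) (θ : ΩH) :
    K.coactTensor (x ᵍ⊗ₜ[k] θ) = (K.coact x) ᵍ⊗ₜ[k] θ := rfl

theorem tensorComul_tmul (x : ΩA) (θ : ΩH) :
    tensorComul grA hΔ (x ᵍ⊗ₜ[k] θ) = x ᵍ⊗ₜ[k] (ΔH θ) := rfl

variable (cA cH) in
/-- The embedding of `A ⊗ H ⊗ H` into `Ω(A) ⊗ Ω(H) ⊗ Ω(H)`. -/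
def zeroForms₃ : A ⊗[k] (H ⊗[k] H) →ₗ[k] grA ᵍ⊗[k] (tensorGr grH grH) :=
  (GradedTensorProduct.of k grA (tensorGr grH grH)).toLinearMap ∘ₗ
    TensorProduct.map cA.ι.toLinearMap (zeroForms cH cH).toLinearMap

variable (cA cH) in
/-- The differential of `A ⊗ H ⊗ H`. -/
def zeroFormsD₃ : A ⊗[k] (H ⊗[k] H) →ₗ[k] grA ᵍ⊗[k] (tensorGr grH grH) :=
  (GradedTensorProduct.of k grA (tensorGr grH grH)).toLinearMap ∘ₗ
    (TensorProduct.map (cA.d ∘ₗ cA.ι.toLinearMap) (zeroForms cH cH).toLinearMap +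
      TensorProduct.map cA.ι.toLinearMap ((tensorDGA cH cH).d ∘ₗ (zeroForms cH cH).toLinearMap))

theorem zeroForms₃_tmul (a : A) (x : H ⊗[k] H) :
    zeroForms₃ cA cH (a ⊗ₜ x) = (cA.ι a) ᵍ⊗ₜ[k] (zeroForms cH cH x) := rfl

theorem zeroFormsD₃_tmul (a : A) (x : H ⊗[k] H) :
    zeroFormsD₃ cA cH (a ⊗ₜ x) = (cA.d (cA.ι a)) ᵍ⊗ₜ[k] (zeroForms cH cH x) +
      (cA.ι a) ᵍ⊗ₜ[k] ((tensorDGA cH cH).d (zeroForms cH cH x)) := rfl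

theorem gradedAssoc_zeroForms (s : A ⊗[k] H) (h : H) :
    gradedAssoc grA grH grH ((zeroForms cA cH s) ᵍ⊗ₜ[k] (cH.ι h)) =
      zeroForms₃ cA cH (TensorProduct.assoc k A H H (s ⊗ₜ h)) := by
  induction s using TensorProduct.induction_on with
  | zero => simp [GradedTensorProduct.tmul]
  | add x y hx hy =>
    simp only [GradedTensorProduct.tmul, map_add, TensorProduct.add_tmul] at hx hy ⊢
    rw [hx, hy]
  | tmul a h' =>
    rw [TensorProduct.assoc_tmul, zeroForms₃_tmul, zeroForms_tmul, zeroForms_tmul,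
      gradedAssoc_tmul]

theorem gradedAssoc_d_zeroForms (s : A ⊗[k] H) (h : H) :
    gradedAssoc grA grH grH (((tensorDGA cA cH).d (zeroForms cA cH s)) ᵍ⊗ₜ[k] (cH.ι h)) +
      gradedAssoc grA grH grH ((zeroForms cA cH s) ᵍ⊗ₜ[k] (cH.d (cH.ι h))) =
      zeroFormsD₃ cA cH (TensorProduct.assoc k A H H (s ⊗ₜ h)) := by
  induction s using TensorProduct.induction_on with
  | zero => simp [GradedTensorProduct.tmul]
  | add x y hx hy =>
    simp only [GradedTensorProduct.tmul, map_add, TensorProduct.add_tmul] at hx hy ⊢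
    rw [← hx, ← hy]
    abel
  | tmul a h' =>
    have e1 : ∀ (p q : grA ᵍ⊗[k] grH) (θ : ΩH), ((p + q) ᵍ⊗ₜ[k] θ :
        (tensorGr grA grH) ᵍ⊗[k] grH) = p ᵍ⊗ₜ[k] θ + q ᵍ⊗ₜ[k] θ :=
      fun p q θ => by simp only [GradedTensorProduct.tmul, TensorProduct.add_tmul, map_add]
    have e2 : ∀ (x : ΩA) (p q : grH ᵍ⊗[k] grH), (x ᵍ⊗ₜ[k] (p + q) :
        grA ᵍ⊗[k] (tensorGr grH grH)) = x ᵍ⊗ₜ[k] p + x ᵍ⊗ₜ[k] q :=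
      fun x p q => by simp only [GradedTensorProduct.tmul, TensorProduct.tmul_add, map_add]
    rw [TensorProduct.assoc_tmul, zeroFormsD₃_tmul, tensorDGA_d_zeroForms, tensorDGA_d_zeroForms,
      zeroForms_tmul, zeroForms_tmul, e1, e2, map_add, gradedAssoc_tmul, gradedAssoc_tmul,
      gradedAssoc_tmul, add_assoc]

theorem coactTensor_zeroForms (z : A ⊗[k] H) :
    gradedAssoc grA grH grH (K.coactTensor (zeroForms cA cH z)) =
      zeroForms₃ cA cH (TensorProduct.assoc k A H H (ρ.coact.toLinearMap.rTensor H z)) := by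
  induction z using TensorProduct.induction_on with
  | zero => simp
  | add x y hx hy => simp only [map_add, hx, hy]
  | tmul a h =>
    rw [zeroForms_tmul, coactTensor_tmul, K.coact_ι, gradedAssoc_zeroForms]
    rfl

theorem coactTensor_d_zeroForms (z : A ⊗[k] H) :
    gradedAssoc grA grH grH (K.coactTensor ((tensorDGA cA cH).d (zeroForms cA cH z))) =
      zeroFormsD₃ cA cH (TensorProduct.assoc k A H H (ρ.coact.toLinearMap.rTensor H z)) := by
  induction z using TensorProduct.induction_on with
  | zero => simp
  | add x y hx hy => simp only [map_add, hx, hy]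
  | tmul a h =>
    rw [tensorDGA_d_zeroForms, map_add, map_add, coactTensor_tmul, coactTensor_tmul, K.coact_d,
      K.coact_ι, gradedAssoc_d_zeroForms]
    rfl

theorem tensorComul_zeroForms (z : A ⊗[k] H) : tensorComul grA hΔ (zeroForms cA cH z) =
    zeroForms₃ cA cH ((Coalgebra.comul (R := k) (A := H)).lTensor A z) := by
  induction z using TensorProduct.induction_on with
  | zero => simp
  | add x y hx hy => simp only [map_add, hx, hy]
  | tmul a h =>
    rw [zeroForms_tmul, tensorComul_tmul, hΔ.extends_comul]
    rfl

theorem tensorComul_d_zeroForms (z : A ⊗[k] H) :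
    tensorComul grA hΔ ((tensorDGA cA cH).d (zeroForms cA cH z)) =
      zeroFormsD₃ cA cH ((Coalgebra.comul (R := k) (A := H)).lTensor A z) := by
  induction z using TensorProduct.induction_on with
  | zero => simp
  | add x y hx hy => simp only [map_add, hx, hy]
  | tmul a h =>
    rw [tensorDGA_d_zeroForms, map_add, tensorComul_tmul, tensorComul_tmul, hΔ.map_d_ι,
      hΔ.extends_comul, LinearMap.lTensor_tmul, zeroFormsD₃_tmul]
    rfl

/-- Both sides are algebra morphisms in x, so they are compared on a and da. There each is a fixed
linear function (`zeroForms₃` or `zeroFormsD₃`) of the corresponding side of coassociativity over A.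
-/
theorem coact_coassoc (x : ΩA) : gradedAssoc grA grH grH (K.coactTensor (K.coact x)) =
    tensorComul grA hΔ (K.coact x) := by
  suffices h : ((gradedAssoc grA grH grH).comp K.coactTensor).comp K.coact =
      (tensorComul grA hΔ).comp K.coact from DFunLike.congr_fun h x
  refine cA.algHom_ext (fun a => ?_) (fun a => ?_)
  · simp only [AlgHom.comp_apply, K.coact_ι, coactTensor_zeroForms, tensorComul_zeroForms,
      ρ.coassoc]
  · simp only [AlgHom.comp_apply, K.coact_d, K.coact_ι, coactTensor_d_zeroForms,
      tensorComul_d_zeroForms, ρ.coassoc]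

variable {ε : ΩH →ₐ[k] k} (hε : ∀ a, ε (cH.ι a) = Coalgebra.counit (R := k) a)
  (hε' : ∀ n, ∀ θ ∈ grH (n + 1), ε θ = 0)

variable (grA) in
/-- The map `id ⊗ ε` on `Ω(A) ⊗ Ω(H)`. -/
def tensorCounit : grA ᵍ⊗[k] grH →ₐ[k] ΩA :=
  GradedTensorProduct.lift grA grH (AlgHom.id k ΩA) ((Algebra.ofId k ΩA).comp ε)
    (fun i j a b => by
      cases j with
      | zero => simpa using (Algebra.commutes (ε b) (a : ΩA)).symm
      | succ j => simp [hε' j b b.2])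

theorem tensorCounit_tmul (x : ΩA) (θ : ΩH) :
    tensorCounit grA hε' (x ᵍ⊗ₜ[k] θ) = x * algebraMap k ΩA (ε θ) := rfl

include hε in
theorem tensorCounit_coact (x : ΩA) : tensorCounit grA hε' (K.coact x) = x := by
  have h₁ : ∀ z : A ⊗[k] H, tensorCounit grA hε' (zeroForms cA cH z) =
      cA.ι (TensorProduct.rid k A ((Coalgebra.counit (R := k) (A := H)).lTensor A z)) := by
    intro z
    induction z using TensorProduct.induction_on with
    | zero => simp
    | add x y hx hy => simp only [map_add, hx, hy]
    | tmul a h =>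
      rw [zeroForms_tmul, tensorCounit_tmul, hε]
      simp [Algebra.smul_def, Algebra.commutes]
  have h₂ : ∀ z : A ⊗[k] H, tensorCounit grA hε' ((tensorDGA cA cH).d (zeroForms cA cH z)) =
      cA.d (cA.ι (TensorProduct.rid k A ((Coalgebra.counit (R := k) (A := H)).lTensor A z))) := by
    intro z
    induction z using TensorProduct.induction_on with
    | zero => simp
    | add x y hx hy => simp only [map_add, hx, hy]
    | tmul a h =>
      rw [tensorDGA_d_zeroForms, map_add, tensorCounit_tmul, tensorCounit_tmul, hε,
        hε' 0 _ (cH.d_ι_mem h), ← Algebra.commutes, ← Algebra.smul_def]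
      simp
  suffices h : (tensorCounit grA hε').comp K.coact = AlgHom.id k ΩA from DFunLike.congr_fun h x
  refine cA.algHom_ext (fun a => ?_) (fun a => ?_)
  · simp only [AlgHom.comp_apply, K.coact_ι, h₁, ρ.counit, AlgHom.id_apply]
  · simp only [AlgHom.comp_apply, K.coact_d, K.coact_ι, h₂, ρ.counit, AlgHom.id_apply]

end CompleteCalculus

end Coaction

/-! ## The antipode reverses the comultiplication -/

section AntipodeComul

open Coalgebra WithConv HopfAlgebra

variable {k : Type*} [Field k] {H : Type*} [Ring H] [HopfAlgebra k H]

theorem conv_left_right : toConv (Algebra.TensorProduct.includeLeft :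
      H →ₐ[k] H ⊗[k] H).toLinearMap *
    toConv (Algebra.TensorProduct.includeRight : H →ₐ[k] H ⊗[k] H).toLinearMap =
      toConv (comul : H →ₗ[k] H ⊗[k] H) := by
  refine WithConv.ext (LinearMap.ext fun h => ?_)
  have := (ℛ k h).convMul_apply (toConv (Algebra.TensorProduct.includeLeft :
      H →ₐ[k] H ⊗[k] H).toLinearMap)
    (toConv (Algebra.TensorProduct.includeRight : H →ₐ[k] H ⊗[k] H).toLinearMap)
  refine this.trans ?_
  simp [(ℛ k h).eq]

theorem conv_comp_antipode {R : Type*} [Ring R] [Algebra k R] (f : H →ₐ[k] R) :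
    toConv f.toLinearMap * toConv (f.toLinearMap ∘ₗ antipode k) = 1 := by
  refine WithConv.ext (LinearMap.ext fun h => ?_)
  refine ((ℛ k h).convMul_apply _ _).trans ?_
  have := congrArg f (sum_mul_antipode_eq_algebraMap_counit (ℛ k h))
  simpa using this

theorem conv_antipode_comp {R : Type*} [Ring R] [Algebra k R] (f : H →ₐ[k] R) :
    toConv (f.toLinearMap ∘ₗ antipode k) * toConv f.toLinearMap = 1 := by
  refine WithConv.ext (LinearMap.ext fun h => ?_)
  refine ((ℛ k h).convMul_apply _ _).trans ?_
  have := congrArg f (sum_antipode_mul_eq_algebraMap_counit (ℛ k h))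
  simpa using this

theorem conv_antipode_right_left :
    toConv ((Algebra.TensorProduct.includeRight : H →ₐ[k] H ⊗[k] H).toLinearMap ∘ₗ antipode k) *
      toConv ((Algebra.TensorProduct.includeLeft : H →ₐ[k] H ⊗[k] H).toLinearMap ∘ₗ antipode k) =
      toConv (TensorProduct.map (antipode k) (antipode k) ∘ₗ
        (TensorProduct.comm k H H).toLinearMap ∘ₗ comul) := by
  refine WithConv.ext (LinearMap.ext fun h => ?_)
  refine ((ℛ k h).convMul_apply _ _).trans ?_
  change _ = TensorProduct.map (antipode k) (antipode k) (TensorProduct.comm k H H (comul h))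
  conv_rhs => rw [← (ℛ k h).eq]
  simp

/-- Both sides are convolution inverses of the comultiplication: one by composing the antipode with
an algebra morphism, the other because Δ is the convolution product of the two inclusions of H into
H ⊗ H. -/
theorem comul_antipode (h : H) : comul (R := k) (antipode k h) =
    TensorProduct.map (antipode k) (antipode k) (TensorProduct.comm k H H (comul h)) := by
  have h₁ := conv_comp_antipode (Bialgebra.comulAlgHom k H)
  have h₂ : toConv (TensorProduct.map (antipode k) (antipode k) ∘ₗ
        (TensorProduct.comm k H H).toLinearMap ∘ₗ comul) *
      toConv (Bialgebra.comulAlgHom k H).toLinearMap = 1 := by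
    have e : toConv (Bialgebra.comulAlgHom k H).toLinearMap =
      toConv (comul : H →ₗ[k] H ⊗[k] H) := rfl
    rw [← conv_antipode_right_left, e, ← conv_left_right, mul_assoc, ← mul_assoc (toConv
      ((Algebra.TensorProduct.includeLeft : H →ₐ[k] H ⊗[k] H).toLinearMap ∘ₗ antipode k)),
      conv_antipode_comp, one_mul, conv_antipode_comp]
  have h₃ := left_inv_eq_right_inv h₂ h₁
  exact (LinearMap.congr_fun (congrArg WithConv.ofConv h₃) h).symm

theorem comul_mul_antipode (h : H) : LinearMap.mul' k (H ⊗[k] H) (TensorProduct.map comul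
    ((Algebra.TensorProduct.includeRight : H →ₐ[k] H ⊗[k] H).toLinearMap ∘ₗ antipode k)
      (comul h)) = h ⊗ₜ 1 := by
  have h₁ : toConv (comul : H →ₗ[k] H ⊗[k] H) * toConv ((Algebra.TensorProduct.includeRight :
      H →ₐ[k] H ⊗[k] H).toLinearMap ∘ₗ antipode k) =
      toConv (Algebra.TensorProduct.includeLeft : H →ₐ[k] H ⊗[k] H).toLinearMap := by
    rw [← conv_left_right, mul_assoc, conv_comp_antipode, mul_one]
  exact LinearMap.congr_fun (congrArg WithConv.ofConv h₁) h

/-- Writing h = S(g) reduces it to `comul_mul_antipode`. This is the cancellation that makes the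
second leg of τ(S⁻¹(m₁)) m₀ coinvariant for horizontal m. -/
theorem comul_antipodeInv_mul (hS : Function.Bijective (antipode k : H →ₗ[k] H)) (h : H) :
    TensorProduct.lift ((LinearMap.mul k (H ⊗[k] H)).flip.compl₁₂
      (Algebra.TensorProduct.includeRight : H →ₐ[k] H ⊗[k] H).toLinearMap
      (comul ∘ₗ antipodeInv hS)) (comul h) = antipodeInv hS h ⊗ₜ 1 := by
  obtain ⟨g, rfl⟩ := hS.2 h
  rw [comul_antipode, antipodeInv_antipode, ← comul_mul_antipode]
  generalize (comul g : H ⊗[k] H) = t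
  induction t using TensorProduct.induction_on with
  | zero => simp
  | add x y hx hy => simp only [map_add, hx, hy]
  | tmul a b => simp [antipodeInv_antipode]

theorem counit_antipodeInv (hS : Function.Bijective (antipode k : H →ₗ[k] H)) (h : H) :
    counit (R := k) (antipodeInv hS h) = counit (R := k) h := by
  conv_rhs => rw [← antipode_antipodeInv hS h, counit_antipode]

end AntipodeComul

/-! ## The translation map of a quantum principal bundle -/

section Translation

variable {k : Type*} [Field k] {H : Type*} [Ring H] [HopfAlgebra k H]
  {A : Type*} [Ring A] [Algebra k A] (ρ : ComoduleAlgebra k H A)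

namespace ComoduleAlgebra

theorem coact_coinvariant (b : ρ.coinvariants) : ρ.coact (b : A) = (b : A) ⊗ₜ[k] (1 : H) := b.2

theorem galoisMap_tmul (x y : A) : ρ.galoisMap (Bal.tmul ρ.coinvariants x y) =
    (x ⊗ₜ[k] (1 : H)) * ρ.coact y := rfl

theorem galoisMap_smul (a : A) (z : Bal ρ.coinvariants A A) :
    ρ.galoisMap (a • z) = (a ⊗ₜ[k] (1 : H)) * ρ.galoisMap z := by
  refine LinearMap.congr_fun (f := ρ.galoisMap ∘ₗ Bal.leftMul ρ.coinvariants A A a)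
    (g := LinearMap.mulLeft k (a ⊗ₜ[k] (1 : H)) ∘ₗ ρ.galoisMap)
    (Bal.hom_ext _ fun x y => ?_) z
  change ((a * x) ⊗ₜ[k] (1 : H)) * ρ.coact y = (a ⊗ₜ[k] (1 : H)) * ((x ⊗ₜ[k] 1) * ρ.coact y)
  rw [← mul_assoc, Algebra.TensorProduct.tmul_mul_tmul, one_mul]

theorem galoisMap_op_smul (a : A) (z : Bal ρ.coinvariants A A) :
    ρ.galoisMap (MulOpposite.op a • z) = ρ.galoisMap z * ρ.coact a := by
  refine LinearMap.congr_fun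
    (f := ρ.galoisMap ∘ₗ Bal.rightMul ρ.coinvariants A A (MulOpposite.op a))
    (g := LinearMap.mulRight k (ρ.coact a) ∘ₗ ρ.galoisMap)
    (Bal.hom_ext _ fun x y => ?_) z
  change (x ⊗ₜ[k] (1 : H)) * ρ.coact (y * a) = (x ⊗ₜ[k] (1 : H)) * ρ.coact y * ρ.coact a
  rw [map_mul, mul_assoc]

variable (hρ : Function.Bijective ρ.galoisMap)

/-- The translation map `h ↦ h⟨1⟩ ⊗ h⟨2⟩ = χ⁻¹(1 ⊗ h)`. -/
def translation : H →ₗ[k] Bal ρ.coinvariants A A :=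
  (LinearEquiv.ofBijective ρ.galoisMap hρ).symm.toLinearMap ∘ₗ TensorProduct.mk k A H 1

theorem galoisMap_translation (h : H) : ρ.galoisMap (ρ.translation hρ h) = 1 ⊗ₜ h :=
  (LinearEquiv.ofBijective ρ.galoisMap hρ).apply_symm_apply _

/-- The map `x ⊗ h ↦ x h⟨1⟩ ⊗ h⟨2⟩`, which is the inverse of the Hopf–Galois map. -/
def mulTranslation : A ⊗[k] H →ₗ[k] Bal ρ.coinvariants A A :=
  TensorProduct.lift (LinearMap.mk₂ k (fun (x : A) (h : H) => x • ρ.translation hρ h)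
    (fun x y h => add_smul x y _)
    (fun c x h => LinearMap.congr_fun (Bal.leftMul_smul ρ.coinvariants c x) _)
    (fun x h h' => by rw [map_add, smul_add])
    (fun c x h => by rw [map_smul]; exact map_smul (Bal.leftMul ρ.coinvariants A A x) c _))

theorem mulTranslation_tmul (x : A) (h : H) :
    ρ.mulTranslation hρ (x ⊗ₜ h) = x • ρ.translation hρ h := rfl

theorem galoisMap_mulTranslation (t : A ⊗[k] H) : ρ.galoisMap (ρ.mulTranslation hρ t) = t := by
  induction t using TensorProduct.induction_on with
  | zero => simp
  | add x y hx hy => rw [map_add, map_add, hx, hy]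
  | tmul x h => rw [mulTranslation_tmul, galoisMap_smul, galoisMap_translation]; simp

theorem mulTranslation_coact (a : A) :
    ρ.mulTranslation hρ (ρ.coact a) = Bal.tmul ρ.coinvariants 1 a := hρ.1 (by
  rw [galoisMap_mulTranslation, galoisMap_tmul, ← Algebra.TensorProduct.one_def, one_mul])

/-- The coaction on the second factor of `A ⊗_B A`. -/
def coactRight : Bal ρ.coinvariants A A →ₗ[k] Bal ρ.coinvariants A A ⊗[k] H :=
  Bal.lift _ (LinearMap.mk₂ k (fun x y => (Bal.mk ρ.coinvariants A A x).rTensor H (ρ.coact y))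
    (fun x x' y => by rw [map_add, LinearMap.rTensor_add, LinearMap.add_apply])
    (fun c x y => by rw [map_smul, LinearMap.rTensor_smul, LinearMap.smul_apply])
    (fun x y y' => by rw [map_add, map_add])
    (fun c x y => by rw [map_smul, map_smul]))
    (by
      intro x b y
      change (Bal.mk ρ.coinvariants A A (x * b)).rTensor H (ρ.coact y) =
        (Bal.mk ρ.coinvariants A A x).rTensor H (ρ.coact (b * y))
      rw [map_mul ρ.coact, coact_coinvariant]
      generalize ρ.coact y = t
      induction t using TensorProduct.induction_on with
      | zero => simp
      | add s t hs ht => rw [mul_add, map_add, map_add, hs, ht]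
      | tmul a h =>
        rw [Algebra.TensorProduct.tmul_mul_tmul, one_mul, LinearMap.rTensor_tmul,
          LinearMap.rTensor_tmul]
        exact congrArg (· ⊗ₜ[k] h) (Bal.tmul_balanced ρ.coinvariants x b a))

theorem coactRight_tmul (x y : A) : ρ.coactRight (Bal.tmul ρ.coinvariants x y) =
    (Bal.mk ρ.coinvariants A A x).rTensor H (ρ.coact y) := rfl

theorem rTensor_galoisMap_coactRight (z : Bal ρ.coinvariants A A) :
    TensorProduct.assoc k A H H (ρ.galoisMap.rTensor H (ρ.coactRight z)) =
      (Coalgebra.comul (R := k) (A := H)).lTensor A (ρ.galoisMap z) := by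
  refine LinearMap.congr_fun (f := (TensorProduct.assoc k A H H).toLinearMap ∘ₗ
      ρ.galoisMap.rTensor H ∘ₗ ρ.coactRight)
    (g := (Coalgebra.comul (R := k) (A := H)).lTensor A ∘ₗ ρ.galoisMap)
    (Bal.hom_ext _ fun x y => ?_) z
  change TensorProduct.assoc k A H H (ρ.galoisMap.rTensor H
    ((Bal.mk ρ.coinvariants A A x).rTensor H (ρ.coact y))) =
      (Coalgebra.comul (R := k) (A := H)).lTensor A ((x ⊗ₜ[k] (1 : H)) * ρ.coact y)
  have h₁ : ∀ t : A ⊗[k] H, TensorProduct.assoc k A H H (ρ.galoisMap.rTensor H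
      ((Bal.mk ρ.coinvariants A A x).rTensor H t)) = (LinearMap.mulLeft k x).rTensor (H ⊗[k] H)
        (TensorProduct.assoc k A H H (ρ.coact.toLinearMap.rTensor H t)) := by
    intro t
    induction t using TensorProduct.induction_on with
    | zero => simp
    | add s t hs ht => simp only [map_add, hs, ht]
    | tmul a h =>
      change TensorProduct.assoc k A H H (((x ⊗ₜ[k] (1 : H)) * ρ.coact a) ⊗ₜ h) =
        (LinearMap.mulLeft k x).rTensor (H ⊗[k] H)
          (TensorProduct.assoc k A H H (ρ.coact a ⊗ₜ h))
      generalize ρ.coact a = s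
      induction s using TensorProduct.induction_on with
      | zero => simp
      | add s t hs ht => simp only [mul_add, TensorProduct.add_tmul, map_add, hs, ht]
      | tmul a' h' => simp
  have h₂ : ∀ t : A ⊗[k] H, (LinearMap.mulLeft k x).rTensor (H ⊗[k] H)
      ((Coalgebra.comul (R := k) (A := H)).lTensor A t) =
        (Coalgebra.comul (R := k) (A := H)).lTensor A ((x ⊗ₜ[k] (1 : H)) * t) := by
    intro t
    induction t using TensorProduct.induction_on with
    | zero => simp
    | add s t hs ht => simp only [mul_add, map_add, hs, ht]
    | tmul a h => simp
  rw [h₁, ρ.coassoc, h₂]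

/-- Checked after the Hopf–Galois map tensored with H, which is injective because H is flat over the
field; there both sides become 1 ⊗ Δ(h). -/
theorem coactRight_translation (h : H) : ρ.coactRight (ρ.translation hρ h) =
    (ρ.translation hρ).rTensor H (Coalgebra.comul (R := k) h) := by
  have hinj : Function.Injective (ρ.galoisMap.rTensor H) :=
    Module.Flat.rTensor_preserves_injective_linearMap _ hρ.1
  refine hinj ((TensorProduct.assoc k A H H).injective ?_)
  rw [rTensor_galoisMap_coactRight, galoisMap_translation, LinearMap.lTensor_tmul]
  generalize (Coalgebra.comul h : H ⊗[k] H) = t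
  induction t using TensorProduct.induction_on with
  | zero => simp
  | add s t hs ht => simp only [map_add, TensorProduct.tmul_add, hs, ht]
  | tmul a b => simp [galoisMap_translation]

/-- The map `x ⊗ y ↦ x_0 y ⊗ x_1`. -/
def leftGaloisMap : Bal ρ.coinvariants A A →ₗ[k] A ⊗[k] H :=
  Bal.lift _ ((LinearMap.mul k (A ⊗[k] H)).compl₁₂ ρ.coact.toLinearMap
    (Algebra.TensorProduct.includeLeft : A →ₐ[k] A ⊗[k] H).toLinearMap) (by
    intro x b y
    change ρ.coact (x * b) * (y ⊗ₜ[k] (1 : H)) = ρ.coact x * ((b * y : A) ⊗ₜ[k] (1 : H))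
    rw [map_mul, coact_coinvariant, mul_assoc, Algebra.TensorProduct.tmul_mul_tmul, one_mul])

theorem leftGaloisMap_tmul (x y : A) : ρ.leftGaloisMap (Bal.tmul ρ.coinvariants x y) =
    ρ.coact x * (y ⊗ₜ[k] (1 : H)) := rfl

/-- The map `x ⊗ h ↦ x_0 ⊗ x_1 S(h)`. -/
def coactMulAntipode : A ⊗[k] H →ₗ[k] A ⊗[k] H :=
  TensorProduct.lift ((LinearMap.mul k (A ⊗[k] H)).compl₁₂ ρ.coact.toLinearMap
    (TensorProduct.mk k A H 1 ∘ₗ HopfAlgebra.antipode k))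

theorem coactMulAntipode_tmul (x : A) (h : H) : ρ.coactMulAntipode (x ⊗ₜ h) =
    ρ.coact x * (1 ⊗ₜ HopfAlgebra.antipode k h) := rfl

theorem coactMulAntipode_coact (x : A) : ρ.coactMulAntipode (ρ.coact x) = x ⊗ₜ 1 := by
  have h₁ : ∀ t : A ⊗[k] H, ρ.coactMulAntipode t =
      (LinearMap.mul' k H ∘ₗ (HopfAlgebra.antipode k).lTensor H).lTensor A
        (TensorProduct.assoc k A H H (ρ.coact.toLinearMap.rTensor H t)) := by
    intro t
    induction t using TensorProduct.induction_on with
    | zero => simp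
    | add s t hs ht => simp only [map_add, hs, ht]
    | tmul a h =>
      rw [coactMulAntipode_tmul, LinearMap.rTensor_tmul]
      change _ = (LinearMap.mul' k H ∘ₗ (HopfAlgebra.antipode k).lTensor H).lTensor A
        (TensorProduct.assoc k A H H (ρ.coact a ⊗ₜ h))
      generalize ρ.coact a = s
      induction s using TensorProduct.induction_on with
      | zero => simp
      | add s t hs ht => simp only [add_mul, TensorProduct.add_tmul, map_add, hs, ht]
      | tmul a' h' => simp
  have h₂ : ∀ t : A ⊗[k] H, (LinearMap.mul' k H ∘ₗ (HopfAlgebra.antipode k).lTensor H).lTensor A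
      ((Coalgebra.comul (R := k) (A := H)).lTensor A t) =
        TensorProduct.rid k A ((Coalgebra.counit (R := k) (A := H)).lTensor A t) ⊗ₜ 1 := by
    intro t
    induction t using TensorProduct.induction_on with
    | zero => simp
    | add s t hs ht => simp only [map_add, hs, ht, TensorProduct.add_tmul]
    | tmul a h =>
      simp [Algebra.algebraMap_eq_smul_one, TensorProduct.smul_tmul]
  rw [h₁, ρ.coassoc, h₂, ρ.counit]

/-- From x₀ y₀ ⊗ x₁ y₁ S(y₂) = x₀ y ⊗ x₁: the left-handed Hopf–Galois map is the usual one followed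
by x ⊗ h ↦ x₀ ⊗ x₁ S(h). Hence h⟨1⟩₀ h⟨2⟩ ⊗ h⟨1⟩₁ = 1 ⊗ S(h). -/
theorem leftGaloisMap_eq (z : Bal ρ.coinvariants A A) :
    ρ.leftGaloisMap z = ρ.coactMulAntipode (ρ.galoisMap z) := by
  refine LinearMap.congr_fun (f := ρ.leftGaloisMap) (g := ρ.coactMulAntipode ∘ₗ ρ.galoisMap)
    (Bal.hom_ext _ fun x y => ?_) z
  rw [leftGaloisMap_tmul, LinearMap.comp_apply, galoisMap_tmul, ← coactMulAntipode_coact]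
  generalize ρ.coact y = t
  induction t using TensorProduct.induction_on with
  | zero => simp
  | add s t hs ht => simp only [mul_add, map_add, hs, ht]
  | tmul a h => simp [coactMulAntipode_tmul, mul_assoc]

theorem leftGaloisMap_translation (h : H) :
    ρ.leftGaloisMap (ρ.translation hρ h) = 1 ⊗ₜ HopfAlgebra.antipode k h := by
  rw [leftGaloisMap_eq, galoisMap_translation, coactMulAntipode_tmul, map_one, one_mul]

/-- The product `A ⊗_B A → A`. -/
def mulBal : Bal ρ.coinvariants A A →ₗ[k] A :=
  Bal.lift _ (LinearMap.mul k A) fun x b y => mul_assoc x b y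

theorem mulBal_translation (h : H) :
    ρ.mulBal (ρ.translation hρ h) = algebraMap k A (Coalgebra.counit (R := k) h) := by
  have h₁ : ∀ z, ρ.mulBal z = TensorProduct.rid k A
      ((Coalgebra.counit (R := k) (A := H)).lTensor A (ρ.galoisMap z)) := by
    intro z
    refine LinearMap.congr_fun (f := ρ.mulBal) (g := (TensorProduct.rid k A).toLinearMap ∘ₗ
      (Coalgebra.counit (R := k) (A := H)).lTensor A ∘ₗ ρ.galoisMap)
      (Bal.hom_ext _ fun x y => ?_) z
    change x * y = TensorProduct.rid k A ((Coalgebra.counit (R := k) (A := H)).lTensor A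
      ((x ⊗ₜ[k] (1 : H)) * ρ.coact y))
    conv_lhs => rw [← ρ.counit y]
    generalize ρ.coact y = t
    induction t using TensorProduct.induction_on with
    | zero => simp
    | add s t hs ht => simp only [mul_add, map_add, hs, ht]
    | tmul a h => simp
  rw [h₁, galoisMap_translation]
  simp [Algebra.algebraMap_eq_smul_one]

/-- The map `x ⊗ y ↦ x τ(h) y`. -/
def insertTranslation (h : H) : Bal ρ.coinvariants A A →ₗ[k] Bal ρ.coinvariants A A :=
  Bal.lift _ (LinearMap.mk₂ k (fun x y => MulOpposite.op y • x • ρ.translation hρ h)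
    (fun x x' y => by rw [add_smul, smul_add])
    (fun c x y => by
      have e := LinearMap.congr_fun (Bal.leftMul_smul (X := A) (Y := A) ρ.coinvariants c x)
        (ρ.translation hρ h)
      change MulOpposite.op y • (Bal.leftMul ρ.coinvariants A A (c • x) _) = _
      rw [e]
      exact map_smul (Bal.rightMul ρ.coinvariants A A (MulOpposite.op y)) c _)
    (fun x y y' => by rw [MulOpposite.op_add, add_smul])
    (fun c x y => LinearMap.congr_fun
      (Bal.rightMul_smul (X := A) (Y := A) ρ.coinvariants c (MulOpposite.op y)) _))
    (by
      intro x b y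
      change MulOpposite.op y • (x * (b : A)) • ρ.translation hρ h =
        MulOpposite.op ((b : A) * y) • x • ρ.translation hρ h
      -- Well-definedness amounts to b τ(h) = τ(h) b for coinvariant b, which is visible after the
      -- Hopf–Galois map: both give b ⊗ h.
      refine hρ.1 ?_
      simp only [galoisMap_op_smul, galoisMap_smul, galoisMap_translation, map_mul,
        coact_coinvariant, ← mul_assoc, Algebra.TensorProduct.tmul_mul_tmul, one_mul, mul_one])

/-- Under the Hopf–Galois map, inserting τ(g) is left multiplication by 1 ⊗ g. This is the source of
the multiplicativity of h ↦ L_h. -/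
theorem insertTranslation_translation (g h : H) :
    ρ.insertTranslation hρ g (ρ.translation hρ h) = ρ.translation hρ (g * h) := by
  have h₁ : ∀ z, ρ.galoisMap (ρ.insertTranslation hρ g z) = (1 ⊗ₜ g) * ρ.galoisMap z := by
    intro z
    refine LinearMap.congr_fun (f := ρ.galoisMap ∘ₗ ρ.insertTranslation hρ g)
      (g := LinearMap.mulLeft k (1 ⊗ₜ[k] g) ∘ₗ ρ.galoisMap) (Bal.hom_ext _ fun x y => ?_) z
    change ρ.galoisMap (MulOpposite.op y • x • ρ.translation hρ g) =
      (1 ⊗ₜ g) * ((x ⊗ₜ[k] (1 : H)) * ρ.coact y)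
    rw [galoisMap_op_smul, galoisMap_smul, galoisMap_translation, ← mul_assoc,
      Algebra.TensorProduct.tmul_mul_tmul, Algebra.TensorProduct.tmul_mul_tmul]
    simp
  refine hρ.1 ?_
  rw [h₁, galoisMap_translation, galoisMap_translation, Algebra.TensorProduct.tmul_mul_tmul,
    one_mul]

end ComoduleAlgebra

end Translation

/-! ## Kernels of `A ⊗_B g` for a flat extension `B ⊆ A` -/

section Flatness

universe u v w w'

theorem small_tensorProduct {k : Type*} [Field k] {M : Type w} {N : Type w'} [AddCommGroup M]
    [AddCommGroup N] [Module k M] [Module k N] [Small.{v} M] [Small.{v} N] :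
    Small.{v} (M ⊗[k] N) := by
  have : Small.{v} (FreeAddMonoid (M × N)) := inferInstanceAs (Small.{v} (List (M × N)))
  exact small_of_surjective (f := AddCon.mk' (addConGen (TensorProduct.Eqv k M N)))
    AddCon.mk'_surjective

/-- The forms are a quotient of the free ring on two copies of A. Flatness is tested only against
modules in the universe of A, so Ω(A) and Ω(H) must be brought down to it. -/
theorem DiffCalculus.small {k : Type*} [Field k] {A : Type w} [Ring A] [Algebra k A]
    [Small.{v} A] {Ω : Type*} [Ring Ω] [Algebra k Ω] {gr : ℕ → Submodule k Ω} [GradedAlgebra gr]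
    (c : DiffCalculus A gr) : Small.{v} Ω := by
  let e := equivShrink.{v} A
  let f : FreeRing (Shrink.{v} A ⊕ Shrink.{v} A) →+* Ω :=
    FreeRing.lift (Sum.elim (fun a => c.ι (e.symm a)) (fun a => c.d (c.ι (e.symm a))))
  refine small_of_surjective (f := f) fun x => ?_
  induction x using c.induction with
  | hι a => exact ⟨FreeRing.of (Sum.inl (e a)), by simp [f]⟩
  | hd a => exact ⟨FreeRing.of (Sum.inr (e a)), by simp [f]⟩
  | hadd x y hx hy =>
    obtain ⟨p, rfl⟩ := hx
    obtain ⟨q, rfl⟩ := hy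
    exact ⟨p + q, map_add f p q⟩
  | hmul m n x _ y _ hx hy =>
    obtain ⟨p, rfl⟩ := hx
    obtain ⟨q, rfl⟩ := hy
    exact ⟨p * q, map_mul f p q⟩

theorem isScalarTower_shrink {k : Type*} [Field k] {B : Type*} [Ring B] [Algebra k B] {N : Type w}
    [AddCommGroup N] [Module k N] [Module B N] [IsScalarTower k B N] [Small.{v} N] :
    IsScalarTower k B (Shrink.{v} N) :=
  ⟨fun c b x => (Shrink.linearEquiv B N).injective (by
    have h : ∀ (c : k) (y : Shrink.{v} N),
      Shrink.linearEquiv B N (c • y) = c • Shrink.linearEquiv B N y :=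
        fun c y => map_smul (Shrink.linearEquiv k N) c y
    rw [h, map_smul, map_smul, smul_assoc])⟩

/-- Tensoring the exact sequence ker g → N → P with A keeps it exact, so the kernel of A ⊗_B g comes
from ker g. The sequence is first transported to small copies of N and P in the universe of A. -/
theorem IsRightFaithfullyFlat.mem_span_of_lmap_eq_zero {k : Type u} [Field k] {A : Type v} [Ring A]
    [Algebra k A] {B : Subalgebra k A} (hB : IsRightFaithfullyFlat B)
    {N : Type w} [AddCommGroup N] [Module k N] [Module B N] [IsScalarTower k B N] [Small.{v} N]
    {P : Type w'} [AddCommGroup P] [Module k P] [Module B P] [IsScalarTower k B P] [Small.{v} P]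
    (g : N →ₗ[k] P) (hg : ∀ (b : B) (n : N), g (b • n) = b • g n) (z : Bal B A N)
    (hz : Bal.lmap B A g hg z = 0) :
    z ∈ Submodule.span k {z | ∃ (a : A) (n : N), g n = 0 ∧ z = Bal.tmul B a n} := by
  have : IsScalarTower k B (Shrink.{v} N) := isScalarTower_shrink
  have : IsScalarTower k B (Shrink.{v} P) := isScalarTower_shrink
  let eN := Shrink.linearEquiv.{v} B N
  let eP := Shrink.linearEquiv.{v} B P
  let gB : N →ₗ[B] P := { g with map_smul' := hg }
  let g' : Shrink.{v} N →ₗ[B] Shrink.{v} P := eP.symm.toLinearMap ∘ₗ gB ∘ₗ eN.toLinearMap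
  have hex := (hB _ _ _ (LinearMap.ker g').subtype g').1 (LinearMap.exact_subtype_ker_map g')
  let e' : N →ₗ[k] Shrink.{v} N := eN.symm.toLinearMap.restrictScalars k
  let e : Shrink.{v} N →ₗ[k] N := eN.toLinearMap.restrictScalars k
  let p : P →ₗ[k] Shrink.{v} P := eP.symm.toLinearMap.restrictScalars k
  have h₁ : Bal.lmap B A (g'.restrictScalars k) (fun b y => map_smul g' b y)
      (Bal.lmap B A e' (fun b y => map_smul eN.symm b y) z) =
        Bal.lmap B A p (fun b y => map_smul eP.symm b y) (Bal.lmap B A g hg z) :=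
    LinearMap.congr_fun (f := Bal.lmap B A (g'.restrictScalars k) (fun b y => map_smul g' b y) ∘ₗ
        Bal.lmap B A e' (fun b y => map_smul eN.symm b y))
      (g := Bal.lmap B A p (fun b y => map_smul eP.symm b y) ∘ₗ Bal.lmap B A g hg)
      (Bal.hom_ext _ fun x y => congrArg (Bal.tmul B x)
        (congrArg (fun t => eP.symm (g t)) (eN.apply_symm_apply y))) z
  rw [hz, map_zero] at h₁
  obtain ⟨w, hw⟩ := (hex _).1 h₁
  have h₂ : z = Bal.lmap B A e (fun b y => map_smul eN b y)
      (Bal.lmap B A e' (fun b y => map_smul eN.symm b y) z) :=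
    LinearMap.congr_fun (f := LinearMap.id)
      (g := Bal.lmap B A e (fun b y => map_smul eN b y) ∘ₗ
        Bal.lmap B A e' (fun b y => map_smul eN.symm b y))
      (Bal.hom_ext _ fun x y => congrArg (Bal.tmul B x) (eN.apply_symm_apply y).symm) z
  rw [h₂, ← hw]
  clear hw h₂ h₁ hz z
  induction w using Bal.induction with
  | h0 => simp
  | ht x y =>
    refine Submodule.subset_span ⟨x, eN y, ?_, rfl⟩
    exact eP.symm.map_eq_zero_iff.1 (LinearMap.mem_ker.1 y.2)
  | ha z z' hz hz' => rw [map_add, map_add]; exact Submodule.add_mem _ hz hz'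

/-- A Hopf–Galois extension of a nontrivial algebra bounds the size of the Hopf algebra. -/
theorem ComoduleAlgebra.small_of_bijective {k : Type u} [Field k] {H : Type w} [Ring H]
    [HopfAlgebra k H] {A : Type v} [Ring A] [Algebra k A] [Nontrivial A]
    (ρ : ComoduleAlgebra k H A) (hρ : Function.Bijective ρ.galoisMap) : Small.{v} H := by
  have : Small.{v} (A ⊗[k] A) := small_tensorProduct
  have : Small.{v} (Bal ρ.coinvariants A A) :=
    small_of_surjective (f := Bal.proj ρ.coinvariants A A) (Submodule.mkQ_surjective _)
  have h₁ : Function.Injective (fun h : H => (1 : A) ⊗ₜ[k] h) :=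
    Algebra.TensorProduct.includeRight_injective (algebraMap k A).injective
  refine small_of_injective (f := fun h : H => ρ.translation hρ h) fun g h hgh => h₁ ?_
  have := congrArg ρ.galoisMap hgh
  rwa [ρ.galoisMap_translation, ρ.galoisMap_translation] at this

end Flatness

/-! ## The action on the second factor of `A ⊗_B A` -/

section ActBal

variable {k : Type*} [Field k] {A : Type*} [Ring A] [Algebra k A] (B : Subalgebra k A)
  {Y : Type*} [AddCommGroup Y] [Module k Y] [Module A Y] [IsScalarTower k A Y]

/-- The map `y ↦ (u ⊗ v ↦ u ⊗ v y)`. -/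
def actBal : Y →ₗ[k] Bal B A A →ₗ[k] Bal B A Y :=
  LinearMap.mk₂ k (fun y => Bal.lmap B A ((Algebra.lsmul k k Y).toLinearMap.flip y)
      (fun b a => mul_smul (b : A) a y))
    (fun y y' z => LinearMap.congr_fun
      (f := Bal.lmap B A ((Algebra.lsmul k k Y).toLinearMap.flip (y + y'))
        (fun b a => mul_smul (b : A) a (y + y')))
      (g := Bal.lmap B A ((Algebra.lsmul k k Y).toLinearMap.flip y)
          (fun b a => mul_smul (b : A) a y) +
        Bal.lmap B A ((Algebra.lsmul k k Y).toLinearMap.flip y')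
          (fun b a => mul_smul (b : A) a y'))
      (Bal.hom_ext B fun u v => (congrArg (Bal.tmul B u) (smul_add v y y')).trans
        (Bal.tmul_add B u _ _)) z)
    (fun c y z => LinearMap.congr_fun
      (f := Bal.lmap B A ((Algebra.lsmul k k Y).toLinearMap.flip (c • y))
        (fun b a => mul_smul (b : A) a (c • y)))
      (g := c • Bal.lmap B A ((Algebra.lsmul k k Y).toLinearMap.flip y)
          (fun b a => mul_smul (b : A) a y))
      (Bal.hom_ext B fun u v => (congrArg (Bal.tmul B u) (smul_comm v c y)).trans
        (Bal.tmul_smul B c u _)) z)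
    (fun _ z z' => map_add _ z z') (fun c _ z => map_smul _ c z)

theorem actBal_tmul (y : Y) (u v : A) : actBal B y (Bal.tmul B u v) = Bal.tmul B u (v • y) := rfl

end ActBal

/-! ## Horizontal forms -/

section Horizontal

universe v

variable {k : Type*} [Field k] {H : Type*} [Ring H] [HopfAlgebra k H]
  {A : Type v} [Ring A] [Algebra k A]
  {ΩH : Type*} [Ring ΩH] [Algebra k ΩH] {grH : ℕ → Submodule k ΩH} [GradedAlgebra grH]
  {ΩA : Type*} [Ring ΩA] [Algebra k ΩA] {grA : ℕ → Submodule k ΩA} [GradedAlgebra grA]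
  {ρ : ComoduleAlgebra k H A} {cA : DiffCalculus A grA} {cH : DiffCalculus H grH}
  (K : CompleteCalculus ρ cA cH)

namespace CompleteCalculus

theorem coact_ι_coinvariant (b : ρ.coinvariants) :
    K.coact (cA.ι (b : A)) = (cA.ι (b : A)) ᵍ⊗ₜ[k] (1 : ΩH) := by
  rw [coact_ι, ρ.coact_coinvariant, zeroForms_tmul, map_one]

theorem ι_mem_base (b : ρ.coinvariants) : cA.ι (b : A) ∈ K.base := K.coact_ι_coinvariant b

variable [Module A ΩA] [IsScalarTower k A ΩA] (hA : ∀ (a : A) (x : ΩA), a • x = cA.ι a * x)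
  [Module A (grA ᵍ⊗[k] grH)] [IsScalarTower k A (grA ᵍ⊗[k] grH)]
  (hT : ∀ (a : A) (t : grA ᵍ⊗[k] grH), a • t = ((cA.ι a) ᵍ⊗ₜ[k] (1 : ΩH)) * t)

include hA in
theorem coinvariant_smul (b : ρ.coinvariants) (x : ΩA) : b • x = cA.ι (b : A) * x := hA b x

include hT in
theorem coinvariant_smul_tensor (b : ρ.coinvariants) (t : grA ᵍ⊗[k] grH) :
    b • t = ((cA.ι (b : A)) ᵍ⊗ₜ[k] (1 : ΩH)) * t := hT b t

include hA hT in
theorem coact_coinvariant_smul (b : ρ.coinvariants) (x : ΩA) :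
    K.coact.toLinearMap (b • x) = b • K.coact.toLinearMap x := by
  rw [coinvariant_smul hA, coinvariant_smul_tensor hT, AlgHom.toLinearMap_apply,
    AlgHom.toLinearMap_apply, map_mul, coact_ι_coinvariant]

include hA hT in
theorem includeLeft_coinvariant_smul (b : ρ.coinvariants) (x : ΩA) :
    (GradedTensorProduct.includeLeft grA grH).toLinearMap (b • x) =
      b • (GradedTensorProduct.includeLeft grA grH).toLinearMap x := by
  rw [coinvariant_smul hA, coinvariant_smul_tensor hT, AlgHom.toLinearMap_apply, map_mul]
  rfl

/-- The map `a ⊗ x ↦ ι(a) ⊗ x` from `A ⊗_B Ω(A)` to `Ω(A) ⊗_{Ω(B)} Ω(A)`. -/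
def fromBal : Bal ρ.coinvariants A ΩA →ₗ[k] K.E :=
  Bal.lift _ ((Bal.mk K.base ΩA ΩA).comp cA.ι.toLinearMap) (by
    intro a b x
    rw [coinvariant_smul hA]
    change Bal.tmul K.base (cA.ι (a * b)) x = Bal.tmul K.base (cA.ι a) (cA.ι (b : A) * x)
    rw [map_mul]
    exact Bal.tmul_balanced K.base (cA.ι a) ⟨_, K.ι_mem_base b⟩ x)

theorem fromBal_tmul (a : A) (x : ΩA) : K.fromBal hA (Bal.tmul ρ.coinvariants a x) =
    Bal.tmul K.base (cA.ι a) x := rfl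

variable (ρ) in
/-- The map `a ⊗ x ↦ ι(a) x`. -/
def mulForms : Bal ρ.coinvariants A ΩA →ₗ[k] ΩA :=
  Bal.lift _ ((LinearMap.mul k ΩA).comp cA.ι.toLinearMap) (by
    intro a b x
    rw [coinvariant_smul hA]
    change cA.ι (a * b) * x = cA.ι a * (cA.ι (b : A) * x)
    rw [map_mul, mul_assoc])

theorem mulForms_tmul (a : A) (x : ΩA) : mulForms ρ hA (Bal.tmul ρ.coinvariants a x) =
    cA.ι a * x := rfl

theorem mulForms_actBal (x : ΩA) (z : Bal ρ.coinvariants A A) :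
    mulForms ρ hA (actBal _ x z) = cA.ι (ρ.mulBal z) * x := by
  refine LinearMap.congr_fun (f := mulForms ρ hA ∘ₗ actBal _ x)
    (g := LinearMap.mulRight k x ∘ₗ cA.ι.toLinearMap ∘ₗ ρ.mulBal) (Bal.hom_ext _ fun u v => ?_) z
  change cA.ι u * (v • x) = cA.ι (u * v) * x
  rw [hA, map_mul, mul_assoc]

variable (grA cH) in
/-- The map `s ↦ ((u ⊗ v) ⊗ h ↦ u ⊗ (v ⊗ h) s)`. -/
def actBalTensor : grA ᵍ⊗[k] grH →ₗ[k] Bal ρ.coinvariants A A ⊗[k] H →ₗ[k]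
    Bal ρ.coinvariants A (grA ᵍ⊗[k] grH) where
  toFun s := TensorProduct.lift (actBal ρ.coinvariants ∘ₗ LinearMap.mulRight k s ∘ₗ
    (GradedTensorProduct.includeRight grA grH).toLinearMap ∘ₗ cH.ι.toLinearMap).flip
  map_add' s s' := TensorProduct.ext' fun z h => by
    change actBal ρ.coinvariants
        ((GradedTensorProduct.includeRight grA grH) (cH.ι h) * (s + s')) z =
      actBal ρ.coinvariants ((GradedTensorProduct.includeRight grA grH) (cH.ι h) * s) z +
        actBal ρ.coinvariants ((GradedTensorProduct.includeRight grA grH) (cH.ι h) * s') z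
    rw [mul_add, map_add, LinearMap.add_apply]
  map_smul' c s := TensorProduct.ext' fun z h => by
    change actBal ρ.coinvariants
        ((GradedTensorProduct.includeRight grA grH) (cH.ι h) * (c • s)) z =
      c • actBal ρ.coinvariants ((GradedTensorProduct.includeRight grA grH) (cH.ι h) * s) z
    rw [mul_smul_comm, map_smul, LinearMap.smul_apply]

theorem actBalTensor_tmul (s : grA ᵍ⊗[k] grH) (z : Bal ρ.coinvariants A A) (h : H) :
    actBalTensor grA cH s (z ⊗ₜ h) =
      actBal ρ.coinvariants (((1 : ΩA) ᵍ⊗ₜ[k] (cH.ι h)) * s) z := rfl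

theorem lmap_coact_actBal (x : ΩA) (z : Bal ρ.coinvariants A A) :
    Bal.lmap ρ.coinvariants A K.coact.toLinearMap (K.coact_coinvariant_smul hA hT)
      (actBal _ x z) = actBalTensor grA cH (K.coact x) (ρ.coactRight z) := by
  refine LinearMap.congr_fun (f := Bal.lmap ρ.coinvariants A K.coact.toLinearMap
      (K.coact_coinvariant_smul hA hT) ∘ₗ actBal _ x)
    (g := actBalTensor grA cH (K.coact x) ∘ₗ ρ.coactRight) (Bal.hom_ext _ fun u v => ?_) z
  change Bal.tmul _ u (K.coact (v • x)) = actBalTensor grA cH (K.coact x)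
    ((Bal.mk ρ.coinvariants A A u).rTensor H (ρ.coact v))
  rw [hA, map_mul, coact_ι]
  generalize ρ.coact v = t
  induction t using TensorProduct.induction_on with
  | zero => simp [Bal.tmul_zero]
  | add s t hs ht => simp only [map_add, add_mul, Bal.tmul_add, hs, ht]
  | tmul a h =>
    rw [LinearMap.rTensor_tmul, actBalTensor_tmul, Bal.mk_apply, actBal_tmul, hT, zeroForms_tmul,
      ← mul_assoc, GradedTensorProduct.tmul_one_mul_one_tmul]

variable (hρ : Function.Bijective ρ.galoisMap)
  (hS : Function.Bijective (HopfAlgebra.antipode k : H →ₗ[k] H))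

/-- The map `x ⊗ h ↦ τ(S⁻¹(h)) x`. -/
def translationMul : ΩA ⊗[k] H →ₗ[k] Bal ρ.coinvariants A ΩA :=
  TensorProduct.lift ((actBal ρ.coinvariants).compl₂ (ρ.translation hρ ∘ₗ antipodeInv hS))

theorem translationMul_tmul (x : ΩA) (h : H) : translationMul (ΩA := ΩA) hρ hS (x ⊗ₜ h) =
    actBal ρ.coinvariants x (ρ.translation hρ (antipodeInv hS h)) := rfl

/-- Multiplying the two legs of τ gives the counit, so τ(S⁻¹(m₁)) m₀ multiplies out to m. -/
theorem mulForms_translationMul (t : ΩA ⊗[k] H) : mulForms ρ hA (translationMul hρ hS t) =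
    TensorProduct.rid k ΩA ((Coalgebra.counit (R := k) (A := H)).lTensor ΩA t) := by
  induction t using TensorProduct.induction_on with
  | zero => simp
  | add s t hs ht => simp only [map_add, hs, ht]
  | tmul x h =>
    rw [translationMul_tmul, mulForms_actBal, ρ.mulBal_translation, counit_antipodeInv]
    simp [Algebra.smul_def]

variable (grA cH) in
/-- The map `x ⊗ (h ⊗ h') ↦ (x ⊗ ι(h)) ⊗ h'`. -/
def formsAssoc : ΩA ⊗[k] (H ⊗[k] H) →ₗ[k] (grA ᵍ⊗[k] grH) ⊗[k] H :=
  ((GradedTensorProduct.of k grA grH).toLinearMap ∘ₗ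
    cH.ι.toLinearMap.lTensor ΩA).rTensor H ∘ₗ (TensorProduct.assoc k ΩA H H).symm.toLinearMap

theorem formsAssoc_tmul (x : ΩA) (h h' : H) :
    formsAssoc grA cH (x ⊗ₜ (h ⊗ₜ h')) = (x ᵍ⊗ₜ[k] (cH.ι h)) ⊗ₜ h' := rfl

/-- (1 ⊗ b)(x ⊗ c) = (1 ⊗ b c)(x ⊗ 1), without sign because b has degree 0; so c is absorbed into
the comultiplication of S⁻¹. -/
theorem actBalTensor_translation (x : ΩA) (c : H) (p : H ⊗[k] H) :
    actBalTensor grA cH (x ᵍ⊗ₜ[k] (cH.ι c)) ((ρ.translation hρ).rTensor H p) =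
      actBalTensor grA cH (x ᵍ⊗ₜ[k] (1 : ΩH))
        ((ρ.translation hρ).rTensor H (p * (1 ⊗ₜ c))) := by
  induction p using TensorProduct.induction_on with
  | zero => simp
  | add s t hs ht => simp only [map_add, add_mul, hs, ht]
  | tmul a b =>
    have e : ((1 : ΩA) ᵍ⊗ₜ[k] (cH.ι b)) * (x ᵍ⊗ₜ[k] (cH.ι c) : grA ᵍ⊗[k] grH) =
        ((1 : ΩA) ᵍ⊗ₜ[k] (cH.ι (b * c))) * (x ᵍ⊗ₜ[k] (1 : ΩH)) := by
      rw [tmul_zero_mul_tmul _ (cH.ι_mem b), tmul_zero_mul_tmul _ (cH.ι_mem _), map_mul, mul_one]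
    rw [Algebra.TensorProduct.tmul_mul_tmul, LinearMap.rTensor_tmul, LinearMap.rTensor_tmul,
      actBalTensor_tmul, actBalTensor_tmul, e, mul_one]

/-- The map `s ⊗ h ↦ τ(S⁻¹(h)_1) S⁻¹(h)_2 s`. -/
def translationMulTensor (cH : DiffCalculus H grH) : (grA ᵍ⊗[k] grH) ⊗[k] H →ₗ[k]
    Bal ρ.coinvariants A (grA ᵍ⊗[k] grH) :=
  TensorProduct.lift ((actBalTensor grA cH).compl₂ ((ρ.translation hρ).rTensor H ∘ₗ
    Coalgebra.comul ∘ₗ antipodeInv hS))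

theorem translationMulTensor_tmul (s : grA ᵍ⊗[k] grH) (h : H) :
    translationMulTensor hρ hS cH (s ⊗ₜ h) = actBalTensor grA cH s
      ((ρ.translation hρ).rTensor H (Coalgebra.comul (antipodeInv hS h))) := rfl

theorem lmap_coact_translationMul (t : ΩA ⊗[k] H) :
    Bal.lmap ρ.coinvariants A K.coact.toLinearMap (K.coact_coinvariant_smul hA hT)
      (translationMul hρ hS t) =
        translationMulTensor hρ hS cH (K.coact.toLinearMap.rTensor H t) := by
  induction t using TensorProduct.induction_on with
  | zero => simp
  | add s t hs ht => simp only [map_add, hs, ht]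
  | tmul x h =>
    rw [translationMul_tmul, K.lmap_coact_actBal hA hT, ρ.coactRight_translation]
    rfl

include hA hT in
theorem translationMulTensor_formsAssoc (t : ΩA ⊗[k] H) :
    translationMulTensor hρ hS cH (formsAssoc grA cH
      ((Coalgebra.comul (R := k) (A := H)).lTensor ΩA t)) =
        Bal.lmap ρ.coinvariants A (GradedTensorProduct.includeLeft grA grH).toLinearMap
          (includeLeft_coinvariant_smul hA hT) (translationMul hρ hS t) := by
  induction t using TensorProduct.induction_on with
  | zero => simp
  | add s t hs ht => simp only [map_add, hs, ht]
  | tmul x h =>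
    have h₁ : ∀ p : H ⊗[k] H, translationMulTensor hρ hS cH (formsAssoc grA cH (x ⊗ₜ p)) =
        actBalTensor grA cH (x ᵍ⊗ₜ[k] (1 : ΩH)) ((ρ.translation hρ).rTensor H
          (TensorProduct.lift ((LinearMap.mul k (H ⊗[k] H)).flip.compl₁₂
            (Algebra.TensorProduct.includeRight : H →ₐ[k] H ⊗[k] H).toLinearMap
            (Coalgebra.comul ∘ₗ antipodeInv hS)) p)) := by
      intro p
      induction p using TensorProduct.induction_on with
      | zero => simp
      | add s t hs ht => simp only [map_add, TensorProduct.tmul_add, hs, ht]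
      | tmul a b =>
        rw [formsAssoc_tmul, translationMulTensor_tmul, actBalTensor_translation]
        rfl
    rw [LinearMap.lTensor_tmul, h₁, comul_antipodeInv_mul, LinearMap.rTensor_tmul,
      actBalTensor_tmul, map_one, translationMul_tmul]
    change actBal _ ((1 : grA ᵍ⊗[k] grH) * _) _ = _
    rw [one_mul]
    refine LinearMap.congr_fun (f := actBal _ (x ᵍ⊗ₜ[k] (1 : ΩH)))
      (g := Bal.lmap ρ.coinvariants A (GradedTensorProduct.includeLeft grA grH).toLinearMap
          (includeLeft_coinvariant_smul hA hT) ∘ₗ actBal _ x) (Bal.hom_ext _ fun u v => ?_) _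
    change Bal.tmul _ u (v • (x ᵍ⊗ₜ[k] (1 : ΩH) : grA ᵍ⊗[k] grH)) =
      Bal.tmul _ u ((GradedTensorProduct.includeLeft grA grH) (v • x))
    rw [hT, hA, map_mul]
    rfl

variable (hflat : IsRightFaithfullyFlat ρ.coinvariants) [Small.{v} ΩA]
  [Small.{v} (grA ᵍ⊗[k] grH)]

include hA hT hflat in
-- By `ht`, applying the coaction to the second leg of τ(S⁻¹(t₁)) t₀ gives the same as · ⊗ 1. The
-- element is thus in the kernel of A ⊗_B (Δ - (· ⊗ 1)), and the kernel of Δ - (· ⊗ 1) is Ω(B), so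
-- flatness applies.
theorem translationMul_mem_span (t : ΩA ⊗[k] H)
    (ht : K.coact.toLinearMap.rTensor H t = formsAssoc grA cH
      ((Coalgebra.comul (R := k) (A := H)).lTensor ΩA t)) :
    translationMul hρ hS t ∈ Submodule.span k {z | ∃ (a : A) (b : K.base),
      z = Bal.tmul ρ.coinvariants a (b : ΩA)} := by
  have h₁ := hflat.mem_span_of_lmap_eq_zero
    (K.coact.toLinearMap - (GradedTensorProduct.includeLeft grA grH).toLinearMap)
    (fun b x => by
      rw [LinearMap.sub_apply, LinearMap.sub_apply, K.coact_coinvariant_smul hA hT,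
        includeLeft_coinvariant_smul hA hT, smul_sub]) (translationMul hρ hS t) (by
      have e : ∀ z, Bal.lmap ρ.coinvariants A
          (K.coact.toLinearMap - (GradedTensorProduct.includeLeft grA grH).toLinearMap)
          (fun b x => by
            rw [LinearMap.sub_apply, LinearMap.sub_apply, K.coact_coinvariant_smul hA hT,
              includeLeft_coinvariant_smul hA hT, smul_sub]) z =
          Bal.lmap ρ.coinvariants A K.coact.toLinearMap (K.coact_coinvariant_smul hA hT) z -
          Bal.lmap ρ.coinvariants A (GradedTensorProduct.includeLeft grA grH).toLinearMap
            (includeLeft_coinvariant_smul hA hT) z := by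
        intro z
        induction z using Bal.induction with
        | h0 => simp
        | ht x y =>
          rw [Bal.lmap_tmul, Bal.lmap_tmul, Bal.lmap_tmul, LinearMap.sub_apply]
          exact map_sub (Bal.mk ρ.coinvariants A (grA ᵍ⊗[k] grH) x) _ _
        | ha z z' hz hz' =>
          rw [map_add, map_add, map_add, hz, hz']
          abel
      rw [e, K.lmap_coact_translationMul hA hT, ht, translationMulTensor_formsAssoc hA hT, sub_self])
  refine Submodule.span_mono ?_ h₁
  rintro _ ⟨a, n, hn, rfl⟩
  exact ⟨a, ⟨n, sub_eq_zero.1 hn⟩, rfl⟩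

/-- In `E` the tensor is balanced over all base forms, so a ⊗ b = a b ⊗ 1 for b ∈ Ω(B). -/
theorem fromBal_eq_of_mem_span {z : Bal ρ.coinvariants A ΩA}
    (hz : z ∈ Submodule.span k {z | ∃ (a : A) (b : K.base),
      z = Bal.tmul ρ.coinvariants a (b : ΩA)}) :
    K.fromBal hA z = Bal.tmul K.base (mulForms ρ hA z) 1 := by
  induction hz using Submodule.span_induction with
  | mem z hz =>
    obtain ⟨a, b, rfl⟩ := hz
    rw [fromBal_tmul, mulForms_tmul]
    have := Bal.tmul_balanced K.base (cA.ι a) b (1 : ΩA)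
    rw [Subalgebra.smul_def, smul_eq_mul, mul_one] at this
    exact this.symm
  | zero => simp [Bal.zero_tmul]
  | add x y _ _ hx hy => rw [map_add, map_add, hx, hy, Bal.add_tmul]
  | smul c x _ hx => rw [map_smul, map_smul, hx, Bal.smul_tmul]

theorem mulForms_mem_span {z : Bal ρ.coinvariants A ΩA}
    (hz : z ∈ Submodule.span k {z | ∃ (a : A) (b : K.base),
      z = Bal.tmul ρ.coinvariants a (b : ΩA)}) :
    mulForms ρ hA z ∈ Submodule.span k {x | ∃ (a : A) (b : K.base), x = cA.ι a * b} := by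
  induction hz using Submodule.span_induction with
  | mem z hz =>
    obtain ⟨a, b, rfl⟩ := hz
    exact Submodule.subset_span ⟨a, b, rfl⟩
  | zero => simp
  | add x y _ _ hx hy => rw [map_add]; exact Submodule.add_mem _ hx hy
  | smul c x _ hx => rw [map_smul]; exact Submodule.smul_mem _ _ hx

end CompleteCalculus

end Horizontal

section AssocInjective

variable {k : Type*} [Field k] {Ω Ω' Ω'' : Type*} [Ring Ω] [Algebra k Ω] [Ring Ω'] [Algebra k Ω']
  [Ring Ω''] [Algebra k Ω'']
  {gr : ℕ → Submodule k Ω} [GradedAlgebra gr] {gr' : ℕ → Submodule k Ω'} [GradedAlgebra gr']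
  {gr'' : ℕ → Submodule k Ω''} [GradedAlgebra gr'']

theorem gradedAssocLin_injective : Function.Injective (gradedAssocLin gr gr' gr'') :=
  ((GradedTensorProduct.of k (tensorGr gr gr') gr'').symm ≪≫ₗ
    TensorProduct.congr (GradedTensorProduct.of k gr gr').symm (LinearEquiv.refl k Ω'') ≪≫ₗ
    TensorProduct.assoc k Ω Ω' Ω'' ≪≫ₗ
    TensorProduct.congr (LinearEquiv.refl k Ω) (GradedTensorProduct.of k gr' gr'') ≪≫ₗ
    GradedTensorProduct.of k gr (tensorGr gr' gr'')).injective

end AssocInjective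

/-! ### Horizontal forms are A·Ω(B), and base forms commute with τ(h). -/

section Central

universe v

variable {k : Type*} [Field k] {H : Type*} [Ring H] [HopfAlgebra k H]
  {A : Type v} [Ring A] [Algebra k A]
  {ΩH : Type*} [Ring ΩH] [Algebra k ΩH] {grH : ℕ → Submodule k ΩH} [GradedAlgebra grH]
  {ΩA : Type*} [Ring ΩA] [Algebra k ΩA] {grA : ℕ → Submodule k ΩA} [GradedAlgebra grA]
  {ρ : ComoduleAlgebra k H A} {cA : DiffCalculus A grA} {cH : DiffCalculus H grH}
  (K : CompleteCalculus ρ cA cH)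

namespace CompleteCalculus

theorem smul_tmul (x y z : ΩA) : x • Bal.tmul K.base y z = Bal.tmul K.base (x * y) z := rfl

theorem op_smul_tmul (x y z : ΩA) :
    MulOpposite.op x • Bal.tmul K.base y z = Bal.tmul K.base y (z * x) := rfl

theorem smul_op_smul (x y : ΩA) (z : K.E) :
    x • MulOpposite.op y • z = MulOpposite.op y • x • z :=
  LinearMap.congr_fun (f := Bal.leftMul K.base ΩA ΩA x ∘ₗ
      Bal.rightMul K.base ΩA ΩA (MulOpposite.op y))
    (g := Bal.rightMul K.base ΩA ΩA (MulOpposite.op y) ∘ₗ Bal.leftMul K.base ΩA ΩA x)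
    (Bal.hom_ext _ fun _ _ => rfl) z

variable (grA cH) in
/-- The inclusion `Ω(A) ⊗ H ⊆ Ω(A) ⊗ Ω(H)`. -/
def formsIncl : ΩA ⊗[k] H →ₗ[k] grA ᵍ⊗[k] grH :=
  (GradedTensorProduct.of k grA grH).toLinearMap ∘ₗ cH.ι.toLinearMap.lTensor ΩA

theorem formsIncl_tmul (x : ΩA) (h : H) :
    formsIncl grA cH (x ⊗ₜ h) = x ᵍ⊗ₜ[k] (cH.ι h) := rfl

theorem formsIncl_injective : Function.Injective (formsIncl grA cH) := by
  have h : Function.Injective (cH.ι.toLinearMap.lTensor ΩA) :=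
    Module.Flat.lTensor_preserves_injective_linearMap _ cH.ι_injective
  exact (GradedTensorProduct.of k grA grH).injective.comp h

/-- The map `t ⊗ h ↦ t ⊗ ι(h)`. -/
def formsIncl₃ : (grA ᵍ⊗[k] grH) ⊗[k] H →ₗ[k] grA ᵍ⊗[k] (tensorGr grH grH) :=
  gradedAssocLin grA grH grH ∘ₗ formsIncl (tensorGr grA grH) cH

theorem formsIncl₃_injective : Function.Injective (formsIncl₃ (grA := grA) (cH := cH)) :=
  gradedAssocLin_injective.comp formsIncl_injective

variable {ΔH : ΩH →ₐ[k] grH ᵍ⊗[k] grH} (hΔ : IsExtendedComul cH ΔH)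

include hΔ in
-- Coassociativity of the extended coaction, pulled back along the injection `formsIncl₃`, since for
-- horizontal m the last factor lies in H.
theorem horizontal_coassoc {m : ΩA} {t : ΩA ⊗[k] H} (ht : formsIncl grA cH t = K.coact m) :
    K.coact.toLinearMap.rTensor H t = formsAssoc grA cH
      ((Coalgebra.comul (R := k) (A := H)).lTensor ΩA t) := by
  refine formsIncl₃_injective (grA := grA) (cH := cH) ?_
  have h₁ : ∀ t, formsIncl₃ (cH := cH) (K.coact.toLinearMap.rTensor H t) =
      gradedAssoc grA grH grH (K.coactTensor (formsIncl grA cH t)) := by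
    intro t
    induction t using TensorProduct.induction_on with
    | zero => simp
    | add s t hs ht => simp only [map_add, hs, ht]
    | tmul x h => rfl
  have h₂ : ∀ t, formsIncl₃ (cH := cH) (formsAssoc grA cH
      ((Coalgebra.comul (R := k) (A := H)).lTensor ΩA t)) =
        tensorComul grA hΔ (formsIncl grA cH t) := by
    intro t
    induction t using TensorProduct.induction_on with
    | zero => simp
    | add s t hs ht => simp only [map_add, hs, ht]
    | tmul x h =>
      rw [formsIncl_tmul, tensorComul_tmul, hΔ.extends_comul, LinearMap.lTensor_tmul]
      generalize (Coalgebra.comul h : H ⊗[k] H) = p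
      induction p using TensorProduct.induction_on with
      | zero => simp [GradedTensorProduct.tmul]
      | add s t hs ht =>
        simp only [map_add, TensorProduct.tmul_add, hs, ht, GradedTensorProduct.tmul]
      | tmul a b => rfl
  rw [h₁, h₂, ht, K.coact_coassoc hΔ]

/-- The map `A ⊗_B A → Ω(A) ⊗_{Ω(B)} Ω(A)`. -/
def zeroBal : Bal ρ.coinvariants A A →ₗ[k] K.E :=
  Bal.lift _ ((Bal.mk K.base ΩA ΩA).compl₁₂ cA.ι.toLinearMap cA.ι.toLinearMap) (by
    intro a b x
    change Bal.tmul K.base (cA.ι (a * b)) (cA.ι x) = Bal.tmul K.base (cA.ι a) (cA.ι (b * x))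
    rw [map_mul, map_mul]
    exact Bal.tmul_balanced K.base (cA.ι a) ⟨_, K.ι_mem_base b⟩ (cA.ι x))

theorem zeroBal_tmul (a b : A) : K.zeroBal (Bal.tmul ρ.coinvariants a b) =
    Bal.tmul K.base (cA.ι a) (cA.ι b) := rfl

theorem zeroBal_smul (a : A) (z : Bal ρ.coinvariants A A) :
    K.zeroBal (a • z) = cA.ι a • K.zeroBal z :=
  LinearMap.congr_fun (f := K.zeroBal ∘ₗ Bal.leftMul ρ.coinvariants A A a)
    (g := Bal.leftMul K.base ΩA ΩA (cA.ι a) ∘ₗ K.zeroBal)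
    (Bal.hom_ext _ fun x y =>
      congrArg (fun t => Bal.tmul K.base t (cA.ι y)) (map_mul cA.ι a x)) z

theorem zeroBal_op_smul (a : A) (z : Bal ρ.coinvariants A A) :
    K.zeroBal (MulOpposite.op a • z) = MulOpposite.op (cA.ι a) • K.zeroBal z :=
  LinearMap.congr_fun (f := K.zeroBal ∘ₗ Bal.rightMul ρ.coinvariants A A (MulOpposite.op a))
    (g := Bal.rightMul K.base ΩA ΩA (MulOpposite.op (cA.ι a)) ∘ₗ K.zeroBal)
    (Bal.hom_ext _ fun x y =>
      congrArg (fun t => Bal.tmul K.base (cA.ι x) t) (map_mul cA.ι y a)) z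

theorem chi_zeroBal (z : Bal ρ.coinvariants A A) :
    K.chi (K.zeroBal z) = zeroForms cA cH (ρ.galoisMap z) :=
  LinearMap.congr_fun (f := K.chi ∘ₗ K.zeroBal) (g := (zeroForms cA cH).toLinearMap ∘ₗ ρ.galoisMap)
    (Bal.hom_ext _ fun x y => by
      change K.chi (Bal.tmul K.base (cA.ι x) (cA.ι y)) =
        zeroForms cA cH ((x ⊗ₜ[k] (1 : H)) * ρ.coact y)
      rw [chi_tmul, coact_ι, map_mul, zeroForms_tmul, map_one]) z

variable (hρ : Function.Bijective ρ.galoisMap)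

/-- The translation map of `B ⊆ A` with values in `Ω(A) ⊗_{Ω(B)} Ω(A)`. -/
def zeroTranslation : H →ₗ[k] K.E := K.zeroBal ∘ₗ ρ.translation hρ

theorem chi_zeroTranslation (h : H) :
    K.chi (K.zeroTranslation hρ h) = (1 : ΩA) ᵍ⊗ₜ[k] (cH.ι h) := by
  rw [zeroTranslation, LinearMap.comp_apply, chi_zeroBal, ρ.galoisMap_translation, zeroForms_tmul,
    map_one]

/-- The map `x ⊗ h ↦ x τ(h)` on `Ω(A) ⊗ H`. -/
def mulZeroTranslation : ΩA ⊗[k] H →ₗ[k] K.E :=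
  TensorProduct.lift (LinearMap.mk₂ k (fun (x : ΩA) (h : H) => x • K.zeroTranslation hρ h)
    (fun x y h => add_smul x y _)
    (fun c x h => LinearMap.congr_fun (Bal.leftMul_smul K.base c x) _)
    (fun x h h' => by rw [map_add, smul_add])
    (fun c x h => by rw [map_smul]; exact map_smul (Bal.leftMul K.base ΩA ΩA x) c _))

theorem mulZeroTranslation_tmul (x : ΩA) (h : H) :
    K.mulZeroTranslation hρ (x ⊗ₜ h) = x • K.zeroTranslation hρ h := rfl

theorem chi_mulZeroTranslation (t : ΩA ⊗[k] H) :
    K.chi (K.mulZeroTranslation hρ t) = formsIncl grA cH t := by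
  induction t using TensorProduct.induction_on with
  | zero => simp
  | add s t hs ht => simp only [map_add, hs, ht]
  | tmul x h =>
    rw [mulZeroTranslation_tmul, chi_smul, chi_zeroTranslation,
      GradedTensorProduct.tmul_one_mul_one_tmul]
    rfl

theorem zeroBal_mulTranslation (t : A ⊗[k] H) : K.zeroBal (ρ.mulTranslation hρ t) =
    K.mulZeroTranslation hρ (cA.ι.toLinearMap.rTensor H t) := by
  induction t using TensorProduct.induction_on with
  | zero => simp
  | add s t hs ht => simp only [map_add, hs, ht]
  | tmul a h => rw [ρ.mulTranslation_tmul, zeroBal_smul]; rfl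

theorem tmul_one_ι (a : A) : Bal.tmul K.base 1 (cA.ι a) =
    K.mulZeroTranslation hρ (cA.ι.toLinearMap.rTensor H (ρ.coact a)) := by
  rw [← zeroBal_mulTranslation, ρ.mulTranslation_coact, zeroBal_tmul, map_one]

variable [Module A ΩA] [IsScalarTower k A ΩA] (hA : ∀ (a : A) (x : ΩA), a • x = cA.ι a * x)
  [Module A (grA ᵍ⊗[k] grH)] [IsScalarTower k A (grA ᵍ⊗[k] grH)]
  (hT : ∀ (a : A) (t : grA ᵍ⊗[k] grH), a • t = ((cA.ι a) ᵍ⊗ₜ[k] (1 : ΩH)) * t)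

theorem fromBal_actBal_mul (x y : ΩA) (z : Bal ρ.coinvariants A A) :
    K.fromBal hA (actBal _ (x * y) z) = MulOpposite.op y • K.fromBal hA (actBal _ x z) :=
  LinearMap.congr_fun (f := K.fromBal hA ∘ₗ actBal _ (x * y))
    (g := Bal.rightMul K.base ΩA ΩA (MulOpposite.op y) ∘ₗ K.fromBal hA ∘ₗ actBal _ x)
    (Bal.hom_ext _ fun u v => by
      change Bal.tmul K.base (cA.ι u) (v • (x * y)) = Bal.tmul K.base (cA.ι u) ((v • x) * y)
      rw [hA, hA, mul_assoc]) z

theorem fromBal_actBal (x : ΩA) (z : Bal ρ.coinvariants A A) :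
    K.fromBal hA (actBal _ x z) = MulOpposite.op x • K.zeroBal z :=
  LinearMap.congr_fun (f := K.fromBal hA ∘ₗ actBal _ x)
    (g := Bal.rightMul K.base ΩA ΩA (MulOpposite.op x) ∘ₗ K.zeroBal)
    (Bal.hom_ext _ fun u v => congrArg (Bal.tmul K.base (cA.ι u)) (hA v x)) z

variable {ε : ΩH →ₐ[k] k} (hε : ∀ a, ε (cH.ι a) = Coalgebra.counit (R := k) a)
  (hε' : ∀ n, ∀ θ ∈ grH (n + 1), ε θ = 0)
  (hS : Function.Bijective (HopfAlgebra.antipode k : H →ₗ[k] H))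
  (hflat : IsRightFaithfullyFlat ρ.coinvariants) [Small.{v} ΩA]
  [Small.{v} (grA ᵍ⊗[k] grH)]

include hε hε' in
theorem mulForms_horizontal {m : ΩA} {t : ΩA ⊗[k] H} (ht : formsIncl grA cH t = K.coact m) :
    mulForms ρ hA (translationMul hρ hS t) = m := by
  have h : ∀ t, TensorProduct.rid k ΩA ((Coalgebra.counit (R := k) (A := H)).lTensor ΩA t) =
      tensorCounit grA hε' (formsIncl grA cH t) := by
    intro t
    induction t using TensorProduct.induction_on with
    | zero => simp
    | add s t hs ht => simp only [map_add, hs, ht]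
    | tmul x h =>
      rw [formsIncl_tmul, tensorCounit_tmul, hε]
      simp [Algebra.smul_def, Algebra.commutes]
  rw [mulForms_translationMul, h, ht, K.tensorCounit_coact hε]

include hΔ hε hε' hT hflat in
theorem fromBal_horizontal {m : ΩA} {t : ΩA ⊗[k] H} (ht : formsIncl grA cH t = K.coact m) :
    K.fromBal hA (translationMul hρ hS t) = Bal.tmul K.base m 1 := by
  rw [K.fromBal_eq_of_mem_span hA (K.translationMul_mem_span hA hT hρ hS hflat t
    (K.horizontal_coassoc hΔ ht)), K.mulForms_horizontal hρ hA hε hε' hS ht]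

include hΔ hε hε' hT hflat hA hρ hS in
theorem horizontal_mem_span {m : ΩA} {t : ΩA ⊗[k] H} (ht : formsIncl grA cH t = K.coact m) :
    m ∈ Submodule.span k {x | ∃ (a : A) (b : K.base), x = cA.ι a * b} := by
  have h := K.mulForms_mem_span hA (K.translationMul_mem_span hA hT hρ hS hflat t
    (K.horizontal_coassoc hΔ ht))
  rwa [K.mulForms_horizontal hρ hA hε hε' hS ht] at h

include hΔ hε hε' hT hflat hA hS in
-- For u ∈ A the form b u is horizontal, so b u ⊗ 1 = τ(S⁻¹(u₁)) b u₀ in `E`. With u ⊗ v = τ(h), b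
-- τ(h) becomes τ(S⁻¹(h⟨1⟩₁)) b h⟨1⟩₀ h⟨2⟩, and h⟨1⟩₀ h⟨2⟩ ⊗ h⟨1⟩₁ = 1 ⊗ S(h) turns this into τ(h)
-- b.
theorem base_smul_zeroTranslation (b : K.base) (h : H) :
    (b : ΩA) • K.zeroTranslation hρ h = MulOpposite.op (b : ΩA) • K.zeroTranslation hρ h := by
  have hb : K.coact (b : ΩA) = (b : ΩA) ᵍ⊗ₜ[k] (1 : ΩH) := b.2
  let f : A →ₗ[k] ΩA := LinearMap.mulLeft k (b : ΩA) ∘ₗ cA.ι.toLinearMap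
  let Θ : A ⊗[k] H →ₗ[k] K.E := K.fromBal hA ∘ₗ translationMul hρ hS ∘ₗ f.rTensor H
  -- Θ sends a ⊗ h to τ(S⁻¹(h)) b a, so left multiplication by b on A ⊗_B A factors through the
  -- left-handed Hopf–Galois map, whose value on τ(h) is known.
  have hΘ : ∀ z, (b : ΩA) • K.zeroBal z = Θ (ρ.leftGaloisMap z) := by
    intro z
    refine LinearMap.congr_fun (f := Bal.leftMul K.base ΩA ΩA (b : ΩA) ∘ₗ K.zeroBal)
      (g := Θ ∘ₗ ρ.leftGaloisMap) (Bal.hom_ext _ fun u v => ?_) z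
    change Bal.tmul K.base ((b : ΩA) * cA.ι u) (cA.ι v) = Θ (ρ.coact u * (v ⊗ₜ[k] (1 : H)))
    have h₁ : formsIncl grA cH (f.rTensor H (ρ.coact u)) = K.coact ((b : ΩA) * cA.ι u) := by
      rw [map_mul, coact_ι, hb]
      generalize ρ.coact u = t
      induction t using TensorProduct.induction_on with
      | zero => simp
      | add s t hs ht => simp only [map_add, mul_add, hs, ht]
      | tmul a h =>
        rw [zeroForms_tmul, tmul_one_mul_tmul]
        rfl
    have h₂ : ∀ t, Θ (t * (v ⊗ₜ[k] (1 : H))) = MulOpposite.op (cA.ι v) • Θ t := by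
      intro t
      induction t using TensorProduct.induction_on with
      | zero => simp
      | add s t hs ht => simp only [map_add, add_mul, smul_add, hs, ht]
      | tmul a h =>
        rw [Algebra.TensorProduct.tmul_mul_tmul, mul_one]
        change K.fromBal hA (actBal _ ((b : ΩA) * cA.ι (a * v))
          (ρ.translation hρ (antipodeInv hS h))) = _
        rw [map_mul cA.ι, ← mul_assoc, fromBal_actBal_mul]
        rfl
    rw [h₂]
    change _ = MulOpposite.op (cA.ι v) • K.fromBal hA (translationMul hρ hS
      (f.rTensor H (ρ.coact u)))
    rw [K.fromBal_horizontal hΔ hρ hA hT hε hε' hS hflat h₁, op_smul_tmul, one_mul]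
  change (b : ΩA) • K.zeroBal (ρ.translation hρ h) =
    MulOpposite.op (b : ΩA) • K.zeroBal (ρ.translation hρ h)
  rw [hΘ, ρ.leftGaloisMap_translation]
  change K.fromBal hA (actBal _ ((b : ΩA) * cA.ι 1) (ρ.translation hρ (antipodeInv hS
    (HopfAlgebra.antipode k h)))) = _
  rw [antipodeInv_antipode, map_one, mul_one, fromBal_actBal]

include hΔ hε hε' hT hflat hA hS in
-- A horizontal m is a sum of terms a b with b ∈ Ω(B); since 1 ⊗ a = a₀ τ(a₁) and b commutes with τ,
-- x ⊗ a b = x a₀ b τ(a₁).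
theorem tmul_horizontal_mem_range (x : ΩA) {m : ΩA} {t : ΩA ⊗[k] H}
    (ht : formsIncl grA cH t = K.coact m) :
    Bal.tmul K.base x m ∈ LinearMap.range (K.mulZeroTranslation hρ) := by
  have hm := K.horizontal_mem_span hΔ hρ hA hT hε hε' hS hflat ht
  clear ht
  induction hm using Submodule.span_induction with
  | mem m hm =>
    obtain ⟨a, b, rfl⟩ := hm
    have e : Bal.tmul K.base x (cA.ι a * b) =
        x • MulOpposite.op (b : ΩA) • Bal.tmul K.base 1 (cA.ι a) := by
      rw [op_smul_tmul, smul_tmul, mul_one]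
    rw [e, K.tmul_one_ι hρ]
    generalize ρ.coact a = s
    induction s using TensorProduct.induction_on with
    | zero => simp
    | add s t hs ht =>
      simp only [map_add, smul_add]
      exact Submodule.add_mem _ hs ht
    | tmul a h =>
      refine ⟨(x * (cA.ι a * b)) ⊗ₜ h, ?_⟩
      rw [mulZeroTranslation_tmul, mul_smul, mul_smul,
        K.base_smul_zeroTranslation hΔ hρ hA hT hε hε' hS hflat]
      exact congrArg (x • ·) (K.smul_op_smul _ _ _)
  | zero => simp [Bal.tmul_zero]
  | add x y _ _ hx hy => rw [Bal.tmul_add]; exact Submodule.add_mem _ hx hy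
  | smul c x _ hx => rw [Bal.tmul_smul]; exact Submodule.smul_mem _ _ hx

end CompleteCalculus

end Central

/-! ## Operators on `Ω(A) ⊗_{Ω(B)} Ω(A)` -/

section Operators

variable {k : Type*} [Field k] {H : Type*} [Ring H] [HopfAlgebra k H]
  {A : Type*} [Ring A] [Algebra k A]
  {ΩH : Type*} [Ring ΩH] [Algebra k ΩH] {grH : ℕ → Submodule k ΩH} [GradedAlgebra grH]
  {ΩA : Type*} [Ring ΩA] [Algebra k ΩA] {grA : ℕ → Submodule k ΩA} [GradedAlgebra grA]
  {ρ : ComoduleAlgebra k H A} {cA : DiffCalculus A grA} {cH : DiffCalculus H grH}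
  (K : CompleteCalculus ρ cA cH)

namespace CompleteCalculus

theorem dE_tmul (x y : ΩA) : K.dE (Bal.tmul K.base x y) =
    Bal.tmul K.base (cA.d x) y + Bal.tmul K.base (parity grA x) (cA.d y) := rfl

theorem dE_smul (x : ΩA) (z : K.E) : K.dE (x • z) = cA.d x • z + parity grA x • K.dE z :=
  LinearMap.congr_fun (f := K.dE ∘ₗ Bal.leftMul K.base ΩA ΩA x)
    (g := Bal.leftMul K.base ΩA ΩA (cA.d x) + Bal.leftMul K.base ΩA ΩA (parity grA x) ∘ₗ K.dE)
    (Bal.hom_ext _ fun y y' => by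
      change K.dE (Bal.tmul K.base (x * y) y') = Bal.tmul K.base (cA.d x * y) y' +
        parity grA x • (Bal.tmul K.base (cA.d y) y' + Bal.tmul K.base (parity grA y) (cA.d y'))
      rw [dE_tmul, cA.leibniz_parity, parity_mul, smul_add, Bal.add_tmul, smul_tmul, smul_tmul,
        add_assoc]) z

/-- The sign operator `z ↦ (-1)^|z| z` of `Ω(A) ⊗_{Ω(B)} Ω(A)`. -/
def parityE : K.E →ₗ[k] K.E :=
  Bal.lift K.base ((Bal.mk K.base ΩA ΩA).compl₁₂ (parity grA) (parity grA)) (by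
    intro x b y
    change Bal.tmul K.base (parity grA (x * b)) (parity grA y) =
      Bal.tmul K.base (parity grA x) (parity grA (b * y))
    rw [parity_mul, parity_mul]
    exact Bal.tmul_balanced K.base (parity grA x) ⟨_, K.parity_mem_base b⟩ (parity grA y))

theorem parityE_tmul (x y : ΩA) : K.parityE (Bal.tmul K.base x y) =
    Bal.tmul K.base (parity grA x) (parity grA y) := rfl

theorem parityE_smul (x : ΩA) (z : K.E) : K.parityE (x • z) = parity grA x • K.parityE z :=
  LinearMap.congr_fun (f := K.parityE ∘ₗ Bal.leftMul K.base ΩA ΩA x)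
    (g := Bal.leftMul K.base ΩA ΩA (parity grA x) ∘ₗ K.parityE)
    (Bal.hom_ext _ fun y y' =>
      congrArg (fun t => Bal.tmul K.base t (parity grA y')) (parity_mul grA x y)) z

theorem parityE_op_smul (x : ΩA) (z : K.E) :
    K.parityE (MulOpposite.op x • z) = MulOpposite.op (parity grA x) • K.parityE z :=
  LinearMap.congr_fun (f := K.parityE ∘ₗ Bal.rightMul K.base ΩA ΩA (MulOpposite.op x))
    (g := Bal.rightMul K.base ΩA ΩA (MulOpposite.op (parity grA x)) ∘ₗ K.parityE)
    (Bal.hom_ext _ fun y y' =>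
      congrArg (fun t => Bal.tmul K.base (parity grA y) t) (parity_mul grA y' x)) z

theorem dE_op_smul (x : ΩA) (z : K.E) : K.dE (MulOpposite.op x • z) =
    MulOpposite.op x • K.dE z + MulOpposite.op (cA.d x) • K.parityE z :=
  LinearMap.congr_fun (f := K.dE ∘ₗ Bal.rightMul K.base ΩA ΩA (MulOpposite.op x))
    (g := Bal.rightMul K.base ΩA ΩA (MulOpposite.op x) ∘ₗ K.dE +
      Bal.rightMul K.base ΩA ΩA (MulOpposite.op (cA.d x)) ∘ₗ K.parityE)
    (Bal.hom_ext _ fun y y' => by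
      change K.dE (Bal.tmul K.base y (y' * x)) =
        MulOpposite.op x • (Bal.tmul K.base (cA.d y) y' +
          Bal.tmul K.base (parity grA y) (cA.d y')) +
        Bal.tmul K.base (parity grA y) (parity grA y' * cA.d x)
      rw [dE_tmul, cA.leibniz_parity, Bal.tmul_add, smul_add, op_smul_tmul, op_smul_tmul,
        add_assoc]) z

theorem dE_dE (z : K.E) : K.dE (K.dE z) = 0 :=
  LinearMap.congr_fun (f := K.dE ∘ₗ K.dE) (g := 0) (Bal.hom_ext _ fun x y => by
    change K.dE (K.dE (Bal.tmul K.base x y)) = 0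
    rw [dE_tmul, map_add, dE_tmul, dE_tmul, cA.d_d, cA.d_d, cA.d_parity, Bal.zero_tmul,
      Bal.tmul_zero, zero_add, add_zero, ← Bal.add_tmul, add_neg_cancel, Bal.zero_tmul]) z

theorem dE_one : K.dE (Bal.tmul K.base 1 1) = 0 := by
  rw [dE_tmul, cA.d_one, Bal.zero_tmul, Bal.tmul_zero, zero_add]

theorem chi_dE (z : K.E) : K.chi (K.dE z) = (tensorDGA cA cH).d (K.chi z) :=
  LinearMap.congr_fun (f := K.chi ∘ₗ K.dE) (g := (tensorDGA cA cH).d ∘ₗ K.chi)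
    (Bal.hom_ext _ fun x y => by
      change K.chi (K.dE (Bal.tmul K.base x y)) = (tensorDGA cA cH).d (K.chi (Bal.tmul K.base x y))
      rw [dE_tmul, map_add, chi_tmul, chi_tmul, chi_tmul, coact_d, tensorDGA_leibniz,
        tensorDGA_d_tmul, cH.d_one, parity_tensor, gradedMap_tmul, parity_one]
      simp [GradedTensorProduct.tmul]) z

theorem parityE_zeroBal (z : Bal ρ.coinvariants A A) : K.parityE (K.zeroBal z) = K.zeroBal z :=
  LinearMap.congr_fun (f := K.parityE ∘ₗ K.zeroBal) (g := K.zeroBal)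
    (Bal.hom_ext _ fun x y => by
      change K.parityE (Bal.tmul K.base (cA.ι x) (cA.ι y)) = Bal.tmul K.base (cA.ι x) (cA.ι y)
      rw [parityE_tmul, cA.parity_ι, cA.parity_ι]) z

variable (hρ : Function.Bijective ρ.galoisMap)

theorem zeroTranslation_one : K.zeroTranslation hρ 1 = Bal.tmul K.base 1 1 := by
  have h : ρ.translation hρ 1 = Bal.tmul ρ.coinvariants 1 1 := hρ.1 (by
    rw [ρ.galoisMap_translation, ρ.galoisMap_tmul, map_one, mul_one])
  rw [zeroTranslation, LinearMap.comp_apply, h, zeroBal_tmul, map_one]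

variable (hcen : ∀ (b : K.base) (h : H),
  (b : ΩA) • K.zeroTranslation hρ h = MulOpposite.op (b : ΩA) • K.zeroTranslation hρ h)

/-- The map `x ⊗ y ↦ x τ(h) y`. -/
def insertE (h : H) : K.E →ₗ[k] K.E :=
  Bal.lift _ (LinearMap.mk₂ k (fun x y => MulOpposite.op y • x • K.zeroTranslation hρ h)
    (fun x x' y => by rw [add_smul, smul_add])
    (fun c x y => by
      have e := LinearMap.congr_fun (Bal.leftMul_smul (X := ΩA) (Y := ΩA) K.base c x)
        (K.zeroTranslation hρ h)
      change MulOpposite.op y • (Bal.leftMul K.base ΩA ΩA (c • x) _) = _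
      rw [e]
      exact map_smul (Bal.rightMul K.base ΩA ΩA (MulOpposite.op y)) c _)
    (fun x y y' => by rw [MulOpposite.op_add, add_smul])
    (fun c x y => LinearMap.congr_fun
      (Bal.rightMul_smul (X := ΩA) (Y := ΩA) K.base c (MulOpposite.op y)) _))
    (by
      intro x b y
      change MulOpposite.op y • (x * (b : ΩA)) • K.zeroTranslation hρ h =
        MulOpposite.op ((b : ΩA) * y) • x • K.zeroTranslation hρ h
      -- Balancedness over Ω(B) is exactly the commutation of base forms with τ(h).
      rw [mul_smul, hcen, smul_op_smul, smul_smul, ← MulOpposite.op_mul])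

theorem insertE_tmul (h : H) (x y : ΩA) : K.insertE hρ hcen h (Bal.tmul K.base x y) =
    MulOpposite.op y • x • K.zeroTranslation hρ h := rfl

theorem insertE_smul (h : H) (x : ΩA) (z : K.E) :
    K.insertE hρ hcen h (x • z) = x • K.insertE hρ hcen h z :=
  LinearMap.congr_fun (f := K.insertE hρ hcen h ∘ₗ Bal.leftMul K.base ΩA ΩA x)
    (g := Bal.leftMul K.base ΩA ΩA x ∘ₗ K.insertE hρ hcen h)
    (Bal.hom_ext _ fun y y' => by
      change MulOpposite.op y' • (x * y) • K.zeroTranslation hρ h =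
        x • MulOpposite.op y' • y • K.zeroTranslation hρ h
      rw [mul_smul, smul_op_smul]) z

theorem insertE_op_smul (h : H) (x : ΩA) (z : K.E) :
    K.insertE hρ hcen h (MulOpposite.op x • z) = MulOpposite.op x • K.insertE hρ hcen h z :=
  LinearMap.congr_fun
    (f := K.insertE hρ hcen h ∘ₗ Bal.rightMul K.base ΩA ΩA (MulOpposite.op x))
    (g := Bal.rightMul K.base ΩA ΩA (MulOpposite.op x) ∘ₗ K.insertE hρ hcen h)
    (Bal.hom_ext _ fun y y' => by
      change MulOpposite.op (y' * x) • y • K.zeroTranslation hρ h =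
        MulOpposite.op x • MulOpposite.op y' • y • K.zeroTranslation hρ h
      rw [smul_smul (MulOpposite.op x), ← MulOpposite.op_mul]) z

theorem insertE_one_tmul_one (h : H) :
    K.insertE hρ hcen h (Bal.tmul K.base 1 1) = K.zeroTranslation hρ h := by
  rw [insertE_tmul, one_smul, MulOpposite.op_one, one_smul]

theorem insertE_zeroBal (h : H) (z : Bal ρ.coinvariants A A) :
    K.insertE hρ hcen h (K.zeroBal z) = K.zeroBal (ρ.insertTranslation hρ h z) :=
  LinearMap.congr_fun (f := K.insertE hρ hcen h ∘ₗ K.zeroBal)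
    (g := K.zeroBal ∘ₗ ρ.insertTranslation hρ h) (Bal.hom_ext _ fun x y => by
      change MulOpposite.op (cA.ι y) • cA.ι x • K.zeroBal (ρ.translation hρ h) =
        K.zeroBal (MulOpposite.op y • x • ρ.translation hρ h)
      rw [zeroBal_op_smul, zeroBal_smul]) z

theorem parityE_insertE (h : H) (z : K.E) :
    K.parityE (K.insertE hρ hcen h z) = K.insertE hρ hcen h (K.parityE z) :=
  LinearMap.congr_fun (f := K.parityE ∘ₗ K.insertE hρ hcen h)
    (g := K.insertE hρ hcen h ∘ₗ K.parityE) (Bal.hom_ext _ fun x y => by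
      change K.parityE (MulOpposite.op y • x • K.zeroTranslation hρ h) =
        MulOpposite.op (parity grA y) • parity grA x • K.zeroTranslation hρ h
      rw [parityE_op_smul, parityE_smul]
      congr 2
      exact K.parityE_zeroBal _) z

theorem chi_op_smul' (x : ΩA) (z : K.E) :
    K.chi (MulOpposite.op x • z) = K.chi z * K.coact x :=
  LinearMap.congr_fun (f := K.chi ∘ₗ Bal.rightMul K.base ΩA ΩA (MulOpposite.op x))
    (g := LinearMap.mulRight k (K.coact x) ∘ₗ K.chi)
    (Bal.hom_ext K.base fun y y' => by
      change K.chi (Bal.tmul K.base y (y' * x)) = K.chi (Bal.tmul K.base y y') * K.coact x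
      rw [chi_tmul, chi_tmul, map_mul, mul_assoc]) z

theorem chi_insertE (h : H) (z : K.E) : K.chi (K.insertE hρ hcen h z) =
    ((1 : ΩA) ᵍ⊗ₜ[k] (cH.ι h)) * K.chi z :=
  LinearMap.congr_fun (f := K.chi ∘ₗ K.insertE hρ hcen h)
    (g := LinearMap.mulLeft k ((1 : ΩA) ᵍ⊗ₜ[k] (cH.ι h)) ∘ₗ K.chi)
    (Bal.hom_ext K.base fun x y => by
      change K.chi (MulOpposite.op y • x • K.zeroTranslation hρ h) =
        ((1 : ΩA) ᵍ⊗ₜ[k] (cH.ι h)) * K.chi (Bal.tmul K.base x y)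
      rw [chi_op_smul', chi_smul, chi_zeroTranslation, chi_tmul, ← mul_assoc,
        tmul_zero_mul_tmul _ (cH.ι_mem h), GradedTensorProduct.tmul_one_mul_one_tmul, one_mul,
        mul_one]) z

/-- The algebra morphism `h ↦ (x ⊗ y ↦ x τ(h) y)`. -/
def insertHom : H →ₐ[k] Module.End k K.E :=
  AlgHom.ofLinearMap
    { toFun := K.insertE hρ hcen
      map_add' := fun h h' => Bal.hom_ext _ fun x y => by
        change MulOpposite.op y • x • K.zeroTranslation hρ (h + h') =
          MulOpposite.op y • x • K.zeroTranslation hρ h +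
          MulOpposite.op y • x • K.zeroTranslation hρ h'
        rw [map_add, smul_add, smul_add]
      map_smul' := fun c h => Bal.hom_ext _ fun x y => by
        change MulOpposite.op y • x • K.zeroTranslation hρ (c • h) =
          c • MulOpposite.op y • x • K.zeroTranslation hρ h
        rw [map_smul]
        exact (congrArg (MulOpposite.op y • ·)
          (map_smul (Bal.leftMul K.base ΩA ΩA x) c (K.zeroTranslation hρ h))).trans
            (map_smul (Bal.rightMul K.base ΩA ΩA (MulOpposite.op y)) c _) }
    (Bal.hom_ext _ fun x y => by
      change MulOpposite.op y • x • K.zeroTranslation hρ 1 = Bal.tmul K.base x y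
      rw [zeroTranslation_one, smul_tmul, op_smul_tmul, mul_one, one_mul])
    (fun g h => Bal.hom_ext _ fun x y => by
      change MulOpposite.op y • x • K.zeroTranslation hρ (g * h) =
        K.insertE hρ hcen g (MulOpposite.op y • x • K.zeroBal (ρ.translation hρ h))
      rw [insertE_op_smul, insertE_smul, insertE_zeroBal, ρ.insertTranslation_translation]
      rfl)

theorem insertHom_apply (h : H) (z : K.E) :
    K.insertHom hρ hcen h z = K.insertE hρ hcen h z := rfl

/-- The commutator of the differential with `x ⊗ y ↦ x τ(h) y`. -/
def insertD : H →ₗ[k] Module.End k K.E :=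
  (LinearMap.mulLeft k (K.dE : Module.End k K.E) - LinearMap.mulRight k K.dE) ∘ₗ
    (K.insertHom hρ hcen).toLinearMap

theorem insertD_apply (h : H) (z : K.E) : K.insertD hρ hcen h z =
    K.dE (K.insertE hρ hcen h z) - K.insertE hρ hcen h (K.dE z) := rfl

theorem insertD_eq (h : H) : K.insertD hρ hcen h =
    (K.dE : Module.End k K.E) * K.insertHom hρ hcen h -
      K.insertHom hρ hcen h * (K.dE : Module.End k K.E) := rfl

theorem insertD_mul (g h : H) : K.insertD hρ hcen (g * h) =
    K.insertD hρ hcen g * K.insertHom hρ hcen h +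
      K.insertHom hρ hcen g * K.insertD hρ hcen h := by
  rw [insertD_eq, insertD_eq, insertD_eq, map_mul]
  noncomm_ring

/-- In the commutator the dx terms cancel, because L_h is left linear. Only the Leibniz sign of x is
left, so [d, L_h] behaves as an operator of degree 1. -/
theorem insertD_smul (h : H) (x : ΩA) (z : K.E) :
    K.insertD hρ hcen h (x • z) = parity grA x • K.insertD hρ hcen h z := by
  rw [insertD_apply, insertD_apply, insertE_smul, dE_smul, dE_smul, map_add, insertE_smul,
    insertE_smul, smul_sub]
  abel

theorem insertD_op_smul (h : H) (x : ΩA) (z : K.E) :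
    K.insertD hρ hcen h (MulOpposite.op x • z) = MulOpposite.op x • K.insertD hρ hcen h z := by
  rw [insertD_apply, insertD_apply, insertE_op_smul, dE_op_smul, dE_op_smul, map_add,
    insertE_op_smul, insertE_op_smul, parityE_insertE, smul_sub]
  abel

theorem insertD_one_tmul_one (h : H) : K.insertD hρ hcen h (Bal.tmul K.base 1 1) =
    K.dE (K.zeroTranslation hρ h) := by
  rw [insertD_apply, dE_one, map_zero, sub_zero, insertE_one_tmul_one]

theorem chi_insertD (h : H) (z : K.E) : K.chi (K.insertD hρ hcen h z) =
    ((1 : ΩA) ᵍ⊗ₜ[k] (cH.d (cH.ι h))) * K.chi z := by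
  rw [insertD_apply, map_sub, chi_dE, chi_insertE, chi_insertE, chi_dE, tensorDGA_leibniz,
    tensorDGA_d_tmul, parity_tensor, gradedMap_tmul, cA.d_one, parity_one, cH.parity_ι]
  simp [GradedTensorProduct.tmul]

/-- If `∑ τ(a) dτ(b) = 0` whenever `∑ a db = 0`, then `∑ dτ(a) dτ(b) = 0` whenever
`∑ a db = 0`. -/
theorem mulMap_insertD {Γ : Type*} [AddCommGroup Γ] [Module k Γ] [Module H Γ] [Module Hᵐᵒᵖ Γ]
    [IsScalarTower k H Γ] [IsScalarTower k Hᵐᵒᵖ Γ] [SMulCommClass H Hᵐᵒᵖ Γ] {F : FODC k H Γ}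
    (w₁ : ∀ X, F.smulD X = 0 →
      mulMap (K.insertHom hρ hcen).toLinearMap (K.insertD hρ hcen) X = 0)
    (X : H ⊗[k] H) (hX : F.smulD X = 0) :
    mulMap (K.insertD hρ hcen) (K.insertD hρ hcen) X = 0 := by
  have hdd : (K.dE : Module.End k K.E) * (K.dE : Module.End k K.E) = 0 :=
    LinearMap.ext fun z => K.dE_dE z
  -- [d, L_a][d, L_b] = d (L_a [d, L_b]) + (L_a [d, L_b]) d, by d² = 0.
  have h : ∀ X, mulMap (K.insertD hρ hcen) (K.insertD hρ hcen) X =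
      (K.dE : Module.End k K.E) *
        mulMap (K.insertHom hρ hcen).toLinearMap (K.insertD hρ hcen) X +
      mulMap (K.insertHom hρ hcen).toLinearMap (K.insertD hρ hcen) X *
        (K.dE : Module.End k K.E) := by
    intro X
    induction X using TensorProduct.induction_on with
    | zero => simp
    | add x y hx hy =>
      rw [map_add, map_add, hx, hy]
      noncomm_ring
    | tmul a b =>
      simp only [mulMap_tmul, AlgHom.toLinearMap_apply, insertD_eq]
      generalize (K.insertHom hρ hcen) a = p
      generalize (K.insertHom hρ hcen) b = q
      generalize (K.dE : Module.End k K.E) = e at hdd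
      have h₁ : p * (e * q - q * e) * e = p * e * q * e := by
        rw [mul_assoc, sub_mul, mul_assoc q, hdd]
        noncomm_ring
      have h₂ : e * (p * (e * q - q * e)) + p * e * q * e =
          (e * p - p * e) * (e * q - q * e) + p * (e * e) * q := by noncomm_ring
      rw [h₁, h₂, hdd, mul_zero, zero_mul, add_zero]
  rw [h, w₁ X hX, mul_zero, zero_mul, add_zero]

end CompleteCalculus

end Operators

section VerticalBundle

variable {k : Type*} [Field k] {H : Type*} [Ring H] [HopfAlgebra k H]
  {A : Type*} [Ring A] [Algebra k A] (ρ : ComoduleAlgebra k H A)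

namespace ComoduleAlgebra

theorem coactRight_smul (a : A) (z : Bal ρ.coinvariants A A) : ρ.coactRight (a • z) =
    (Bal.leftMul ρ.coinvariants A A a).rTensor H (ρ.coactRight z) :=
  LinearMap.congr_fun (f := ρ.coactRight ∘ₗ Bal.leftMul ρ.coinvariants A A a)
    (g := (Bal.leftMul ρ.coinvariants A A a).rTensor H ∘ₗ ρ.coactRight)
    (Bal.hom_ext _ fun x y => by
      change (Bal.mk ρ.coinvariants A A (a * x)).rTensor H (ρ.coact y) =
        (Bal.leftMul ρ.coinvariants A A a).rTensor H
          ((Bal.mk ρ.coinvariants A A x).rTensor H (ρ.coact y))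
      rw [← LinearMap.rTensor_comp_apply]
      rfl) z

/-- The right action of `A` on `A ⊗_B A`, as a bilinear map. -/
def rightMulBal : A →ₗ[k] Bal ρ.coinvariants A A →ₗ[k] Bal ρ.coinvariants A A :=
  LinearMap.mk₂ k (fun a z => MulOpposite.op a • z)
    (fun a a' z => by rw [MulOpposite.op_add, add_smul])
    (fun c a z => LinearMap.congr_fun
      (Bal.rightMul_smul (X := A) (Y := A) ρ.coinvariants c (MulOpposite.op a)) z)
    (fun a z z' => smul_add _ z z')
    (fun c a z => map_smul (Bal.rightMul ρ.coinvariants A A (MulOpposite.op a)) c z)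

variable (hρ : Function.Bijective ρ.galoisMap)

/-- The map `h ⊗ (x ⊗ y) ↦ x τ(h) y`, as a bilinear map. -/
def insertTranslationLin : H →ₗ[k] Bal ρ.coinvariants A A →ₗ[k] Bal ρ.coinvariants A A where
  toFun := ρ.insertTranslation hρ
  map_add' h h' := Bal.hom_ext _ fun x y => by
    change MulOpposite.op y • x • ρ.translation hρ (h + h') =
      MulOpposite.op y • x • ρ.translation hρ h + MulOpposite.op y • x • ρ.translation hρ h'
    rw [map_add, smul_add, smul_add]
  map_smul' c h := Bal.hom_ext _ fun x y => by
    change MulOpposite.op y • x • ρ.translation hρ (c • h) =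
      c • MulOpposite.op y • x • ρ.translation hρ h
    rw [map_smul]
    exact (congrArg (MulOpposite.op y • ·)
      (map_smul (Bal.leftMul ρ.coinvariants A A x) c (ρ.translation hρ h))).trans
        (map_smul (Bal.rightMul ρ.coinvariants A A (MulOpposite.op y)) c _)

theorem map₂_rightMulBal (u : A) (t : A ⊗[k] H) (p : H ⊗[k] H) :
    TensorProduct.map₂ ρ.rightMulBal (TensorProduct.mk k H H).flip t
      ((Bal.leftMul ρ.coinvariants A A u ∘ₗ ρ.translation hρ).rTensor H p) =
    TensorProduct.map₂ (ρ.insertTranslationLin hρ) (TensorProduct.mk k H H) p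
      ((Bal.mk ρ.coinvariants A A u).rTensor H t) := by
  induction p using TensorProduct.induction_on with
  | zero => simp
  | add p q hp hq => simp only [map_add, LinearMap.add_apply, hp, hq]
  | tmul g g' =>
    induction t using TensorProduct.induction_on with
    | zero => simp
    | add s t hs ht => simp only [map_add, LinearMap.add_apply, hs, ht]
    | tmul v h => rfl

end ComoduleAlgebra

end VerticalBundle

/-! ## Forms with vanishing vertical part -/

section Vertical

universe v

variable {k : Type*} [Field k] {H : Type*} [Ring H] [HopfAlgebra k H]
  {A : Type v} [Ring A] [Algebra k A]
  {ΩH : Type*} [Ring ΩH] [Algebra k ΩH] {grH : ℕ → Submodule k ΩH} [GradedAlgebra grH]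
  {ΩA : Type*} [Ring ΩA] [Algebra k ΩA] {grA : ℕ → Submodule k ΩA} [GradedAlgebra grA]
  {ρ : ComoduleAlgebra k H A} {cA : DiffCalculus A grA} {cH : DiffCalculus H grH}
  (K : CompleteCalculus ρ cA cH)

namespace CompleteCalculus

variable (grA grH) in
/-- The projection of `Ω(A) ⊗ Ω(H)` onto the forms of positive degree on `H`. -/
def vertical : grA ᵍ⊗[k] grH →ₗ[k] grA ᵍ⊗[k] grH :=
  gradedMap LinearMap.id (LinearMap.id - GradedAlgebra.proj grH 0)

theorem vertical_tmul (x : ΩA) (θ : ΩH) : vertical grH grA (x ᵍ⊗ₜ[k] θ) =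
    x ᵍ⊗ₜ[k] (θ - GradedAlgebra.proj grH 0 θ) := rfl

theorem mul_vertical (x : ΩA) (t : grA ᵍ⊗[k] grH) :
    vertical grH grA ((x ᵍ⊗ₜ[k] (1 : ΩH)) * t) = (x ᵍ⊗ₜ[k] (1 : ΩH)) * vertical grH grA t := by
  refine LinearMap.congr_fun (f := vertical grH grA ∘ₗ LinearMap.mulLeft k (x ᵍ⊗ₜ[k] (1 : ΩH)))
    (g := LinearMap.mulLeft k (x ᵍ⊗ₜ[k] (1 : ΩH)) ∘ₗ vertical grH grA)
    (gradedTensor_ext fun i j y hy θ hθ => ?_) t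
  change vertical grH grA ((x ᵍ⊗ₜ[k] (1 : ΩH)) * (y ᵍ⊗ₜ[k] θ)) =
    (x ᵍ⊗ₜ[k] (1 : ΩH)) * vertical grH grA (y ᵍ⊗ₜ[k] θ)
  rw [tmul_one_mul_tmul, vertical_tmul, vertical_tmul, tmul_one_mul_tmul]

/-- What `vertical` removes is the part of degree 0 in Ω(H), which is the image of H; a form whose
coaction has no vertical part is therefore horizontal. -/
theorem exists_formsIncl_of_vertical_eq_zero {s : grA ᵍ⊗[k] grH}
    (hs : vertical grH grA s = 0) : ∃ t : ΩA ⊗[k] H, formsIncl grA cH t = s := by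
  have h : ∀ s, s - vertical grH grA s ∈ LinearMap.range (formsIncl grA cH) := by
    intro s
    obtain ⟨t, rfl⟩ := (GradedTensorProduct.of k grA grH).surjective s
    induction t using TensorProduct.induction_on with
    | zero => simp
    | add s t hs ht =>
      rw [map_add, map_add, add_sub_add_comm]
      exact Submodule.add_mem _ hs ht
    | tmul x θ =>
      have h0 : GradedAlgebra.proj grH 0 θ ∈ grH 0 := (DirectSum.decompose grH θ 0).2
      obtain ⟨a, ha⟩ := (cH.mem_zero_iff _).1 h0
      refine ⟨x ⊗ₜ a, ?_⟩
      change x ᵍ⊗ₜ[k] (cH.ι a) = (x ᵍ⊗ₜ[k] θ) - vertical grH grA (x ᵍ⊗ₜ[k] θ)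
      rw [vertical_tmul, ha]
      simp [GradedTensorProduct.tmul, TensorProduct.tmul_sub]
  have := h s
  rwa [hs, sub_zero] at this

variable (grA cH) in
/-- The map `(a ⊗ h) ⊗ (a' ⊗ h') ↦ ι(a a') ⊗ h dh'`. -/
def verticalForms : A ⊗[k] H →ₗ[k] A ⊗[k] H →ₗ[k] grA ᵍ⊗[k] grH :=
  (TensorProduct.map₂ ((LinearMap.mul k A).compr₂ cA.ι.toLinearMap)
    ((LinearMap.mul k ΩH).compl₁₂ cH.ι.toLinearMap (cH.d ∘ₗ cH.ι.toLinearMap))).compr₂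
      (GradedTensorProduct.of k grA grH).toLinearMap

theorem verticalForms_tmul (a a' : A) (h h' : H) :
    verticalForms grA (cA := cA) cH (a ⊗ₜ h) (a' ⊗ₜ h') =
      (cA.ι (a * a')) ᵍ⊗ₜ[k] (cH.ι h * cH.d (cH.ι h')) := rfl

theorem vertical_zeroForms_mul_d (s t : A ⊗[k] H) :
    vertical grH grA (zeroForms cA cH s * (tensorDGA cA cH).d (zeroForms cA cH t)) =
      verticalForms grA (cA := cA) cH s t := by
  induction s using TensorProduct.induction_on with
  | zero => simp
  | add x y hx hy => simp only [map_add, add_mul, LinearMap.add_apply, hx, hy]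
  | tmul a h =>
    induction t using TensorProduct.induction_on with
    | zero => simp
    | add x y hx hy => simp only [map_add, mul_add, hx, hy]
    | tmul a' h' =>
      have hm : cH.ι h * cH.d (cH.ι h') ∈ grH 1 := by
        simpa using SetLike.GradedMul.mul_mem (cH.ι_mem h) (cH.d_ι_mem h')
      have hm' : cH.ι h * cH.ι h' ∈ grH 0 := by
        simpa using SetLike.GradedMul.mul_mem (cH.ι_mem h) (cH.ι_mem h')
      rw [tensorDGA_d_zeroForms, zeroForms_tmul, mul_add, tmul_zero_mul_tmul _ (cH.ι_mem h),
        tmul_zero_mul_tmul _ (cH.ι_mem h), map_add, vertical_tmul, vertical_tmul,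
        verticalForms_tmul, proj_of_mem grH hm', proj_of_mem_ne grH (by decide) hm, map_mul, sub_zero]
      simp [GradedTensorProduct.tmul]

variable [Module A ΩA] [IsScalarTower k A ΩA] (hA : ∀ (a : A) (x : ΩA), a • x = cA.ι a * x)
  [Module A (grA ᵍ⊗[k] grH)] [IsScalarTower k A (grA ᵍ⊗[k] grH)]
  (hT : ∀ (a : A) (t : grA ᵍ⊗[k] grH), a • t = ((cA.ι a) ᵍ⊗ₜ[k] (1 : ΩH)) * t)

include hA hT in
theorem verticalCoact_smul (b : ρ.coinvariants) (x : ΩA) :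
    (vertical grH grA ∘ₗ K.coact.toLinearMap) (b • x) =
      b • (vertical grH grA ∘ₗ K.coact.toLinearMap) x := by
  rw [LinearMap.comp_apply, LinearMap.comp_apply, K.coact_coinvariant_smul hA hT,
    coinvariant_smul_tensor hT, coinvariant_smul_tensor hT, mul_vertical]

variable (grA cH) in
/-- The map `z ⊗ (h ⊗ h') ↦ z (1 ⊗ h dh')`. -/
def actVertical : Bal ρ.coinvariants A A ⊗[k] (H ⊗[k] H) →ₗ[k]
    Bal ρ.coinvariants A (grA ᵍ⊗[k] grH) :=
  TensorProduct.lift (actBal ρ.coinvariants ∘ₗ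
    (GradedTensorProduct.includeRight grA grH).toLinearMap ∘ₗ
      mulMap cH.ι.toLinearMap (cH.d ∘ₗ cH.ι.toLinearMap)).flip

theorem lmap_verticalCoact_actBal (v : A) (z : Bal ρ.coinvariants A A) :
    Bal.lmap ρ.coinvariants A (vertical grH grA ∘ₗ K.coact.toLinearMap)
      (K.verticalCoact_smul hA hT) (actBal _ (cA.d (cA.ι v)) z) =
    actVertical grA cH (TensorProduct.map₂ ρ.rightMulBal (TensorProduct.mk k H H).flip
      (ρ.coact v) (ρ.coactRight z)) := by
  refine LinearMap.congr_fun (f := Bal.lmap ρ.coinvariants A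
      (vertical grH grA ∘ₗ K.coact.toLinearMap) (K.verticalCoact_smul hA hT) ∘ₗ
        actBal _ (cA.d (cA.ι v)))
    (g := actVertical grA cH ∘ₗ TensorProduct.map₂ ρ.rightMulBal (TensorProduct.mk k H H).flip
      (ρ.coact v) ∘ₗ ρ.coactRight) (Bal.hom_ext _ fun p q => ?_) z
  change Bal.tmul _ p (vertical grH grA (K.coact (q • cA.d (cA.ι v)))) =
    actVertical grA cH (TensorProduct.map₂ ρ.rightMulBal (TensorProduct.mk k H H).flip
      (ρ.coact v) ((Bal.mk ρ.coinvariants A A p).rTensor H (ρ.coact q)))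
  rw [hA, map_mul, coact_d, coact_ι, coact_ι, vertical_zeroForms_mul_d]
  generalize ρ.coact q = s
  generalize ρ.coact v = t
  induction s using TensorProduct.induction_on with
  | zero => simp [Bal.tmul_zero]
  | add x y hx hy => simp only [map_add, LinearMap.add_apply, Bal.tmul_add, hx, hy]
  | tmul a h =>
    induction t using TensorProduct.induction_on with
    | zero => simp [Bal.tmul_zero]
    | add x y hx hy => simp only [map_add, LinearMap.add_apply, Bal.tmul_add, hx, hy]
    | tmul a' h' =>
      rw [verticalForms_tmul, LinearMap.rTensor_tmul, TensorProduct.map₂_apply_tmul]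
      change _ = actBal ρ.coinvariants ((1 : ΩA) ᵍ⊗ₜ[k] (cH.ι h * cH.d (cH.ι h')))
        (Bal.tmul ρ.coinvariants p (a * a'))
      rw [actBal_tmul, hT, tmul_one_mul_tmul, mul_one]

variable (hρ : Function.Bijective ρ.galoisMap)

/-- τ(h) v lies in A ⊗_B A, and every element there is a sum of y τ(g) with y ∈ A, by surjectivity
of the map inverse to the Hopf–Galois map. -/
theorem op_ι_smul_mem_range {z : K.E} (v : A)
    (hz : z ∈ LinearMap.range (K.mulZeroTranslation hρ)) :
    MulOpposite.op (cA.ι v) • z ∈ LinearMap.range (K.mulZeroTranslation hρ) := by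
  obtain ⟨t, rfl⟩ := hz
  induction t using TensorProduct.induction_on with
  | zero => simp
  | add s t hs ht =>
    rw [map_add, smul_add]
    exact Submodule.add_mem _ hs ht
  | tmul x h =>
    rw [mulZeroTranslation_tmul, ← smul_op_smul, zeroTranslation, LinearMap.comp_apply,
      ← zeroBal_op_smul]
    have e : MulOpposite.op v • ρ.translation hρ h = ρ.mulTranslation hρ
        (ρ.galoisMap (MulOpposite.op v • ρ.translation hρ h)) :=
      hρ.1 (ρ.galoisMap_mulTranslation hρ _).symm
    rw [e, zeroBal_mulTranslation]
    generalize cA.ι.toLinearMap.rTensor H (ρ.galoisMap (MulOpposite.op v • ρ.translation hρ h)) = t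
    induction t using TensorProduct.induction_on with
    | zero => simp
    | add s t hs ht =>
      rw [map_add, smul_add]
      exact Submodule.add_mem _ hs ht
    | tmul y g => exact ⟨(x * y) ⊗ₜ g, by rw [mulZeroTranslation_tmul, mulZeroTranslation_tmul,
        mul_smul]⟩

variable (hcen : ∀ (b : K.base) (h : H),
  (b : ΩA) • K.zeroTranslation hρ h = MulOpposite.op (b : ΩA) • K.zeroTranslation hρ h)

/-- For z = u ⊗ v, L_a d(u ⊗ v) = du τ(a) v + u τ(a) dv. The first term lies in the span of the x
τ(h), and the second is the image of Y = u τ(a) dv ∈ A ⊗_B Ω(A). -/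
theorem exists_insertE_dE_zeroBal (a : H) (z : Bal ρ.coinvariants A A) :
    ∃ Y : Bal ρ.coinvariants A ΩA,
      Bal.lmap ρ.coinvariants A (vertical grH grA ∘ₗ K.coact.toLinearMap)
        (K.verticalCoact_smul hA hT) Y = actVertical grA cH
          (TensorProduct.map₂ (ρ.insertTranslationLin hρ) (TensorProduct.mk k H H)
            (Coalgebra.comul a) (ρ.coactRight z)) ∧
      K.insertE hρ hcen a (K.dE (K.zeroBal z)) - K.fromBal hA Y ∈
        LinearMap.range (K.mulZeroTranslation hρ) := by
  induction z using Bal.induction with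
  | h0 => exact ⟨0, by simp, by simp⟩
  | ha z z' hz hz' =>
    obtain ⟨Y, hY, hY'⟩ := hz
    obtain ⟨Z, hZ, hZ'⟩ := hz'
    refine ⟨Y + Z, ?_, ?_⟩
    · simp only [map_add, hY, hZ]
    · simp only [map_add]
      rw [add_sub_add_comm]
      exact Submodule.add_mem _ hY' hZ'
  | ht u v =>
    refine ⟨actBal _ (cA.d (cA.ι v)) (u • ρ.translation hρ a), ?_, ?_⟩
    · rw [K.lmap_verticalCoact_actBal hA hT, ρ.coactRight_smul, ρ.coactRight_translation,
        ← LinearMap.rTensor_comp_apply, ρ.map₂_rightMulBal, ρ.coactRight_tmul]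
    · rw [zeroBal_tmul, dE_tmul, map_add, insertE_tmul, insertE_tmul, fromBal_actBal,
        zeroBal_smul, cA.parity_ι]
      change _ + MulOpposite.op (cA.d (cA.ι v)) • cA.ι u • K.zeroBal (ρ.translation hρ a) -
        MulOpposite.op (cA.d (cA.ι v)) • cA.ι u • K.zeroBal (ρ.translation hρ a) ∈ _
      rw [add_sub_cancel_right]
      exact K.op_ι_smul_mem_range hρ v ⟨cA.d (cA.ι u) ⊗ₜ a, rfl⟩

variable {Γ : Type*} [AddCommGroup Γ] [Module k Γ] [Module H Γ] [Module Hᵐᵒᵖ Γ]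
  [IsScalarTower k H Γ] [IsScalarTower k Hᵐᵒᵖ Γ] [SMulCommClass H Hᵐᵒᵖ Γ] {F : FODC k H Γ}

/-- With z = τ(b), the vertical part of Y is τ(a₁ b₁)(1 ⊗ a₂ db₂), a function of the left coaction
a₁ b₁ ⊗ a₂ db₂ of a db; hence it depends on ∑ a db only. -/
theorem actVertical_translation {j : Γ →ₗ[k] ΩH}
    (hj : ∀ a b, j (a • F.d b) = cH.ι a * cH.d (cH.ι b)) (p q : H ⊗[k] H) :
    actVertical grA cH (TensorProduct.map₂ (ρ.insertTranslationLin hρ) (TensorProduct.mk k H H) p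
        ((ρ.translation hρ).rTensor H q)) =
      TensorProduct.lift ((actBal ρ.coinvariants ∘ₗ
        (GradedTensorProduct.includeRight grA grH).toLinearMap ∘ₗ j).flip ∘ₗ ρ.translation hρ)
        (TensorProduct.map₂ (LinearMap.mul k H) (lact k H Γ) p (F.d.lTensor H q)) := by
  induction p using TensorProduct.induction_on with
  | zero => simp
  | add x y hx hy => simp only [map_add, LinearMap.add_apply, hx, hy]
  | tmul a a' =>
    induction q using TensorProduct.induction_on with
    | zero => simp
    | add x y hx hy => simp only [map_add, hx, hy]
    | tmul b b' =>
      rw [LinearMap.rTensor_tmul, LinearMap.lTensor_tmul, TensorProduct.map₂_apply_tmul,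
        TensorProduct.map₂_apply_tmul]
      change actBal ρ.coinvariants ((1 : ΩA) ᵍ⊗ₜ[k] (cH.ι a' * cH.d (cH.ι b')))
          (ρ.insertTranslation hρ a (ρ.translation hρ b)) =
        actBal ρ.coinvariants ((1 : ΩA) ᵍ⊗ₜ[k] (j (a' • F.d b'))) (ρ.translation hρ (a * b))
      rw [hj, ρ.insertTranslation_translation]

theorem exists_mulMap_insertD {j : Γ →ₗ[k] ΩH}
    (hj : ∀ a b, j (a • F.d b) = cH.ι a * cH.d (cH.ι b)) (R : BicovariantStructure F)
    (X : H ⊗[k] H) : ∃ Y : Bal ρ.coinvariants A ΩA,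
      Bal.lmap ρ.coinvariants A (vertical grH grA ∘ₗ K.coact.toLinearMap)
        (K.verticalCoact_smul hA hT) Y = TensorProduct.lift ((actBal ρ.coinvariants ∘ₗ
        (GradedTensorProduct.includeRight grA grH).toLinearMap ∘ₗ j).flip ∘ₗ ρ.translation hρ)
          (R.left (F.smulD X)) ∧
      mulMap (K.insertHom hρ hcen).toLinearMap (K.insertD hρ hcen) X (Bal.tmul K.base 1 1) -
        K.fromBal hA Y ∈ LinearMap.range (K.mulZeroTranslation hρ) := by
  induction X using TensorProduct.induction_on with
  | zero => exact ⟨0, by simp, by simp⟩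
  | add x y hx hy =>
    obtain ⟨Y, hY, hY'⟩ := hx
    obtain ⟨Z, hZ, hZ'⟩ := hy
    refine ⟨Y + Z, ?_, ?_⟩
    · simp only [map_add, hY, hZ]
    · rw [map_add, map_add, LinearMap.add_apply, add_sub_add_comm]
      exact Submodule.add_mem _ hY' hZ'
  | tmul a b =>
    obtain ⟨Y, hY, hY'⟩ := K.exists_insertE_dE_zeroBal hA hT hρ hcen a (ρ.translation hρ b)
    refine ⟨Y, ?_, ?_⟩
    · rw [hY, ρ.coactRight_translation, actVertical_translation hρ hj, FODC.smulD_tmul,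
        R.left_smul, R.left_d]
    · change K.insertE hρ hcen a (K.insertD hρ hcen b (Bal.tmul K.base 1 1)) - _ ∈ _
      rw [insertD_one_tmul_one]
      exact hY'

theorem chi_mulMap_insertD {j : Γ →ₗ[k] ΩH}
    (hj : ∀ a b, j (a • F.d b) = cH.ι a * cH.d (cH.ι b)) (X : H ⊗[k] H) :
    K.chi (mulMap (K.insertHom hρ hcen).toLinearMap (K.insertD hρ hcen) X
      (Bal.tmul K.base 1 1)) = (1 : ΩA) ᵍ⊗ₜ[k] (j (F.smulD X)) := by
  induction X using TensorProduct.induction_on with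
  | zero => simp [GradedTensorProduct.tmul]
  | add x y hx hy =>
    simp only [map_add, LinearMap.add_apply, hx, hy, GradedTensorProduct.tmul,
      TensorProduct.tmul_add]
  | tmul a b =>
    change K.chi (K.insertE hρ hcen a (K.insertD hρ hcen b (Bal.tmul K.base 1 1))) = _
    rw [chi_insertE, chi_insertD, chi_tmul, map_one]
    change _ * (_ * ((1 : grA ᵍ⊗[k] grH) * 1)) = _
    rw [mul_one, mul_one, FODC.smulD_tmul, hj, tmul_zero_mul_tmul _ (cH.ι_mem a), one_mul]

/-- The operator is right linear and left linear up to the sign of the form, so it is determined by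
its value on 1 ⊗ 1. -/
theorem mulMap_insertD_eq_zero {X : H ⊗[k] H}
    (hX : mulMap (K.insertHom hρ hcen).toLinearMap (K.insertD hρ hcen) X
      (Bal.tmul K.base 1 1) = 0) :
    mulMap (K.insertHom hρ hcen).toLinearMap (K.insertD hρ hcen) X = 0 := by
  have hs : ∀ (X : H ⊗[k] H) (x : ΩA) (z : K.E),
      mulMap (K.insertHom hρ hcen).toLinearMap (K.insertD hρ hcen) X (x • z) = parity grA x •
        mulMap (K.insertHom hρ hcen).toLinearMap (K.insertD hρ hcen) X z := by
    intro X x z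
    induction X using TensorProduct.induction_on with
    | zero => simp
    | add s t hs ht => rw [map_add, LinearMap.add_apply, LinearMap.add_apply, hs, ht, smul_add]
    | tmul a b =>
      change K.insertE hρ hcen a (K.insertD hρ hcen b (x • z)) =
        parity grA x • K.insertE hρ hcen a (K.insertD hρ hcen b z)
      rw [insertD_smul, insertE_smul]
  have ho : ∀ (X : H ⊗[k] H) (x : ΩA) (z : K.E),
      mulMap (K.insertHom hρ hcen).toLinearMap (K.insertD hρ hcen) X (MulOpposite.op x • z) =
        MulOpposite.op x • mulMap (K.insertHom hρ hcen).toLinearMap (K.insertD hρ hcen) X z := by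
    intro X x z
    induction X using TensorProduct.induction_on with
    | zero => simp
    | add s t hs ht => rw [map_add, LinearMap.add_apply, LinearMap.add_apply, hs, ht, smul_add]
    | tmul a b =>
      change K.insertE hρ hcen a (K.insertD hρ hcen b (MulOpposite.op x • z)) =
        MulOpposite.op x • K.insertE hρ hcen a (K.insertD hρ hcen b z)
      rw [insertD_op_smul, insertE_op_smul]
  refine Bal.hom_ext _ fun x y => ?_
  have e : Bal.tmul K.base x y = MulOpposite.op y • x • Bal.tmul K.base 1 1 := by
    rw [smul_tmul, op_smul_tmul, mul_one, one_mul]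
  rw [e, ho, hs, hX, smul_zero, smul_zero, LinearMap.zero_apply]

variable {ΔH : ΩH →ₐ[k] grH ᵍ⊗[k] grH} (hΔ : IsExtendedComul cH ΔH)
  {ε : ΩH →ₐ[k] k} (hε : ∀ a, ε (cH.ι a) = Coalgebra.counit (R := k) a)
  (hε' : ∀ n, ∀ θ ∈ grH (n + 1), ε θ = 0)
  (hS : Function.Bijective (HopfAlgebra.antipode k : H →ₗ[k] H))
  (hflat : IsRightFaithfullyFlat ρ.coinvariants) [Small.{v} ΩA]
  [Small.{v} (grA ᵍ⊗[k] grH)]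

include hA hT hΔ hε hε' hS hflat in
-- Two properties of w = ∑ L_a [d, L_b](1 ⊗ 1) are played against each other: w lies in the image of
-- Ω(A) ⊗ H under x ⊗ h ↦ x τ(h), on which χ is injective, and χ(w) = 1 ⊗ ∑ a db = 0.
theorem mulMap_insertHom_insertD {j : Γ →ₗ[k] ΩH}
    (hj : ∀ a b, j (a • F.d b) = cH.ι a * cH.d (cH.ι b)) (R : BicovariantStructure F)
    (X : H ⊗[k] H) (hX : F.smulD X = 0) :
    mulMap (K.insertHom hρ hcen).toLinearMap (K.insertD hρ hcen) X = 0 := by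
  obtain ⟨Y, hY, hY'⟩ := K.exists_mulMap_insertD hA hT hρ hcen hj R X
  rw [hX, map_zero, map_zero] at hY
  have hY₁ : K.fromBal hA Y ∈ LinearMap.range (K.mulZeroTranslation hρ) := by
    -- Vanishing of the vertical part of Y means, by flatness, that Y is a sum of a ⊗ n with n
    -- horizontal.
    have h := hflat.mem_span_of_lmap_eq_zero _ _ Y hY
    clear hY hY'
    induction h using Submodule.span_induction with
    | mem z hz =>
      obtain ⟨a, n, hn, rfl⟩ := hz
      obtain ⟨t, ht⟩ := exists_formsIncl_of_vertical_eq_zero (cH := cH) hn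
      exact K.tmul_horizontal_mem_range hΔ hρ hA hT hε hε' hS hflat _ ht
    | zero => simp
    | add x y _ _ hx hy => rw [map_add]; exact Submodule.add_mem _ hx hy
    | smul c x _ hx => rw [map_smul]; exact Submodule.smul_mem _ _ hx
  refine K.mulMap_insertD_eq_zero hρ hcen ?_
  have h₁ := Submodule.add_mem _ hY' hY₁
  rw [sub_add_cancel] at h₁
  obtain ⟨t, ht⟩ := h₁
  have h₂ := congrArg K.chi ht
  rw [K.chi_mulMap_insertD hρ hcen hj, hX, map_zero, chi_mulZeroTranslation] at h₂
  have h₃ : t = 0 := formsIncl_injective (grA := grA) (cH := cH) (by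
    rw [h₂, map_zero]
    simp [GradedTensorProduct.tmul])
  rw [← ht, h₃, map_zero]

end CompleteCalculus

end Vertical

/-! ## Bijectivity of the extended canonical map -/

section Bijectivity

variable {k : Type*} [Field k] {H : Type*} [Ring H] [HopfAlgebra k H]
  {A : Type*} [Ring A] [Algebra k A]
  {ΩH : Type*} [Ring ΩH] [Algebra k ΩH] {grH : ℕ → Submodule k ΩH} [GradedAlgebra grH]
  {ΩA : Type*} [Ring ΩA] [Algebra k ΩA] {grA : ℕ → Submodule k ΩA} [GradedAlgebra grA]
  {ρ : ComoduleAlgebra k H A} {cA : DiffCalculus A grA} {cH : DiffCalculus H grH}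
  (K : CompleteCalculus ρ cA cH)

namespace CompleteCalculus

variable (hρ : Function.Bijective ρ.galoisMap)
  (hcen : ∀ (b : K.base) (h : H),
    (b : ΩA) • K.zeroTranslation hρ h = MulOpposite.op (b : ΩA) • K.zeroTranslation hρ h)
  (L : ΩH →ₐ[k] Module.End k K.E) (hL : ∀ h, L (cH.ι h) = K.insertHom hρ hcen h)
  (hL' : ∀ h, L (cH.d (cH.ι h)) = K.insertD hρ hcen h)

include hL hL' in
theorem chi_insertForm (θ : ΩH) : ∀ z : K.E,
    K.chi (L θ z) = GradedTensorProduct.includeRight grA grH θ * K.chi z := by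
  induction θ using cH.induction with
  | hι h =>
    intro z
    rw [hL]
    exact K.chi_insertE hρ hcen h z
  | hd h =>
    intro z
    rw [hL']
    exact K.chi_insertD hρ hcen h z
  | hadd x y hx hy =>
    intro z
    rw [map_add, map_add, LinearMap.add_apply, map_add, hx, hy, add_mul]
  | hmul m n x _ y _ hx hy =>
    intro z
    rw [map_mul, map_mul, Module.End.mul_apply, hx, hy, mul_assoc]

include hL hL' in
theorem insertForm_op_smul (θ : ΩH) : ∀ (x : ΩA) (z : K.E),
    L θ (MulOpposite.op x • z) = MulOpposite.op x • L θ z := by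
  induction θ using cH.induction with
  | hι h =>
    intro x z
    rw [hL]
    exact K.insertE_op_smul hρ hcen h x z
  | hd h =>
    intro x z
    rw [hL']
    exact K.insertD_op_smul hρ hcen h x z
  | hadd θ η hθ hη =>
    intro x z
    rw [map_add, LinearMap.add_apply, LinearMap.add_apply, hθ, hη, smul_add]
  | hmul m n θ _ η _ hθ hη =>
    intro x z
    rw [map_mul, Module.End.mul_apply, Module.End.mul_apply, hη, hθ]

include hL hL' in
theorem insertForm_smul_zero (θ : ΩH) : ∀ {x : ΩA} (_ : x ∈ grA 0) (z : K.E),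
    L θ (x • z) = x • L θ z := by
  induction θ using cH.induction with
  | hι h =>
    intro x _ z
    rw [hL]
    exact K.insertE_smul hρ hcen h x z
  | hd h =>
    intro x hx z
    rw [hL', insertD_smul, parity_of_mem grA hx, pow_zero, one_smul]
  | hadd θ η hθ hη =>
    intro x hx z
    rw [map_add, LinearMap.add_apply, LinearMap.add_apply, hθ hx, hη hx, smul_add]
  | hmul m n θ _ η _ hθ hη =>
    intro x hx z
    rw [map_mul, Module.End.mul_apply, Module.End.mul_apply, hη hx, hθ hx]

include hL hL' in
-- Degrees 0 and 1 suffice: the coactions of a and da involve no Ω(A)-factor of higher degree, and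
-- these elements generate Ω(A).
theorem insertForm_smul_one (θ : ΩH) : ∀ {x : ΩA} (_ : x ∈ grA 1) (z : K.E),
    L θ (x • z) = x • L (parity grH θ) z := by
  induction θ using cH.induction with
  | hι h =>
    intro x _ z
    rw [cH.parity_ι, hL]
    exact K.insertE_smul hρ hcen h x z
  | hd h =>
    intro x hx z
    rw [parity_of_mem grH (cH.d_ι_mem h), pow_one, neg_one_smul, map_neg, hL', insertD_smul,
      parity_of_mem grA hx, pow_one, neg_one_smul, neg_smul, LinearMap.neg_apply, smul_neg]
  | hadd θ η hθ hη =>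
    intro x hx z
    rw [map_add, map_add, map_add, LinearMap.add_apply, LinearMap.add_apply, hθ hx, hη hx,
      smul_add]
  | hmul m n θ _ η _ hθ hη =>
    intro x hx z
    rw [parity_mul, map_mul, map_mul, Module.End.mul_apply, Module.End.mul_apply, hη hx, hθ hx]

/-- The map `x ⊗ θ ↦ x L_θ(1 ⊗ 1)`, the inverse of the extended canonical map. -/
def insertInv : grA ᵍ⊗[k] grH →ₗ[k] K.E :=
  TensorProduct.lift (LinearMap.mk₂ k
    (fun (x : ΩA) (θ : ΩH) => x • L θ (Bal.tmul K.base 1 1))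
    (fun x y θ => add_smul x y _)
    (fun c x θ => LinearMap.congr_fun (Bal.leftMul_smul K.base c x) _)
    (fun x θ θ' => by rw [map_add, LinearMap.add_apply, smul_add])
    (fun c x θ => by
      rw [map_smul, LinearMap.smul_apply]
      exact map_smul (Bal.leftMul K.base ΩA ΩA x) c _)) ∘ₗ
    (GradedTensorProduct.of k grA grH).symm.toLinearMap

theorem insertInv_tmul (x : ΩA) (θ : ΩH) :
    K.insertInv L (x ᵍ⊗ₜ[k] θ) = x • L θ (Bal.tmul K.base 1 1) := rfl

include hL hL' in
theorem chi_insertInv (t : grA ᵍ⊗[k] grH) : K.chi (K.insertInv L t) = t := by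
  refine LinearMap.congr_fun (f := K.chi ∘ₗ K.insertInv L) (g := LinearMap.id)
    (gradedTensor_ext fun i j x hx θ hθ => ?_) t
  rw [LinearMap.comp_apply, insertInv_tmul, chi_smul, K.chi_insertForm hρ hcen L hL hL', chi_tmul,
    map_one]
  change (x ᵍ⊗ₜ[k] (1 : ΩH)) * (((1 : ΩA) ᵍ⊗ₜ[k] θ) * ((1 : grA ᵍ⊗[k] grH) * 1)) =
    (x ᵍ⊗ₜ[k] θ : grA ᵍ⊗[k] grH)
  rw [mul_one, mul_one, GradedTensorProduct.tmul_one_mul_one_tmul]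

include hL hL' in
theorem insertInv_mul_zeroForms (x : ΩA) (θ : ΩH) (s : A ⊗[k] H) :
    K.insertInv L ((x ᵍ⊗ₜ[k] θ) * zeroForms cA cH s) =
      x • L θ (K.mulZeroTranslation hρ (cA.ι.toLinearMap.rTensor H s)) := by
  induction s using TensorProduct.induction_on with
  | zero => simp
  | add s t hs ht => simp only [map_add, mul_add, smul_add, hs, ht]
  | tmul a h =>
    rw [zeroForms_tmul, tmul_mul_tmul_zero _ _ (cA.ι_mem a), insertInv_tmul, map_mul,
      Module.End.mul_apply, mul_smul, ← K.insertForm_smul_zero hρ hcen L hL hL' θ (cA.ι_mem a), hL,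
      insertHom_apply, insertE_one_tmul_one]
    rfl

include hL hL' in
theorem insertInv_mul_d_zeroForms (x : ΩA) {j : ℕ} {θ : ΩH} (hθ : θ ∈ grH j) (s : A ⊗[k] H) :
    K.insertInv L ((x ᵍ⊗ₜ[k] θ) * (tensorDGA cA cH).d (zeroForms cA cH s)) =
      x • L θ (K.dE (K.mulZeroTranslation hρ (cA.ι.toLinearMap.rTensor H s))) := by
  induction s using TensorProduct.induction_on with
  | zero => simp
  | add s t hs ht => simp only [map_add, mul_add, smul_add, hs, ht]
  | tmul a h =>
    have h₁ : (x ᵍ⊗ₜ[k] θ) * ((cA.d (cA.ι a)) ᵍ⊗ₜ[k] (cH.ι h) : grA ᵍ⊗[k] grH) =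
        (x * cA.d (cA.ι a)) ᵍ⊗ₜ[k] (parity grH θ * cH.ι h) := by
      rw [tmul_mul_tmul_of_mem x hθ (cA.d_ι_mem a), parity_of_mem grH hθ, mul_one, smul_mul_assoc]
      simp [GradedTensorProduct.tmul]
    rw [tensorDGA_d_zeroForms, mul_add, h₁, tmul_mul_tmul_zero _ _ (cA.ι_mem a), map_add,
      insertInv_tmul, insertInv_tmul, map_mul, map_mul, Module.End.mul_apply,
      Module.End.mul_apply, mul_smul, mul_smul, ← K.insertForm_smul_one hρ hcen L hL hL' θ
        (cA.d_ι_mem a), ← K.insertForm_smul_zero hρ hcen L hL hL' θ (cA.ι_mem a), hL, hL',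
      insertHom_apply, insertE_one_tmul_one, insertD_one_tmul_one, LinearMap.rTensor_tmul,
      mulZeroTranslation_tmul, AlgHom.toLinearMap_apply, dE_smul, cA.parity_ι, map_add, smul_add]

include hL hL' in
-- Right Ω(A)-linearity of the candidate inverse, where Ω(A) acts on the target of χ through Δ. On
-- generators it follows from 1 ⊗ a = a₀ τ(a₁) and its differential 1 ⊗ da = d(a₀ τ(a₁)).
theorem insertInv_mul_coact (y : ΩA) : ∀ t : grA ᵍ⊗[k] grH,
    K.insertInv L (t * K.coact y) = MulOpposite.op y • K.insertInv L t := by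
  induction y using cA.induction with
  | hι a =>
    intro t
    refine LinearMap.congr_fun (f := K.insertInv L ∘ₗ LinearMap.mulRight k (K.coact (cA.ι a)))
      (g := Bal.rightMul K.base ΩA ΩA (MulOpposite.op (cA.ι a)) ∘ₗ K.insertInv L)
      (gradedTensor_ext fun i j x hx θ hθ => ?_) t
    change K.insertInv L ((x ᵍ⊗ₜ[k] θ) * K.coact (cA.ι a)) =
      MulOpposite.op (cA.ι a) • x • L θ (Bal.tmul K.base 1 1)
    rw [coact_ι, K.insertInv_mul_zeroForms hρ hcen L hL hL', ← tmul_one_ι, ← smul_op_smul,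
      ← K.insertForm_op_smul hρ hcen L hL hL', op_smul_tmul, one_mul]
  | hd a =>
    intro t
    refine LinearMap.congr_fun
      (f := K.insertInv L ∘ₗ LinearMap.mulRight k (K.coact (cA.d (cA.ι a))))
      (g := Bal.rightMul K.base ΩA ΩA (MulOpposite.op (cA.d (cA.ι a))) ∘ₗ K.insertInv L)
      (gradedTensor_ext fun i j x hx θ hθ => ?_) t
    change K.insertInv L ((x ᵍ⊗ₜ[k] θ) * K.coact (cA.d (cA.ι a))) =
      MulOpposite.op (cA.d (cA.ι a)) • x • L θ (Bal.tmul K.base 1 1)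
    rw [coact_d, coact_ι, K.insertInv_mul_d_zeroForms hρ hcen L hL hL' x hθ, ← tmul_one_ι,
      ← smul_op_smul, ← K.insertForm_op_smul hρ hcen L hL hL', op_smul_tmul, one_mul, dE_tmul,
      cA.d_one, Bal.zero_tmul, zero_add, parity_one]
  | hadd x y hx hy =>
    intro t
    rw [map_add, mul_add, map_add, hx, hy, MulOpposite.op_add, add_smul]
  | hmul m n x _ y _ hx hy =>
    intro t
    rw [map_mul K.coact, ← mul_assoc, hy, hx, smul_smul, ← MulOpposite.op_mul]

include hL hL' in
theorem insertInv_chi (z : K.E) : K.insertInv L (K.chi z) = z := by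
  refine LinearMap.congr_fun (f := K.insertInv L ∘ₗ K.chi) (g := LinearMap.id)
    (Bal.hom_ext _ fun x y => ?_) z
  rw [LinearMap.comp_apply, chi_tmul, K.insertInv_mul_coact hρ hcen L hL hL', insertInv_tmul,
    map_one, Module.End.one_apply, smul_tmul, op_smul_tmul, mul_one, one_mul]
  rfl

end CompleteCalculus

end Bijectivity

section Main

universe v

variable {k : Type*} [Field k] {H : Type*} [Ring H] [HopfAlgebra k H]
  {A : Type v} [Ring A] [Algebra k A]
  {ΩH : Type*} [Ring ΩH] [Algebra k ΩH] {grH : ℕ → Submodule k ΩH} [GradedAlgebra grH]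
  {ΩA : Type*} [Ring ΩA] [Algebra k ΩA] {grA : ℕ → Submodule k ΩA} [GradedAlgebra grA]
  {ρ : ComoduleAlgebra k H A} {cA : DiffCalculus A grA} {cH : DiffCalculus H grH}
  (K : CompleteCalculus ρ cA cH)
  {Γ : Type*} [AddCommGroup Γ] [Module k Γ] [Module H Γ] [Module Hᵐᵒᵖ Γ]
  [IsScalarTower k H Γ] [IsScalarTower k Hᵐᵒᵖ Γ] [SMulCommClass H Hᵐᵒᵖ Γ] {F : FODC k H Γ}

theorem CompleteCalculus.bijective_chi
    (hS : Function.Bijective (HopfAlgebra.antipode k : H →ₗ[k] H))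
    (hρ : ρ.IsQuantumPrincipalBundle) (hF : F.IsBicovariant) (hcH : IsMaximalProlongation F cH) :
    Function.Bijective K.chi := by
  -- For A = 0 the Hopf–Galois map does not bound the size of H, so smallness cannot be derived; but
  -- then both sides of χ are zero.
  rcases subsingleton_or_nontrivial A with hA | hA
  · have h0 : ∀ x : ΩA, x = 0 := fun x => by
      rw [← one_mul x, ← map_one cA.ι, Subsingleton.elim (1 : A) 0, map_zero, zero_mul]
    have hE : ∀ z : K.E, z = 0 := fun z => by
      induction z using Bal.induction with
      | h0 => rfl
      | ht x y => rw [h0 x, Bal.zero_tmul]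
      | ha z z' hz hz' => rw [hz, hz', add_zero]
    have hT : ∀ t : grA ᵍ⊗[k] grH, t = 0 := fun t => by
      rw [← one_mul t]
      change ((1 : ΩA) ᵍ⊗ₜ[k] (1 : ΩH)) * t = 0
      rw [h0 1]
      simp [GradedTensorProduct.tmul]
    exact ⟨fun z z' _ => (hE z).trans (hE z').symm, fun t => ⟨0, by rw [map_zero, hT t]⟩⟩
  have hgal := hρ.bijective_galoisMap
  have : Small.{v} H := ρ.small_of_bijective hgal
  have : Small.{v} ΩA := cA.small
  have : Small.{v} ΩH := cH.small
  have : Small.{v} (grA ᵍ⊗[k] grH) :=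
    inferInstanceAs (Small.{v} (ΩA ⊗[k] ΩH))
  let _ : Module A ΩA := Module.compHom ΩA cA.ι.toRingHom
  let _ : Module A (grA ᵍ⊗[k] grH) :=
    Module.compHom _ ((GradedTensorProduct.includeLeft grA grH).comp cA.ι).toRingHom
  have hA : ∀ (a : A) (x : ΩA), a • x = cA.ι a * x := fun _ _ => rfl
  have hT : ∀ (a : A) (t : grA ᵍ⊗[k] grH), a • t = ((cA.ι a) ᵍ⊗ₜ[k] (1 : ΩH)) * t :=
    fun _ _ => rfl
  have : IsScalarTower k A ΩA := ⟨fun c a x => by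
    rw [hA, hA, map_smul, smul_mul_assoc]⟩
  have : IsScalarTower k A (grA ᵍ⊗[k] grH) := ⟨fun c a t => by
    change (GradedTensorProduct.includeLeft grA grH).comp cA.ι (c • a) * t =
      c • ((GradedTensorProduct.includeLeft grA grH).comp cA.ι a * t)
    rw [map_smul, smul_mul_assoc]⟩
  obtain ⟨R⟩ := hF
  obtain ⟨Δ, hΔ⟩ := hcH.exists_extendedComul R
  obtain ⟨ε, hε, hε'⟩ := hcH.exists_counit
  obtain ⟨j, hj⟩ := hcH.exists_forms
  have hcen := K.base_smul_zeroTranslation hΔ hgal hA hT hε hε' hS hρ.faithfullyFlat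
  have w₁ := K.mulMap_insertHom_insertD hA hT hgal hcen hΔ hε hε' hS hρ.faithfullyFlat hj R
  -- L extends h ↦ L_h to Ω(H) with dh ↦ [d, L_h]; the two conditions of the universal property are
  -- `w₁` and its consequence through d² = 0.
  obtain ⟨L, hL, hL'⟩ := hcH.exists_algHom (K.insertHom hgal hcen) (K.insertD hgal hcen)
    (K.insertD_mul hgal hcen) w₁ (K.mulMap_insertD hgal hcen w₁)
  exact ⟨Function.LeftInverse.injective (K.insertInv_chi hgal hcen L hL hL'),
    Function.RightInverse.surjective (K.chi_insertInv hgal hcen L hL hL')⟩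

end Main

/-! ## The braiding: degrees, braided commutativity and the hexagon identities -/

section Braiding

variable {k : Type*} [Field k] {H : Type*} [Ring H] [HopfAlgebra k H]
  {A : Type*} [Ring A] [Algebra k A]
  {ΩH : Type*} [Ring ΩH] [Algebra k ΩH] {grH : ℕ → Submodule k ΩH} [GradedAlgebra grH]
  {ΩA : Type*} [Ring ΩA] [Algebra k ΩA] {grA : ℕ → Submodule k ΩA} [GradedAlgebra grA]
  {ρ : ComoduleAlgebra k H A} {cA : DiffCalculus A grA} {cH : DiffCalculus H grH}
  (K : CompleteCalculus ρ cA cH)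

namespace CompleteCalculus

theorem tmul_one_mem {n : ℕ} {x : ΩA} (hx : x ∈ grA n) :
    (x ᵍ⊗ₜ[k] (1 : ΩH) : grA ᵍ⊗[k] grH) ∈ tensorGr grA grH n :=
  tmul_mem_tensorGr (add_zero n) hx (SetLike.GradedOne.one_mem (A := grH))

theorem chi_mem {n : ℕ} {z : K.E} (hz : z ∈ K.grE n) : K.chi z ∈ tensorGr grA grH n := by
  suffices h : K.grE n ≤ (tensorGr grA grH n).comap K.chi from h hz
  refine Submodule.span_le.2 ?_
  rintro _ ⟨i, j, rfl, x, hx, y, hy, rfl⟩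
  change K.chi (Bal.tmul K.base x y) ∈ tensorGr grA grH (i + j)
  rw [chi_tmul]
  exact tensorGr_mul_mem (tmul_one_mem hx) (K.coact_mem j y hy)

variable (hχ : Function.Bijective K.chi)

theorem chiEquiv_symm_proj_mem (n : ℕ) (z : K.E) :
    (K.chiEquiv hχ).symm (GradedAlgebra.proj (tensorGr grA grH) n (K.chi z)) ∈ K.grE n := by
  suffices h : (K.grE n).mkQ ∘ₗ (K.chiEquiv hχ).symm.toLinearMap ∘ₗ
      GradedAlgebra.proj (tensorGr grA grH) n ∘ₗ K.chi = 0 by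
    have h := LinearMap.congr_fun h z
    rwa [LinearMap.comp_apply, LinearMap.zero_apply, Submodule.mkQ_apply,
      Submodule.Quotient.mk_eq_zero] at h
  refine Bal.hom_ext _ fun x y => ?_
  suffices h : (LinearMap.compr₂ (Bal.mk K.base ΩA ΩA) ((K.grE n).mkQ ∘ₗ
      (K.chiEquiv hχ).symm.toLinearMap ∘ₗ GradedAlgebra.proj (tensorGr grA grH) n ∘ₗ K.chi)) = 0 from
    LinearMap.congr_fun (LinearMap.congr_fun h x) y
  refine graded_ext grA fun i x hx => graded_ext grA fun j y hy => ?_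
  change (K.grE n).mkQ ((K.chiEquiv hχ).symm (GradedAlgebra.proj (tensorGr grA grH) n
    (K.chi (Bal.tmul K.base x y)))) = 0
  have hmem : Bal.tmul K.base x y ∈ K.grE (i + j) :=
    Submodule.subset_span ⟨i, j, rfl, x, hx, y, hy, rfl⟩
  by_cases h : i + j = n
  · rw [h] at hmem
    rw [proj_of_mem _ (K.chi_mem hmem), Submodule.mkQ_apply, Submodule.Quotient.mk_eq_zero]
    rw [show (K.chiEquiv hχ).symm (K.chi (Bal.tmul K.base x y)) = Bal.tmul K.base x y from
      (K.chiEquiv hχ).symm_apply_apply _]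
    exact hmem
  · rw [proj_of_mem_ne _ h (K.chi_mem hmem), map_zero, map_zero]

include hχ in
-- The projections of the target grading, transported by χ⁻¹, map `E` into `grE` since they do so on
-- homogeneous x ⊗ y. Degrees in `E` can thus be read off after χ.
theorem mem_grE_iff {n : ℕ} {z : K.E} : z ∈ K.grE n ↔ K.chi z ∈ tensorGr grA grH n := by
  refine ⟨K.chi_mem, fun hz => ?_⟩
  have h := K.chiEquiv_symm_proj_mem hχ n z
  rw [proj_of_mem _ hz] at h
  rwa [show (K.chiEquiv hχ).symm (K.chi z) = z from (K.chiEquiv hχ).symm_apply_apply z] at h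

theorem chi_pullback_mul (z w : K.E) :
    K.chi ((K.pullbackDGA hχ).mul z w) = K.chi z * K.chi w :=
  (K.chiEquiv hχ).apply_symm_apply _

theorem chi_one : K.chi (Bal.tmul K.base 1 1) = 1 := by
  rw [chi_tmul, map_one, mul_one]
  rfl

include hχ in
theorem isInternal_grE : DirectSum.IsInternal K.grE := by
  refine isInternal_of_projections _ (fun n => (K.chiEquiv hχ).symm.toLinearMap ∘ₗ
    GradedAlgebra.proj (tensorGr grA grH) n ∘ₗ K.chi) (fun n z hz => ?_) (fun m n h z hz => ?_) ?_
  · rw [LinearMap.comp_apply, LinearMap.comp_apply, proj_of_mem _ (K.chi_mem hz)]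
    exact (K.chiEquiv hχ).symm_apply_apply z
  · rw [LinearMap.comp_apply, LinearMap.comp_apply, proj_of_mem_ne _ h (K.chi_mem hz), map_zero]
  · have h : (⨆ n, K.grE n).mkQ = 0 := Bal.hom_ext _ fun x y => by
      suffices h : LinearMap.compr₂ (Bal.mk K.base ΩA ΩA) (⨆ n, K.grE n).mkQ = 0 from
        LinearMap.congr_fun (LinearMap.congr_fun h x) y
      refine graded_ext grA fun i x hx => graded_ext grA fun j y hy => ?_
      change (⨆ n, K.grE n).mkQ (Bal.tmul K.base x y) = 0
      rw [Submodule.mkQ_apply, Submodule.Quotient.mk_eq_zero]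
      exact Submodule.mem_iSup_of_mem (i + j) (Submodule.subset_span ⟨i, j, rfl, x, hx, y, hy, rfl⟩)
    rw [← Submodule.ker_mkQ (⨆ n, K.grE n), h, LinearMap.ker_zero]

/-- χ is injective, multiplicative by construction, compatible with d by `chi_dE` and detects
degrees by `mem_grE_iff`; so the algebraic axioms are those of Ω(A) ⊗ Ω(H). -/
theorem pullbackDGA_isDGA : (K.pullbackDGA hχ).IsDGA where
  isInternal := K.isInternal_grE hχ
  one_mul z := hχ.1 ((K.chi_pullback_mul hχ _ z).trans (by
    change K.chi (Bal.tmul K.base 1 1) * K.chi z = K.chi z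
    rw [chi_one, one_mul]))
  mul_one z := hχ.1 ((K.chi_pullback_mul hχ z _).trans (by
    change K.chi z * K.chi (Bal.tmul K.base 1 1) = K.chi z
    rw [chi_one, mul_one]))
  mul_assoc z w v := hχ.1 (by simp only [chi_pullback_mul, mul_assoc])
  one_mem := (K.mem_grE_iff hχ).2 (K.chi_one.symm ▸ tensorGr_one_mem)
  mul_mem m n z hz w hw := (K.mem_grE_iff hχ).2 (by
    rw [chi_pullback_mul]
    exact tensorGr_mul_mem (K.chi_mem hz) (K.chi_mem hw))
  d_mem n z hz := (K.mem_grE_iff hχ).2 ((K.chi_dE z).symm ▸ tensorDGA_d_mem cA cH (K.chi_mem hz))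
  d_d := K.dE_dE
  leibniz n z hz w := hχ.1 (by
    change K.chi (K.dE ((K.pullbackDGA hχ).mul z w)) = K.chi ((K.pullbackDGA hχ).mul (K.dE z) w +
      (-1 : k) ^ n • (K.pullbackDGA hχ).mul z (K.dE w))
    rw [map_add, map_smul, chi_dE, chi_pullback_mul, chi_pullback_mul, chi_pullback_mul, chi_dE,
      chi_dE, tensorDGA_leibniz, parity_of_mem _ (K.chi_mem hz), smul_mul_assoc])

theorem chi_isHom : DGAData.IsHom (K.pullbackDGA hχ) (tensorDGA cA cH) K.chi where
  map_mul := K.chi_pullback_mul hχ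
  map_one := K.chi_one
  map_gr _ _ := K.chi_mem
  map_d := K.chi_dE

theorem tau_isHom : DGAData.IsHom cH.dga (K.pullbackDGA hχ) (K.tau hχ) where
  map_mul θ η := hχ.1 (by
    rw [chi_pullback_mul, chi_tau, chi_tau, chi_tau, tmul_mul_one_tmul]
    rfl)
  map_one := hχ.1 ((K.chi_tau hχ 1).trans K.chi_one.symm)
  map_gr n θ hθ := (K.mem_grE_iff hχ).2 (by
    rw [chi_tau]
    exact tmul_mem_tensorGr (zero_add n) (SetLike.GradedOne.one_mem (A := grA)) hθ)
  map_d θ := hχ.1 (by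
    change K.chi (K.tau hχ (cH.d θ)) = K.chi (K.dE (K.tau hχ θ))
    rw [chi_dE, chi_tau, chi_tau, tensorDGA_d_tmul, cA.d_one, parity_one]
    simp [GradedTensorProduct.tmul])

theorem chi_sigma_tmul (x y : ΩA) :
    K.chi (K.sigma hχ (Bal.tmul K.base x y)) = K.coact x * (y ᵍ⊗ₜ[k] (1 : ΩH)) := by
  rw [sigma_tmul, chi_mulTau]

theorem sigma_mem (n : ℕ) (z : K.E) (hz : z ∈ K.grE n) : K.sigma hχ z ∈ K.grE n := by
  suffices h : K.grE n ≤ (K.grE n).comap (K.sigma hχ) from h hz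
  refine Submodule.span_le.2 ?_
  rintro _ ⟨i, j, rfl, x, hx, y, hy, rfl⟩
  change K.sigma hχ (Bal.tmul K.base x y) ∈ K.grE (i + j)
  rw [K.mem_grE_iff hχ, chi_sigma_tmul]
  exact tensorGr_mul_mem (K.coact_mem i x hx) (tmul_one_mem hy)

/-- ∧ = (id ⊗ ε)χ, and id ⊗ ε is an algebra morphism taking Δ(x)(y ⊗ 1) to x y. -/
theorem wedge_comp_sigma {ε : ΩH →ₐ[k] k} (hε : ∀ a, ε (cH.ι a) = Coalgebra.counit (R := k) a)
    (hε' : ∀ n, ∀ θ ∈ grH (n + 1), ε θ = 0) : K.wedge ∘ₗ K.sigma hχ = K.wedge := by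
  have hl : ∀ x : ΩA, tensorCounit grA hε' (x ᵍ⊗ₜ[k] (1 : ΩH)) = x := fun x => by
    rw [tensorCounit_tmul, map_one, map_one, mul_one]
  have h : ∀ z, K.wedge z = tensorCounit grA hε' (K.chi z) :=
    LinearMap.congr_fun (f := K.wedge) (g := (tensorCounit grA hε').toLinearMap ∘ₗ K.chi)
      (Bal.hom_ext _ fun x y => by
        change x * y = tensorCounit grA hε' (K.chi (Bal.tmul K.base x y))
        rw [chi_tmul, map_mul, hl, K.tensorCounit_coact hε])
  refine Bal.hom_ext _ fun x y => ?_
  rw [LinearMap.comp_apply, h, chi_sigma_tmul, map_mul, hl, K.tensorCounit_coact hε]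
  rfl

theorem hom_ext₃ {M : Type*} [AddCommGroup M] [Module k M] {f g : K.E₃ →ₗ[k] M}
    (h : ∀ x y z, f (Bal.tmul K.base (Bal.tmul K.base x y) z) =
      g (Bal.tmul K.base (Bal.tmul K.base x y) z)) : f = g :=
  Bal.hom_ext _ fun w z => LinearMap.congr_fun
    (f := f ∘ₗ (Bal.mk K.base K.E ΩA).flip z) (g := g ∘ₗ (Bal.mk K.base K.E ΩA).flip z)
    (Bal.hom_ext _ fun x y => h x y z) w

/-- The map `x ⊗ w ↦ x w` of `Ω(A) ⊗ E` to the triple tensor product. -/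
abbrev consE (x : ΩA) (w : K.E) : K.E₃ := (Bal.assoc K.base).symm (Bal.tmul K.base x w)

theorem sigmaLeft_tmul (w : K.E) (z : ΩA) :
    K.sigmaLeft hχ (Bal.tmul K.base w z) = Bal.tmul K.base (K.sigma hχ w) z := rfl

theorem sigmaRight_tmul (x y z : ΩA) :
    K.sigmaRight hχ (Bal.tmul K.base (Bal.tmul K.base x y) z) =
      K.consE x (K.sigma hχ (Bal.tmul K.base y z)) := rfl

theorem wedgeRight_tmul (w : K.E) (z : ΩA) :
    K.wedgeRight (Bal.tmul K.base w z) = MulOpposite.op z • w :=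
  LinearMap.congr_fun (f := K.wedgeRight ∘ₗ (Bal.mk K.base K.E ΩA).flip z)
    (g := Bal.rightMul K.base ΩA ΩA (MulOpposite.op z)) (Bal.hom_ext _ fun _ _ => rfl) w

theorem wedgeLeft_consE (x : ΩA) (w : K.E) : K.wedgeLeft (K.consE x w) = x • w :=
  LinearMap.congr_fun (f := K.wedgeLeft ∘ₗ (Bal.assoc K.base).symm.toLinearMap ∘ₗ
      Bal.mk K.base ΩA K.E x)
    (g := Bal.leftMul K.base ΩA ΩA x) (Bal.hom_ext _ fun _ _ => rfl) w

/-- After χ, the map (id ⊗ ∧)(σ ⊗ id) sends x ⊗ w to Δ(x) χ(w), so the identity reads Δ(xy)(z ⊗ 1) =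
Δ(x) (Δ(y)(z ⊗ 1)). The other hexagon is similar, with right multiplication by z ⊗ 1. -/
theorem sigma_comp_wedgeLeft :
    K.sigma hχ ∘ₗ K.wedgeLeft = K.wedgeRight ∘ₗ K.sigmaLeft hχ ∘ₗ K.sigmaRight hχ := by
  have h : ∀ (x : ΩA) (w : K.E), K.chi (K.wedgeRight (K.sigmaLeft hχ (K.consE x w))) =
      K.coact x * K.chi w := fun x w =>
    LinearMap.congr_fun (f := K.chi ∘ₗ K.wedgeRight ∘ₗ K.sigmaLeft hχ ∘ₗ
        (Bal.assoc K.base).symm.toLinearMap ∘ₗ Bal.mk K.base ΩA K.E x)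
      (g := LinearMap.mulLeft k (K.coact x) ∘ₗ K.chi)
      (Bal.hom_ext _ fun y z => by
        change K.chi (K.wedgeRight (K.sigmaLeft hχ (Bal.tmul K.base (Bal.tmul K.base x y) z))) =
          K.coact x * K.chi (Bal.tmul K.base y z)
        rw [sigmaLeft_tmul, wedgeRight_tmul, chi_op_smul', chi_sigma_tmul, chi_tmul, mul_assoc]) w
  refine K.hom_ext₃ fun x y z => hχ.1 ?_
  change K.chi (K.sigma hχ (Bal.tmul K.base (x * y) z)) =
    K.chi (K.wedgeRight (K.sigmaLeft hχ (K.consE x (K.sigma hχ (Bal.tmul K.base y z)))))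
  rw [h, chi_sigma_tmul, chi_sigma_tmul, map_mul, mul_assoc]

theorem sigma_comp_wedgeRight :
    K.sigma hχ ∘ₗ K.wedgeRight = K.wedgeLeft ∘ₗ K.sigmaRight hχ ∘ₗ K.sigmaLeft hχ := by
  have h : ∀ (w : K.E) (z : ΩA), K.chi (K.wedgeLeft (K.sigmaRight hχ (Bal.tmul K.base w z))) =
      K.chi w * (z ᵍ⊗ₜ[k] (1 : ΩH)) := fun w z =>
    LinearMap.congr_fun (f := K.chi ∘ₗ K.wedgeLeft ∘ₗ K.sigmaRight hχ ∘ₗ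
        (Bal.mk K.base K.E ΩA).flip z)
      (g := LinearMap.mulRight k (z ᵍ⊗ₜ[k] (1 : ΩH)) ∘ₗ K.chi)
      (Bal.hom_ext _ fun x y => by
        change K.chi (K.wedgeLeft (K.consE x (K.sigma hχ (Bal.tmul K.base y z)))) =
          K.chi (Bal.tmul K.base x y) * (z ᵍ⊗ₜ[k] (1 : ΩH))
        rw [wedgeLeft_consE, chi_smul, chi_sigma_tmul, chi_tmul, mul_assoc]) w
  refine K.hom_ext₃ fun x y z => hχ.1 ?_
  change K.chi (K.sigma hχ (Bal.tmul K.base x (y * z))) =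
    K.chi (K.wedgeLeft (K.sigmaRight hχ (Bal.tmul K.base (K.sigma hχ (Bal.tmul K.base x y)) z)))
  rw [h, chi_sigma_tmul, chi_sigma_tmul, mul_assoc, tmul_one_mul_tmul]

/-! ### The braid equation -/

section Braid

variable {C : Type*} [Ring C] [Algebra k C] (f g h : ΩA →ₐ[k] C)

/-- The map `x ⊗ y ↦ f(x) g(y)`, for morphisms `f`, `g` which agree on `Ω(B)`. -/
def pairMap (hfg : ∀ b : K.base, f b = g b) : K.E →ₗ[k] C :=
  Bal.lift _ ((LinearMap.mul k C).compl₁₂ f.toLinearMap g.toLinearMap) (by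
    intro x b y
    simp [Subalgebra.smul_def, hfg, mul_assoc])

theorem pairMap_tmul (hfg : ∀ b : K.base, f b = g b) (x y : ΩA) :
    K.pairMap f g hfg (Bal.tmul K.base x y) = f x * g y := rfl

/-- The map `x ⊗ y ⊗ z ↦ f(x) g(y) h(z)`, for morphisms `f`, `g`, `h` which agree on `Ω(B)`. -/
def tripleMap (hfg : ∀ b : K.base, f b = g b) (hgh : ∀ b : K.base, g b = h b) : K.E₃ →ₗ[k] C :=
  Bal.lift _ ((LinearMap.mul k C).compl₁₂ (K.pairMap f g hfg) h.toLinearMap) (fun w b z =>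
    LinearMap.congr_fun
      (f := LinearMap.mulRight k (h z) ∘ₗ K.pairMap f g hfg ∘ₗ
        Bal.rightMul K.base ΩA ΩA (MulOpposite.op (b : ΩA)))
      (g := LinearMap.mulRight k (h (b * z)) ∘ₗ K.pairMap f g hfg)
      (Bal.hom_ext _ fun x y => by
        change f x * g (y * b) * h z = f x * g y * h (b * z)
        rw [map_mul, map_mul, hgh, mul_assoc, mul_assoc, mul_assoc]) w)

theorem tripleMap_tmul (hfg : ∀ b : K.base, f b = g b) (hgh : ∀ b : K.base, g b = h b) (w : K.E)
    (z : ΩA) : K.tripleMap f g h hfg hgh (Bal.tmul K.base w z) = K.pairMap f g hfg w * h z := rfl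

theorem tripleMap_consE (hfg : ∀ b : K.base, f b = g b) (hgh : ∀ b : K.base, g b = h b) (x : ΩA)
    (w : K.E) : K.tripleMap f g h hfg hgh (K.consE x w) = f x * K.pairMap g h hgh w :=
  LinearMap.congr_fun (f := K.tripleMap f g h hfg hgh ∘ₗ (Bal.assoc K.base).symm.toLinearMap ∘ₗ
      Bal.mk K.base ΩA K.E x)
    (g := LinearMap.mulLeft k (f x) ∘ₗ K.pairMap g h hgh)
    (Bal.hom_ext _ fun y z => mul_assoc (f x) (g y) (h z)) w

/-- The braiding of two neighbouring factors is absorbed by exchanging the two algebra morphisms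
attached to them, so a composite of braidings acts as a permutation of (f, g, h). -/
theorem tripleMap_sigmaLeft (hfg : ∀ b : K.base, f b = g b) (hgh : ∀ b : K.base, g b = h b)
    (hfh : ∀ b : K.base, f b = h b)
    (hσ : ∀ x y, K.pairMap f g hfg (K.sigma hχ (Bal.tmul K.base x y)) = g x * f y) (t : K.E₃) :
    K.tripleMap f g h hfg hgh (K.sigmaLeft hχ t) =
      K.tripleMap g f h (fun b => (hfg b).symm) hfh t :=
  LinearMap.congr_fun (f := K.tripleMap f g h hfg hgh ∘ₗ K.sigmaLeft hχ)
    (K.hom_ext₃ fun x y z => by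
      rw [LinearMap.comp_apply, sigmaLeft_tmul, tripleMap_tmul, tripleMap_tmul, hσ, pairMap_tmul]) t

theorem tripleMap_sigmaRight (hfg : ∀ b : K.base, f b = g b) (hgh : ∀ b : K.base, g b = h b)
    (hfh : ∀ b : K.base, f b = h b)
    (hσ : ∀ x y, K.pairMap g h hgh (K.sigma hχ (Bal.tmul K.base x y)) = h x * g y) (t : K.E₃) :
    K.tripleMap f g h hfg hgh (K.sigmaRight hχ t) =
      K.tripleMap f h g hfh (fun b => (hgh b).symm) t :=
  LinearMap.congr_fun (f := K.tripleMap f g h hfg hgh ∘ₗ K.sigmaRight hχ)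
    (K.hom_ext₃ fun x y z => by
      rw [LinearMap.comp_apply, sigmaRight_tmul, tripleMap_consE, tripleMap_tmul, hσ,
        pairMap_tmul, mul_assoc]) t

theorem pairMap_eq (F : grA ᵍ⊗[k] grH →ₐ[k] C) (hfg : ∀ b : K.base, f b = g b)
    (hf : ∀ x, F (x ᵍ⊗ₜ[k] (1 : ΩH)) = f x) (hg : ∀ x, F (K.coact x) = g x) (w : K.E) :
    K.pairMap f g hfg w = F (K.chi w) :=
  LinearMap.congr_fun (f := K.pairMap f g hfg) (g := F.toLinearMap ∘ₗ K.chi)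
    (Bal.hom_ext _ fun x y => by
      change f x * g y = F (K.chi (Bal.tmul K.base x y))
      rw [chi_tmul, map_mul, hf, hg]) w

end Braid

/-- The first of the three morphisms of `Ω(A)` to `Ω(A) ⊗ Ω(H) ⊗ Ω(H)`. -/
def embed₁ : ΩA →ₐ[k] (tensorGr grA grH) ᵍ⊗[k] grH :=
  (GradedTensorProduct.includeLeft (tensorGr grA grH) grH).comp
    (GradedTensorProduct.includeLeft grA grH)

/-- The morphism `x ↦ Δ(x) ⊗ 1`. -/
def embed₂ : ΩA →ₐ[k] (tensorGr grA grH) ᵍ⊗[k] grH :=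
  (GradedTensorProduct.includeLeft (tensorGr grA grH) grH).comp K.coact

/-- The morphism `x ↦ (Δ ⊗ id) Δ(x)`. -/
def embed₃ : ΩA →ₐ[k] (tensorGr grA grH) ᵍ⊗[k] grH := K.coactTensor.comp K.coact

theorem embed₁_eq_embed₂ (b : K.base) : embed₁ (grA := grA) (grH := grH) (b : ΩA) = K.embed₂ b := by
  have hb : K.coact (b : ΩA) = GradedTensorProduct.includeLeft grA grH b := b.2
  rw [embed₁, embed₂, AlgHom.comp_apply, AlgHom.comp_apply, hb]

theorem embed₂_eq_embed₃ (b : K.base) : K.embed₂ (b : ΩA) = K.embed₃ b := by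
  have hb : K.coact (b : ΩA) = (b : ΩA) ᵍ⊗ₜ[k] (1 : ΩH) := b.2
  rw [embed₃, AlgHom.comp_apply, hb, coactTensor_tmul]
  rfl

/-- The map `x ⊗ y ↦ x ⊗ y τ(θ)`. -/
def consTau (θ : ΩH) : K.E →ₗ[k] Bal K.base ΩA K.E :=
  Bal.lmap K.base ΩA (K.mulTau hχ ∘ₗ (GradedTensorProduct.of k grA grH).toLinearMap ∘ₗ
    (TensorProduct.mk k ΩA ΩH).flip θ) (fun b y => mul_smul (b : ΩA) y (K.tau hχ θ))

theorem consTau_tmul (θ : ΩH) (x y : ΩA) :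
    K.consTau hχ θ (Bal.tmul K.base x y) = Bal.tmul K.base x (y • K.tau hχ θ) := rfl

/-- The map `χ(x ⊗ y) ⊗ θ ↦ x ⊗ y τ(θ)`. -/
def unembed : (tensorGr grA grH) ᵍ⊗[k] grH →ₗ[k] Bal K.base ΩA K.E :=
  TensorProduct.lift (LinearMap.mk₂ k
    (fun (t : grA ᵍ⊗[k] grH) (θ : ΩH) => K.consTau hχ θ ((K.chiEquiv hχ).symm t))
    (fun s t θ => by rw [map_add, map_add])
    (fun c t θ => by rw [map_smul, map_smul])
    (fun t θ θ' => LinearMap.congr_fun (f := K.consTau hχ (θ + θ'))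
      (g := K.consTau hχ θ + K.consTau hχ θ') (Bal.hom_ext _ fun x y => by
        rw [LinearMap.add_apply, consTau_tmul, consTau_tmul, consTau_tmul, map_add, smul_add,
          Bal.tmul_add]) _)
    (fun c t θ => LinearMap.congr_fun (f := K.consTau hχ (c • θ)) (g := c • K.consTau hχ θ)
      (Bal.hom_ext _ fun x y => by
        rw [LinearMap.smul_apply, consTau_tmul, consTau_tmul, map_smul, ← Bal.tmul_smul]
        exact congrArg (Bal.tmul K.base x) (map_smul (Bal.leftMul K.base ΩA ΩA y) c _)) _)) ∘ₗ
    (GradedTensorProduct.of k (tensorGr grA grH) grH).symm.toLinearMap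

theorem unembed_chi_tmul (x y : ΩA) (θ : ΩH) :
    K.unembed hχ ((K.chi (Bal.tmul K.base x y)) ᵍ⊗ₜ[k] θ) =
      Bal.tmul K.base x (y • K.tau hχ θ) :=
  (congrArg (K.consTau hχ θ) ((K.chiEquiv hχ).symm_apply_apply _)).trans (K.consTau_tmul hχ θ x y)

theorem mulTau_chi (w : K.E) : K.mulTau hχ (K.chi w) = w := hχ.1 (K.chi_mulTau hχ _)

include hχ in
-- On x ⊗ w the map is (x ⊗ 1 ⊗ 1)·(Δ ⊗ id)(χ(w)). Writing w as a sum of y τ(θ), this is χ(x ⊗ y) ⊗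
-- θ, from which `unembed` recovers x ⊗ y τ(θ).
theorem tripleMap_injective : Function.Injective
    (K.tripleMap embed₁ K.embed₂ K.embed₃ K.embed₁_eq_embed₂ K.embed₂_eq_embed₃) := by
  have h : ∀ (x : ΩA) (t : grA ᵍ⊗[k] grH), K.unembed hχ
      (K.tripleMap embed₁ K.embed₂ K.embed₃ K.embed₁_eq_embed₂ K.embed₂_eq_embed₃
        (K.consE x (K.mulTau hχ t))) = Bal.tmul K.base x (K.mulTau hχ t) := by
    intro x t
    rw [tripleMap_consE, K.pairMap_eq _ _ K.coactTensor _ (fun _ => rfl) (fun _ => rfl), chi_mulTau]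
    refine LinearMap.congr_fun
      (f := K.unembed hχ ∘ₗ LinearMap.mulLeft k (embed₁ x) ∘ₗ K.coactTensor.toLinearMap)
      (g := Bal.mk K.base ΩA K.E x ∘ₗ K.mulTau hχ) (gradedTensor_ext fun i j y hy θ hθ => ?_) t
    change K.unembed hχ (((x ᵍ⊗ₜ[k] (1 : ΩH)) ᵍ⊗ₜ[k] (1 : ΩH)) * ((K.coact y) ᵍ⊗ₜ[k] θ)) =
      Bal.tmul K.base x (y • K.tau hχ θ)
    rw [tmul_one_mul_tmul, ← chi_tmul, unembed_chi_tmul]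
  refine Function.LeftInverse.injective
    (g := (Bal.assoc K.base).symm ∘ K.unembed hχ) fun t => ?_
  refine LinearMap.congr_fun (f := (Bal.assoc K.base).symm.toLinearMap ∘ₗ K.unembed hχ ∘ₗ
    K.tripleMap embed₁ K.embed₂ K.embed₃ K.embed₁_eq_embed₂ K.embed₂_eq_embed₃)
    (g := LinearMap.id) (K.hom_ext₃ fun x y z => ?_) t
  have h := h x (K.chi (Bal.tmul K.base y z))
  rw [mulTau_chi] at h
  exact congrArg (Bal.assoc K.base).symm h

variable {ΔH : ΩH →ₐ[k] grH ᵍ⊗[k] grH} (hΔ : IsExtendedComul cH ΔH)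

include hΔ in
-- Both sides reverse the triple of embeddings, the two words being the reduced expressions of the
-- longest permutation of three letters.
theorem braid_equation : K.sigmaLeft hχ ∘ₗ K.sigmaRight hχ ∘ₗ K.sigmaLeft hχ =
    K.sigmaRight hχ ∘ₗ K.sigmaLeft hχ ∘ₗ K.sigmaRight hχ := by
  have h₁₃ : ∀ b : K.base, embed₁ (b : ΩA) = K.embed₃ b := fun b =>
    (K.embed₁_eq_embed₂ b).trans (K.embed₂_eq_embed₃ b)
  have σ₁₂ : ∀ x y, K.pairMap embed₁ K.embed₂ K.embed₁_eq_embed₂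
      (K.sigma hχ (Bal.tmul K.base x y)) = K.embed₂ x * embed₁ y := fun x y => by
    rw [K.pairMap_eq _ _ (GradedTensorProduct.includeLeft (tensorGr grA grH) grH) _
      (fun _ => rfl) (fun _ => rfl), chi_sigma_tmul, map_mul]
    rfl
  have σ₂₃ : ∀ x y, K.pairMap K.embed₂ K.embed₃ K.embed₂_eq_embed₃
      (K.sigma hχ (Bal.tmul K.base x y)) = K.embed₃ x * K.embed₂ y := fun x y => by
    rw [K.pairMap_eq _ _ K.coactTensor _ (fun _ => rfl) (fun _ => rfl), chi_sigma_tmul, map_mul]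
    rfl
  -- The pairs (1,2) and (2,3) come from (· ⊗ 1, Δ) along · ⊗ 1 and Δ ⊗ id. The pair (1,3) comes
  -- from it along id ⊗ Δ, which needs coassociativity.
  have σ₁₃ : ∀ x y, K.pairMap embed₁ K.embed₃ h₁₃
      (K.sigma hχ (Bal.tmul K.base x y)) = K.embed₃ x * embed₁ y := fun x y => by
    have hl : ∀ y : ΩA, gradedAssoc grA grH grH (embed₁ y) =
        tensorComul grA hΔ (y ᵍ⊗ₜ[k] (1 : ΩH)) := fun y => by
      rw [tensorComul_tmul, map_one]
      rfl
    have h₃ : ∀ y : ΩA, gradedAssoc grA grH grH (K.embed₃ y) = tensorComul grA hΔ (K.coact y) :=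
      K.coact_coassoc hΔ
    have hinj : Function.Injective (gradedAssoc grA grH grH) := gradedAssocLin_injective
    have hp : ∀ w, gradedAssoc grA grH grH (K.pairMap embed₁ K.embed₃ h₁₃ w) =
        tensorComul grA hΔ (K.chi w) :=
      LinearMap.congr_fun (f := (gradedAssoc grA grH grH).toLinearMap ∘ₗ
          K.pairMap embed₁ K.embed₃ h₁₃)
        (g := (tensorComul grA hΔ).toLinearMap ∘ₗ K.chi) (Bal.hom_ext _ fun x y => by
          rw [LinearMap.comp_apply, LinearMap.comp_apply, AlgHom.toLinearMap_apply,
            AlgHom.toLinearMap_apply, pairMap_tmul, chi_tmul, map_mul (gradedAssoc grA grH grH),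
            map_mul (tensorComul grA hΔ), hl, h₃])
    refine hinj ?_
    rw [hp, chi_sigma_tmul, map_mul (gradedAssoc grA grH grH), map_mul (tensorComul grA hΔ), hl, h₃]
  refine LinearMap.ext fun t => K.tripleMap_injective hχ ?_
  simp only [LinearMap.comp_apply]
  rw [K.tripleMap_sigmaLeft hχ _ _ _ _ _ h₁₃ σ₁₂,
    K.tripleMap_sigmaRight hχ _ _ _ _ _ K.embed₂_eq_embed₃ σ₁₃,
    K.tripleMap_sigmaLeft hχ _ _ _ _ _ _ σ₂₃,
    K.tripleMap_sigmaRight hχ _ _ _ _ _ h₁₃ σ₂₃,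
    K.tripleMap_sigmaLeft hχ _ _ _ _ _ K.embed₁_eq_embed₂ σ₁₃,
    K.tripleMap_sigmaRight hχ _ _ _ _ _ _ σ₁₂]

end CompleteCalculus

end Braiding

/-! ## The inverse of the braiding -/

section Inverse

variable {k : Type*} [Field k] {H : Type*} [Ring H] [HopfAlgebra k H]
  {A : Type*} [Ring A] [Algebra k A]
  {ΩH : Type*} [Ring ΩH] [Algebra k ΩH] {grH : ℕ → Submodule k ΩH} [GradedAlgebra grH]
  {ΩA : Type*} [Ring ΩA] [Algebra k ΩA] {grA : ℕ → Submodule k ΩA} [GradedAlgebra grA]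
  {ρ : ComoduleAlgebra k H A} {cA : DiffCalculus A grA} {cH : DiffCalculus H grH}
  (K : CompleteCalculus ρ cA cH)

namespace CompleteCalculus

/-- For `φ : Ω(H) → Ω(H)`, the map `x ⊗ θ ↦ Δ(x) (1 ⊗ φ(θ))`. -/
def coactMul (φ : ΩH →ₗ[k] ΩH) : grA ᵍ⊗[k] grH →ₗ[k] grA ᵍ⊗[k] grH :=
  TensorProduct.lift ((LinearMap.mul k (grA ᵍ⊗[k] grH)).compl₁₂ K.coact.toLinearMap
    ((GradedTensorProduct.includeRight grA grH).toLinearMap ∘ₗ φ)) ∘ₗ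
    (GradedTensorProduct.of k grA grH).symm.toLinearMap

theorem coactMul_tmul (φ : ΩH →ₗ[k] ΩH) (x : ΩA) (θ : ΩH) :
    K.coactMul φ (x ᵍ⊗ₜ[k] θ) = K.coact x * ((1 : ΩA) ᵍ⊗ₜ[k] (φ θ)) := rfl

theorem coactMul_tmul_one_mul (φ : ΩH →ₗ[k] ΩH) (x : ΩA) (t : grA ᵍ⊗[k] grH) :
    K.coactMul φ ((x ᵍ⊗ₜ[k] (1 : ΩH)) * t) = K.coact x * K.coactMul φ t :=
  LinearMap.congr_fun (f := K.coactMul φ ∘ₗ LinearMap.mulLeft k (x ᵍ⊗ₜ[k] (1 : ΩH)))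
    (g := LinearMap.mulLeft k (K.coact x) ∘ₗ K.coactMul φ)
    (gradedTensor_ext fun i j y hy θ hθ => by
      change K.coactMul φ ((x ᵍ⊗ₜ[k] (1 : ΩH)) * (y ᵍ⊗ₜ[k] θ)) =
        K.coact x * K.coactMul φ (y ᵍ⊗ₜ[k] θ)
      rw [tmul_one_mul_tmul, coactMul_tmul, coactMul_tmul, map_mul, mul_assoc]) t

variable (grA) in
/-- The map `x ⊗ t ↦ x ⊗ m(t)` of `Ω(A) ⊗ (Ω(H) ⊗ Ω(H))` to `Ω(A) ⊗ Ω(H)`. -/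
def mergeRight (m : ΩH ⊗[k] ΩH →ₗ[k] ΩH) :
    grA ᵍ⊗[k] (tensorGr grH grH) →ₗ[k] grA ᵍ⊗[k] grH :=
  (GradedTensorProduct.of k grA grH).toLinearMap ∘ₗ
    TensorProduct.map LinearMap.id (m ∘ₗ (GradedTensorProduct.of k grH grH).symm.toLinearMap) ∘ₗ
    (GradedTensorProduct.of k grA (tensorGr grH grH)).symm.toLinearMap

theorem mergeRight_tmul (m : ΩH ⊗[k] ΩH →ₗ[k] ΩH) (x : ΩA) (t : grH ᵍ⊗[k] grH) :
    mergeRight grA m (x ᵍ⊗ₜ[k] t) =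
      x ᵍ⊗ₜ[k] (m ((GradedTensorProduct.of k grH grH).symm t)) := rfl

/-- The map `x ⊗ θ ↦ x₀ ⊗ φ(x₁) θ`. -/
def coactTwist (φ : ΩH →ₗ[k] ΩH) : grA ᵍ⊗[k] grH →ₗ[k] grA ᵍ⊗[k] grH :=
  mergeRight grA (mulMap φ LinearMap.id) ∘ₗ (gradedAssoc grA grH grH).toLinearMap ∘ₗ
    K.coactTensor.toLinearMap

theorem coactTwist_apply (φ : ΩH →ₗ[k] ΩH) (t : grA ᵍ⊗[k] grH) : K.coactTwist φ t =
    mergeRight grA (mulMap φ LinearMap.id) (gradedAssoc grA grH grH (K.coactTensor t)) := rfl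

theorem mergeRight_gradedAssoc_mul (φ : ΩH →ₗ[k] ΩH) (u : (tensorGr grA grH) ᵍ⊗[k] grH) (η : ΩH) :
    mergeRight grA (mulMap φ LinearMap.id)
        (gradedAssoc grA grH grH (u * ((1 : grA ᵍ⊗[k] grH) ᵍ⊗ₜ[k] η))) =
      mergeRight grA (mulMap φ LinearMap.id) (gradedAssoc grA grH grH u) *
        ((1 : ΩA) ᵍ⊗ₜ[k] η) := by
  have hm : ∀ (x : ΩA) (ζ θ : ΩH), mergeRight grA (mulMap φ LinearMap.id)
      (gradedAssoc grA grH grH ((x ᵍ⊗ₜ[k] ζ) ᵍ⊗ₜ[k] θ)) = x ᵍ⊗ₜ[k] (φ ζ * θ) := fun _ _ _ => rfl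
  suffices h : mergeRight grA (mulMap φ LinearMap.id) ∘ₗ (gradedAssoc grA grH grH).toLinearMap ∘ₗ
        LinearMap.mulRight k ((1 : grA ᵍ⊗[k] grH) ᵍ⊗ₜ[k] η) =
      LinearMap.mulRight k ((1 : ΩA) ᵍ⊗ₜ[k] η) ∘ₗ
        mergeRight grA (mulMap φ LinearMap.id) ∘ₗ (gradedAssoc grA grH grH).toLinearMap from
    LinearMap.congr_fun h u
  refine gradedTensor_ext₃ fun i j l x hx ζ hζ θ hθ => ?_
  simp only [LinearMap.comp_apply, LinearMap.mulRight_apply, AlgHom.toLinearMap_apply]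
  rw [tmul_mul_one_tmul, hm, hm, tmul_mul_one_tmul, mul_assoc]

theorem coactTwist_mul_one_tmul (φ : ΩH →ₗ[k] ΩH) (t : grA ᵍ⊗[k] grH) (η : ΩH) :
    K.coactTwist φ (t * ((1 : ΩA) ᵍ⊗ₜ[k] η)) = K.coactTwist φ t * ((1 : ΩA) ᵍ⊗ₜ[k] η) := by
  rw [coactTwist_apply, coactTwist_apply, map_mul K.coactTensor, coactTensor_tmul, map_one,
    mergeRight_gradedAssoc_mul]

theorem coactMul_eq (φ : ΩH →ₗ[k] ΩH) (t : grA ᵍ⊗[k] grH) : K.coactMul φ t =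
    mergeRight grA (mulMap LinearMap.id φ) (gradedAssoc grA grH grH (K.coactTensor t)) := by
  refine LinearMap.congr_fun (f := K.coactMul φ)
    (g := mergeRight grA (mulMap LinearMap.id φ) ∘ₗ (gradedAssoc grA grH grH).toLinearMap ∘ₗ
      K.coactTensor.toLinearMap) (gradedTensor_ext fun i j x hx θ hθ => ?_) t
  refine LinearMap.congr_fun (f := LinearMap.mulRight k ((1 : ΩA) ᵍ⊗ₜ[k] (φ θ)))
    (g := mergeRight grA (mulMap LinearMap.id φ) ∘ₗ gradedAssocLin grA grH grH ∘ₗ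
      (GradedTensorProduct.of k (tensorGr grA grH) grH).toLinearMap ∘ₗ
      (TensorProduct.mk k (grA ᵍ⊗[k] grH) ΩH).flip θ)
    (gradedTensor_ext fun i j y hy ζ hζ => ?_) (K.coact x)
  change (y ᵍ⊗ₜ[k] ζ : grA ᵍ⊗[k] grH) * ((1 : ΩA) ᵍ⊗ₜ[k] (φ θ)) = y ᵍ⊗ₜ[k] (ζ * φ θ)
  rw [tmul_mul_one_tmul]

variable {ΔH : ΩH →ₐ[k] grH ᵍ⊗[k] grH} (hΔ : IsExtendedComul cH ΔH)
  {ε : ΩH →ₐ[k] k} (hε : ∀ a, ε (cH.ι a) = Coalgebra.counit (R := k) a)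
  (hε' : ∀ n, ∀ θ ∈ grH (n + 1), ε θ = 0)

include hΔ hε hε' in
-- Coassociativity rewrites x₀ ⊗ m(x₁ ⊗ x₂) as the value of m on Δ(x₁); if that is the counit, x ⊗ 1
-- remains. Used for both antipode axioms.
theorem mergeRight_coassoc (m : ΩH ⊗[k] ΩH →ₗ[k] ΩH)
    (hm : ∀ θ, m ((GradedTensorProduct.of k grH grH).symm (ΔH θ)) = algebraMap k ΩH (ε θ))
    (x : ΩA) : mergeRight grA m (gradedAssoc grA grH grH (K.coactTensor (K.coact x))) =
      x ᵍ⊗ₜ[k] (1 : ΩH) := by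
  have h : ∀ t : grA ᵍ⊗[k] grH, mergeRight grA m (tensorComul grA hΔ t) =
      (tensorCounit grA hε' t) ᵍ⊗ₜ[k] (1 : ΩH) := fun t =>
    LinearMap.congr_fun
      (f := mergeRight grA m ∘ₗ (tensorComul grA hΔ).toLinearMap)
      (g := (GradedTensorProduct.includeLeft grA grH).toLinearMap ∘ₗ
        (tensorCounit grA hε').toLinearMap)
      (gradedTensor_ext fun i j y hy θ hθ => by
        change mergeRight grA m (tensorComul grA hΔ (y ᵍ⊗ₜ[k] θ)) =
          (tensorCounit grA hε' (y ᵍ⊗ₜ[k] θ)) ᵍ⊗ₜ[k] (1 : ΩH)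
        rw [tensorComul_tmul, mergeRight_tmul, hm, tensorCounit_tmul, ← Algebra.commutes,
          ← Algebra.smul_def, Algebra.algebraMap_eq_smul_one]
        simp only [GradedTensorProduct.tmul, TensorProduct.smul_tmul]) t
  rw [K.coact_coassoc hΔ, h, K.tensorCounit_coact hε]

variable {S : ΩH ≃ₗ[k] ΩH} (hS : IsGradedAntiHom cH (HopfAlgebra.antipode k) S.toLinearMap)

include hS hΔ hε hε' in
theorem coactMul_coact (x : ΩA) :
    K.coactMul S.toLinearMap (K.coact x) = x ᵍ⊗ₜ[k] (1 : ΩH) := by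
  rw [coactMul_eq, K.mergeRight_coassoc hΔ hε hε' _ (hS.mulMap_comul_right hΔ hε hε')]

include hS hΔ hε hε' in
theorem coactTwist_coact (x : ΩA) :
    K.coactTwist S.toLinearMap (K.coact x) = x ᵍ⊗ₜ[k] (1 : ΩH) := by
  rw [coactTwist_apply, K.mergeRight_coassoc hΔ hε hε' _ (hS.mulMap_comul_left hΔ hε hε')]

include hS hΔ hε hε' in
-- The twist x ⊗ θ ↦ x₀ ⊗ S(x₁) θ sends Δ(x)(1 ⊗ S(θ)) to x ⊗ S(θ) by the left antipode axiom;
-- applying S⁻¹ to the second factor gives a left inverse.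
theorem coactMul_injective : Function.Injective (K.coactMul S.toLinearMap) :=
  Function.LeftInverse.injective
    (g := gradedMap LinearMap.id S.symm.toLinearMap ∘ₗ K.coactTwist S.toLinearMap)
    (LinearMap.congr_fun (f := (gradedMap LinearMap.id S.symm.toLinearMap ∘ₗ
        K.coactTwist S.toLinearMap) ∘ₗ K.coactMul S.toLinearMap)
      (g := LinearMap.id) (gradedTensor_ext fun i j x hx θ hθ => by
        rw [LinearMap.comp_apply, LinearMap.comp_apply, coactMul_tmul, coactTwist_mul_one_tmul,
          K.coactTwist_coact hΔ hε hε' hS, GradedTensorProduct.tmul_one_mul_one_tmul,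
          gradedMap_tmul]
        simp))

variable (hχ : Function.Bijective K.chi)

include hS hΔ hε hε' in
-- On x ⊗ y the right-hand side is Δ(x) times the image of Δ(y), and that image is y ⊗ 1 by the
-- right antipode axiom.
theorem chi_sigma (z : K.E) : K.chi (K.sigma hχ z) = K.coactMul S.toLinearMap (K.chi z) :=
  LinearMap.congr_fun (f := K.chi ∘ₗ K.sigma hχ) (g := K.coactMul S.toLinearMap ∘ₗ K.chi)
    (Bal.hom_ext _ fun x y => by
      rw [LinearMap.comp_apply, LinearMap.comp_apply, chi_sigma_tmul, chi_tmul,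
        coactMul_tmul_one_mul, K.coactMul_coact hΔ hε hε' hS]) z

theorem chi_sigma_op_smul (x : ΩA) (z : K.E) :
    K.chi (K.sigma hχ (MulOpposite.op x • z)) =
      K.chi (K.sigma hχ z) * (x ᵍ⊗ₜ[k] (1 : ΩH)) :=
  LinearMap.congr_fun (f := K.chi ∘ₗ K.sigma hχ ∘ₗ Bal.rightMul K.base ΩA ΩA (MulOpposite.op x))
    (g := LinearMap.mulRight k (x ᵍ⊗ₜ[k] (1 : ΩH)) ∘ₗ K.chi ∘ₗ K.sigma hχ)
    (Bal.hom_ext _ fun y y' => by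
      change K.chi (K.sigma hχ (Bal.tmul K.base y (y' * x))) =
        K.chi (K.sigma hχ (Bal.tmul K.base y y')) * (x ᵍ⊗ₜ[k] (1 : ΩH))
      rw [chi_sigma_tmul, chi_sigma_tmul, mul_assoc, tmul_one_mul_tmul]) z

include hS hΔ hε hε' in
theorem sigma_sigmaInv (z : K.E) : K.sigma hχ (K.sigmaInv hχ S z) = z := by
  let N : grH ᵍ⊗[k] grA →ₗ[k] K.E := TensorProduct.lift (LinearMap.mk₂ k
    (fun (θ : ΩH) (x : ΩA) => MulOpposite.op x • K.tau hχ (S.symm θ))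
    (fun θ θ' x => by rw [map_add, map_add, smul_add])
    (fun c θ x => by
      rw [map_smul, map_smul]
      exact map_smul (Bal.rightMul K.base ΩA ΩA (MulOpposite.op x)) c _)
    (fun θ x y => add_smul (MulOpposite.op x) (MulOpposite.op y) (K.tau hχ (S.symm θ)))
    (fun c θ x => LinearMap.congr_fun (Bal.rightMul_smul K.base c (MulOpposite.op x))
      (K.tau hχ (S.symm θ)))) ∘ₗ (GradedTensorProduct.of k grH grA).symm.toLinearMap
  have hN : ∀ w, K.sigmaInv hχ S w = N (GradedTensorProduct.comm grA grH (K.chi w)) := fun _ => rfl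
  apply hχ.1
  rw [hN]
  refine LinearMap.congr_fun (f := K.chi ∘ₗ K.sigma hχ ∘ₗ N ∘ₗ
      (GradedTensorProduct.comm grA grH).toLinearMap) (g := LinearMap.id)
    (gradedTensor_ext fun i j x hx θ hθ => ?_) (K.chi z)
  have h₁ : GradedTensorProduct.comm grA grH (x ᵍ⊗ₜ[k] θ) = (-1 : k) ^ (j * i) • (θ ᵍ⊗ₜ[k] x) := by
    refine (GradedTensorProduct.comm_coe_tmul_coe grA grH ⟨x, hx⟩ ⟨θ, hθ⟩).trans ?_
    rcases Nat.even_or_odd (j * i) with h | h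
    · rw [h.neg_one_pow, h.neg_one_pow, one_smul, one_smul]
    · rw [h.neg_one_pow, h.neg_one_pow, Units.neg_smul, one_smul, neg_one_smul]
  -- χσ sends τ(S⁻¹(θ)) to 1 ⊗ θ and is right linear for · ⊗ 1, so N(θ ⊗ x) goes to (1 ⊗ θ)(x ⊗ 1);
  -- its Koszul sign cancels the one of the flip.
  have h₂ : K.chi (K.sigma hχ (N (θ ᵍ⊗ₜ[k] x))) =
      ((1 : ΩA) ᵍ⊗ₜ[k] θ) * (x ᵍ⊗ₜ[k] (1 : ΩH)) := by
    change K.chi (K.sigma hχ (MulOpposite.op x • K.tau hχ (S.symm θ))) = _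
    rw [chi_sigma_op_smul, K.chi_sigma hΔ hε hε' hS, chi_tau, coactMul_tmul, map_one, one_mul]
    simp
  change K.chi (K.sigma hχ (N (GradedTensorProduct.comm grA grH (x ᵍ⊗ₜ[k] θ)))) = x ᵍ⊗ₜ[k] θ
  rw [h₁, map_smul, map_smul, map_smul, h₂, tmul_mul_tmul_of_mem _ hθ hx, smul_smul, one_mul,
    mul_one, ← mul_pow]
  simp

include hS hΔ hε hε' in
theorem sigmaInv_sigma (z : K.E) : K.sigmaInv hχ S (K.sigma hχ z) = z := by
  -- A right inverse of an injective map is two-sided, so no second computation with `sigmaInv` is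
  -- needed.
  have hinj : Function.Injective (K.sigma hχ) := fun z w h => hχ.1
    (K.coactMul_injective hΔ hε hε' hS (by
      rw [← K.chi_sigma hΔ hε hε' hS hχ, ← K.chi_sigma hΔ hε hε' hS hχ, h]))
  exact hinj (K.sigma_sigmaInv hΔ hε hε' hS hχ _)

end CompleteCalculus

end Inverse

end

end QPB

theorem proposition5p6 {k : Type*} [Field k]
    -- the structure Hopf algebra, with invertible antipode
    {H : Type*} [Ring H] [HopfAlgebra k H]
    (hS : Function.Bijective (HopfAlgebra.antipode k : H →ₗ[k] H))
    -- the quantum principal bundle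
    {A : Type*} [Ring A] [Algebra k A] (ρ : QPB.ComoduleAlgebra k H A)
    (hρ : ρ.IsQuantumPrincipalBundle)
    -- the maximal prolongation of a bicovariant first order calculus on `H`
    {Γ : Type*} [AddCommGroup Γ] [Module k Γ] [Module H Γ] [Module Hᵐᵒᵖ Γ]
    [IsScalarTower k H Γ] [IsScalarTower k Hᵐᵒᵖ Γ] [SMulCommClass H Hᵐᵒᵖ Γ]
    (F : QPB.FODC k H Γ) (hF : F.IsBicovariant)
    {ΩH : Type*} [Ring ΩH] [Algebra k ΩH] (grH : ℕ → Submodule k ΩH) [GradedAlgebra grH]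
    (cH : QPB.DiffCalculus H grH) (hcH : QPB.IsMaximalProlongation F cH)
    -- the complete calculus on `A`
    {ΩA : Type*} [Ring ΩA] [Algebra k ΩA] (grA : ℕ → Submodule k ΩA) [GradedAlgebra grA]
    (cA : QPB.DiffCalculus A grA) (K : QPB.CompleteCalculus ρ cA cH) :
    ∃ hχ : Function.Bijective K.chi,
      -- i.) `χ` and `τ` are morphisms of differential graded algebras
      ((K.pullbackDGA hχ).IsDGA ∧
        QPB.DGAData.IsHom (K.pullbackDGA hχ) (QPB.tensorDGA cA cH) K.chi ∧
        QPB.DGAData.IsHom cH.dga (K.pullbackDGA hχ) (K.tau hχ)) ∧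
      -- ii.) `σ` is a graded isomorphism of `Ω(B)`-bimodules, with an explicit inverse
      ((∀ n, ∀ z ∈ K.grE n, K.sigma hχ z ∈ K.grE n) ∧
        (∀ (b : K.base) (z : K.E), K.sigma hχ (b • z) = b • K.sigma hχ z) ∧
        (∀ (b : K.base) (z : K.E), K.sigma hχ (MulOpposite.op (b : ΩA) • z) =
          MulOpposite.op (b : ΩA) • K.sigma hχ z) ∧
        ∃ (Δ : ΩH →ₐ[k] grH ᵍ⊗[k] grH) (S : ΩH ≃ₗ[k] ΩH),
          QPB.IsExtendedComul cH Δ ∧ QPB.IsGradedAntipode cH Δ S.toLinearMap ∧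
          (∀ (n : ℕ) (a : H) (b : Fin n → H),
            S (cH.ι a * (List.ofFn fun i => cH.d (cH.ι (b i))).prod) =
              (-1 : k) ^ n.choose 2 •
                ((List.ofFn fun i => cH.d (cH.ι (HopfAlgebra.antipode k (b i)))).reverse.prod *
                  cH.ι (HopfAlgebra.antipode k a))) ∧
          (∀ z, K.sigmaInv hχ S (K.sigma hχ z) = z) ∧
          (∀ z, K.sigma hχ (K.sigmaInv hχ S z) = z)) ∧
      -- iii.) the braid equation
      (K.sigmaLeft hχ ∘ₗ K.sigmaRight hχ ∘ₗ K.sigmaLeft hχ =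
        K.sigmaRight hχ ∘ₗ K.sigmaLeft hχ ∘ₗ K.sigmaRight hχ) ∧
      -- iv.) graded braided-commutativity
      (K.wedge ∘ₗ K.sigma hχ = K.wedge) ∧
      -- v.) the hexagon identities
      (K.sigma hχ ∘ₗ K.wedgeLeft = K.wedgeRight ∘ₗ K.sigmaLeft hχ ∘ₗ K.sigmaRight hχ ∧
        K.sigma hχ ∘ₗ K.wedgeRight = K.wedgeLeft ∘ₗ K.sigmaRight hχ ∘ₗ K.sigmaLeft hχ) := by
  have hχ := K.bijective_chi hS hρ hF hcH
  obtain ⟨R⟩ := id hF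
  obtain ⟨Δ, hΔ⟩ := hcH.exists_extendedComul R
  obtain ⟨ε, hε, hε'⟩ := hcH.exists_counit
  obtain ⟨S, hS'⟩ := hcH.exists_antipode hF hS
  exact ⟨hχ, ⟨K.pullbackDGA_isDGA hχ, K.chi_isHom hχ, K.tau_isHom hχ⟩,
    ⟨K.sigma_mem hχ, K.sigma_smul hχ, K.sigma_op_smul hχ, Δ, S, hΔ,
      hS'.isGradedAntipode hΔ hε hε', hS'.map_form HopfAlgebra.antipode_one,
      K.sigmaInv_sigma hΔ hε hε' hS' hχ, K.sigma_sigmaInv hΔ hε hε' hS' hχ⟩,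
    K.braid_equation hχ hΔ, K.wedge_comp_sigma hχ hε hε',
    K.sigma_comp_wedgeLeft hχ, K.sigma_comp_wedgeRight hχ⟩
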